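/- Let $N(m,n)$ be the number of partitions of $n$ with rank $m$ (rank = largest part minus number of parts, the empty partition having rank $0$). Let $M(m,n)$, for $n\neq 1$, be the number of partitions of $n$ with crank $m$ (the crank is the largest part if there are no ones, and otherwise the number of parts larger than the number of ones, minus the number of ones; the empty partition has crank $0$), and put $M(-1,1)=M(1,1)=1$, $M(0,1)=-1$ and $M(m,1)=0$ for all other $m$. Write $(a)_n=\prod_{i=0}^{n-1}(1-aq^i)$ and $(q)_\infty=\prod_{n\ge1}(1-q^n)$, and let $$R(z,q)=1+\sum_{n\ge1}\frac{q^{n^2}}{(zq)_n(z^{-1}q)_n},\qquad C(z,q)=\prod_{n\ge1}\frac{1-q^n}{(1-zq^n)(1-z^{-1}q^n)}.$$ For $z\ne1$ let $R^*(z,q)=\frac{R(z,q)}{1-z}$ and $C^*(z,q)=\frac{C(z,q)}{1-z}$; let $\delta_z=z\frac{\partial}{\partial z}$ and $\delta_q=q\frac{\partial}{\partial q}$. **Theorem 1.1 (the rank–crank PDE).** Let $z,q\in\mathbb C$ with $|q|<1$, $z\neq0$, and $zq^n\ne1$, $z^{-1}q^n\neq1$ for all $n\ge1$. (i) If moreover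 $|zq|<1$ and $|z^{-1}q|<1$, then $R$ and $C$ are the rank and crank generating functions: $R(z,q)=\sum_{n\ge0}\sum_{m\in\mathbb Z}N(m,n)z^mq^n$ and $C(z,q)=\sum_{n\ge0}\sum_{m\in\mathbb Z}M(m,n)z^mq^n$, both double series being absolutely convergent. (ii) $R$ is analytic in $z$ and analytic in $q$ at the point $(z,q)$ (each with the other variable fixed). (iii) If $z\ne1$, then $$z\,(q)_\infty^2\,[C^*(z,q)]^3=\Bigl(3\delta_q+\tfrac12\delta_z+\tfrac12\delta_z^2\Bigr)R^*(z,q).$$ (iv) For all such $z$ (including $z=1$), $$z\,(q)_\infty^2\,[C(z,q)]^3=\Bigl(3(1-z)^2\delta_q+\tfrac12(1-z)^2\delta_z^2-\tfrac12(z^2-1)\delta_z+z\Bigr)R(z,q).$$ -/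

import Mathlib

noncomputable section

namespace RankCrank

/-- The largest part of a partition (`0` for the empty partition). -/
def largestPart {n : ℕ} (p : n.Partition) : ℕ := p.parts.sup

/-- Dyson's rank of a partition: the largest part minus the number of parts. -/
def rank {n : ℕ} (p : n.Partition) : ℤ := (largestPart p : ℤ) - (p.parts.card : ℤ)

/-- The number of ones in a partition. -/
def numOnes {n : ℕ} (p : n.Partition) : ℕ := p.parts.count 1

/-- The Andrews–Garvan crank of a partition: the largest part if there are no ones, and otherwise
the number of parts larger than the number of ones, minus the number of ones. -/
def crank {n : ℕ} (p : n.Partition) : ℤ :=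
  if numOnes p = 0 then (largestPart p : ℤ)
  else (p.parts.countP (fun k => numOnes p < k) : ℤ) - (numOnes p : ℤ)

/-- `N(m,n)`: the number of partitions of `n` with rank `m`. -/
def N (m : ℤ) (n : ℕ) : ℕ :=
  (Finset.univ.filter (fun p : n.Partition => rank p = m)).card

/-- `M(m,n)`: the number of partitions of `n` with crank `m`, amended for `n = 1` in the usual way:
`M(-1,1) = M(1,1) = 1`, `M(0,1) = -1`, and `M(m,1) = 0` otherwise. -/
def M (m : ℤ) (n : ℕ) : ℤ :=
  if n = 1 then (if m = 0 then -1 else if m = 1 ∨ m = -1 then 1 else 0)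
  else ((Finset.univ.filter (fun p : n.Partition => crank p = m)).card : ℤ)

/-- `(a;q)_n = (1 - a)(1 - aq)⋯(1 - aq^{n-1})`. -/
def qPoch (a q : ℂ) (n : ℕ) : ℂ := ∏ i ∈ Finset.range n, (1 - a * q ^ i)

/-- `(a;q)_∞ = ∏_{i ≥ 0} (1 - aq^i)`. -/
def qPochInf (a q : ℂ) : ℂ := ∏' i : ℕ, (1 - a * q ^ i)

/-- `R(z,q) = 1 + ∑_{n ≥ 1} q^{n²} / ((zq)_n (z⁻¹q)_n)`; the sum is indexed by `n - 1`. -/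
def R (z q : ℂ) : ℂ :=
  1 + ∑' n : ℕ, q ^ ((n + 1) ^ 2) / (qPoch (z * q) q (n + 1) * qPoch (z⁻¹ * q) q (n + 1))

/-- `C(z,q) = ∏_{n ≥ 1} (1 - q^n) / ((1 - zq^n)(1 - z⁻¹q^n))`; the product is indexed by
`n - 1`. -/
def C (z q : ℂ) : ℂ :=
  ∏' n : ℕ, (1 - q ^ (n + 1)) / ((1 - z * q ^ (n + 1)) * (1 - z⁻¹ * q ^ (n + 1)))

/-- `R*(z,q) = R(z,q) / (1 - z)`. -/
def Rstar (z q : ℂ) : ℂ := R z q / (1 - z)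

/-- `C*(z,q) = C(z,q) / (1 - z)`. -/
def Cstar (z q : ℂ) : ℂ := C z q / (1 - z)

/-- The operator `δ_z = z ∂/∂z`. -/
def deltaZ (F : ℂ → ℂ → ℂ) : ℂ → ℂ → ℂ := fun z q => z * deriv (fun w => F w q) z

/-- The operator `δ_q = q ∂/∂q`. -/
def deltaQ (F : ℂ → ℂ → ℂ) : ℂ → ℂ → ℂ := fun z q => q * deriv (fun t => F z t) q

end RankCrank

end

namespace RankCrank

open Filter Topology Finset

/-! ### Finite and infinite q-Pochhammer products. -/

section Pochhammer

variable {a q : ℂ}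

/-! The PDE compares two expansions of one meromorphic function of z. Write E = (q)_∞ and A_k(z) = ∑
(-1)^n q^{n(3n+1)/2} (1 - zq^n)^{-k}, the sum being over all integers n.

Rank side: the partial fractions of 1/((1-z)(zq)_n(q/z)_n) (`tsum_partialFraction`), inserted in the
limiting Bailey lemma (`hasSum_bailey`), give R* = A_1/E (`R_eq_appellSum`).

Crank side: G(z) = zE³(C*)³ equals zE⁶/θ(z)³ (`cubeQuot`) with θ(zq) = -θ(z)/z, so G(zq) = -qz³G(z).
Hence the triple poles of G at the powers of q are all copies of the one at 1, and the multipliers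
are exactly the pentagonal coefficients of A_k (`cubeQuot_mul_zpow`). The symmetry w ↦ 1/w kills a
Taylor coefficient at 1, which leaves a single unknown constant c in all the principal parts
(`exists_polarPart`). The difference of G and the series of its principal parts extends analytically
to z ≠ 0, is bounded on the circles |z| = |q|^{n+1/2}, and tends to 0 along them at infinity; it
vanishes by the maximum principle (`eq_zero_of_oddCircles`). Letting z → 0 along the circles,
together with the pentagonal number theorem, yields c = -3 δ_q(E)/E.

Comparison: the principal parts sum to A_3 - A_2 + 3 δ_q A_1 + c A_1
(`AppellDomain.polarSeries_eq`). Since δ_z y^k = k(y^{k+1} - y^k) for y = 1/(1 - zq^n), the operator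
(δ_z + δ_z²)/2 sends A_1 to A_3 - A_2, while the value of c turns 3 δ_q A_1 + c A_1 into 3E
δ_q(A_1/E). Dividing by E gives the PDE for R*; the product rule for R = (1-z)R* gives the other
form. The cases q = 0 and z = 1 are computed directly.

Generating functions: partitions are grouped by largest part (rank), or by largest part or number of
ones (crank). Each group is summed by Euler products over multisets, and the groups are added by the
Rogers–Fine identity for R and by the q-binomial theorem for C. The same closed forms at |z|, |q|
supply absolute convergence (`hasSum_of_fibers`). -/

theorem qPoch_zero (a q : ℂ) : qPoch a q 0 = 1 := by simp [qPoch]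

theorem qPoch_succ (a q : ℂ) (n : ℕ) : qPoch a q (n + 1) = qPoch a q n * (1 - a * q ^ n) := by
  simp [qPoch, prod_range_succ]

theorem qPoch_add (a q : ℂ) (m n : ℕ) :
    qPoch a q (m + n) = qPoch a q m * qPoch (a * q ^ m) q n := by
  simp only [qPoch, prod_range_add, mul_assoc, pow_add]

theorem qPoch_succ_left (a q : ℂ) (n : ℕ) :
    qPoch a q (n + 1) = (1 - a) * qPoch (a * q) q n := by
  rw [add_comm, qPoch_add, pow_one]
  simp [qPoch]

theorem qPoch_ne_zero (h : ∀ i, a * q ^ i ≠ 1) (n : ℕ) : qPoch a q n ≠ 0 :=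
  prod_ne_zero_iff.2 fun i _ => sub_ne_zero.2 (h i).symm

theorem summable_norm_mul_pow (hq : ‖q‖ < 1) (a : ℂ) : Summable fun i : ℕ => ‖a * q ^ i‖ := by
  simp only [norm_mul, norm_pow]
  exact (summable_geometric_of_lt_one (norm_nonneg _) hq).mul_left _

theorem multipliable_one_sub_mul_pow (hq : ‖q‖ < 1) (a : ℂ) :
    Multipliable fun i : ℕ => 1 - a * q ^ i := by
  simp only [sub_eq_add_neg]
  exact multipliable_one_add_of_summable (by simpa using summable_norm_mul_pow hq a)

theorem tendsto_qPoch (hq : ‖q‖ < 1) (a : ℂ) :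
    Tendsto (qPoch a q) atTop (𝓝 (qPochInf a q)) :=
  (multipliable_one_sub_mul_pow hq a).hasProd.tendsto_prod_nat

theorem qPochInf_ne_zero (hq : ‖q‖ < 1) (h : ∀ i, a * q ^ i ≠ 1) : qPochInf a q ≠ 0 := by
  unfold qPochInf
  simp only [sub_eq_add_neg]
  refine tprod_one_add_ne_zero_of_summable (fun i => ?_) (by simpa using summable_norm_mul_pow hq a)
  rw [← sub_eq_add_neg]
  exact sub_ne_zero.2 (h i).symm

theorem qPochInf_eq_qPoch_mul (hq : ‖q‖ < 1) (a : ℂ) (n : ℕ) :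
    qPochInf a q = qPoch a q n * qPochInf (a * q ^ n) q := by
  have h1 := (tendsto_qPoch hq a).comp (tendsto_add_atTop_nat n)
  have h2 := (tendsto_qPoch hq (a * q ^ n)).const_mul (qPoch a q n)
  refine tendsto_nhds_unique h1 (h2.congr fun m => ?_)
  simp [← qPoch_add, add_comm]

theorem qPochInf_eq_one_sub_mul (hq : ‖q‖ < 1) (a : ℂ) :
    qPochInf a q = (1 - a) * qPochInf (a * q) q := by
  simpa [qPoch] using qPochInf_eq_qPoch_mul hq a 1

theorem mul_pow_ne_one_of_norm_lt (hq : ‖q‖ < 1) (ha : ‖a‖ < 1) (i : ℕ) : a * q ^ i ≠ 1 := by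
  intro h
  have : ‖a * q ^ i‖ < 1 := by
    rw [norm_mul, norm_pow]
    exact mul_lt_one_of_nonneg_of_lt_one_left (norm_nonneg _) ha
      (pow_le_one₀ (norm_nonneg _) hq.le)
  simp [h] at this

theorem exists_norm_qPoch_le (hq : ‖q‖ < 1) (a : ℂ) : ∃ K : ℝ, 0 < K ∧ ∀ n, ‖qPoch a q n‖ ≤ K := by
  obtain ⟨K, hK⟩ := (tendsto_qPoch hq a).norm.bddAbove_range
  exact ⟨max K 1, by positivity, fun n => le_max_of_le_left (hK ⟨n, rfl⟩)⟩

theorem exists_norm_inv_qPoch_le (hq : ‖q‖ < 1) (h : ∀ i, a * q ^ i ≠ 1) :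
    ∃ K : ℝ, 0 < K ∧ ∀ n, ‖(qPoch a q n)⁻¹‖ ≤ K := by
  obtain ⟨K, hK⟩ := ((tendsto_qPoch hq a).inv₀ (qPochInf_ne_zero hq h)).norm.bddAbove_range
  exact ⟨max K 1, by positivity, fun n => le_max_of_le_left (hK ⟨n, rfl⟩)⟩

end Pochhammer

/-! ### The Rogers–Fine identity with a vanishing parameter. -/

section Fine

variable {q β τ : ℂ}

theorem summable_pow_div_qPoch (hq : ‖q‖ < 1) (hτ : ‖τ‖ < 1) (hβ : ∀ i, β * q ^ i ≠ 1) :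
    Summable fun n => ‖τ ^ n / qPoch β q n‖ := by
  obtain ⟨K, hK, h⟩ := exists_norm_inv_qPoch_le hq hβ
  refine .of_nonneg_of_le (fun _ => norm_nonneg _) (fun n => ?_)
    ((summable_geometric_of_lt_one (norm_nonneg _) hτ).mul_right K)
  rw [div_eq_mul_inv, norm_mul, norm_pow]
  gcongr
  exact h n

/-- Split off the term n = 0 and use 1/(β)_{n+1} - 1/(β)_n = βq^n/(β)_{n+1} with (β)_{n+1} =
(1-β)(βq)_n. This relates the parameters (β, τ) to (βq, τq), so it can be iterated. -/
theorem tsum_pow_div_qPoch_step (hq : ‖q‖ < 1) (hτ : ‖τ‖ < 1) (hβ : ∀ i, β * q ^ i ≠ 1) :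
    ∑' n, τ ^ n / qPoch β q n =
      1 / (1 - τ) + β * τ / ((1 - β) * (1 - τ)) * ∑' n, (τ * q) ^ n / qPoch (β * q) q n := by
  have hβ' : ∀ i, β * q * q ^ i ≠ 1 := fun i => by
    have := hβ (i + 1); rwa [pow_succ', ← mul_assoc] at this
  have hb : 1 - β ≠ 0 := sub_ne_zero.2 (by simpa using (hβ 0).symm)
  have ht : 1 - τ ≠ 0 := sub_ne_zero.2 (by rintro rfl; simp at hτ)
  have hs := (summable_pow_div_qPoch hq hτ hβ).of_norm
  have hτq : ‖τ * q‖ < 1 := by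
    rw [norm_mul]; exact mul_lt_one_of_nonneg_of_lt_one_left (norm_nonneg _) hτ hq.le
  have hs' := (summable_pow_div_qPoch hq hτq hβ').of_norm
  have h1 : ∑' n, τ ^ n / qPoch β q n = 1 + ∑' n, τ ^ (n + 1) / qPoch β q (n + 1) := by
    rw [hs.tsum_eq_zero_add]; simp [qPoch_zero]
  have h2 : ∑' n, τ ^ (n + 1) / qPoch β q (n + 1) =
      ∑' n, (τ * (τ ^ n / qPoch β q n) + τ * β / (1 - β) * ((τ * q) ^ n / qPoch (β * q) q n)) := by
    congr 1; ext n
    have e1 := qPoch_ne_zero hβ n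
    have e2 := qPoch_ne_zero hβ' n
    have e3 := sub_ne_zero.2 (hβ n).symm
    have e4 : qPoch β q n * (1 - β * q ^ n) = (1 - β) * qPoch (β * q) q n := by
      rw [← qPoch_succ, qPoch_succ_left]
    have e5 : τ ^ (n + 1) / qPoch β q (n + 1) - τ * (τ ^ n / qPoch β q n) =
        τ ^ (n + 1) * (β * q ^ n) / (qPoch β q n * (1 - β * q ^ n)) := by
      rw [qPoch_succ]; field_simp; ring
    rw [← sub_eq_iff_eq_add', e5, e4]
    field_simp
    ring
  rw [h2, (hs.mul_left _).tsum_add (hs'.mul_left _), tsum_mul_left, tsum_mul_left] at h1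
  field_simp
  field_simp at h1
  linear_combination h1

theorem tsum_pow_div_qPoch_eq_sum (hq : ‖q‖ < 1) (hτ : ‖τ‖ < 1) (hβ : ∀ i, β * q ^ i ≠ 1) (N : ℕ) :
    ∑' n, τ ^ n / qPoch β q n =
      ∑ n ∈ range N, (β * τ) ^ n * q ^ (n * (n - 1)) / (qPoch β q n * qPoch τ q (n + 1)) +
      (β * τ) ^ N * q ^ (N * (N - 1)) / (qPoch β q N * qPoch τ q N) *
        ∑' n, (τ * q ^ N) ^ n / qPoch (β * q ^ N) q n := by
  induction N with
  | zero => simp [qPoch_zero]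
  | succ N ih =>
    have hβ' : ∀ i, β * q ^ N * q ^ i ≠ 1 := fun i => by
      have := hβ (N + i); rwa [pow_add, ← mul_assoc] at this
    have hτ' : ‖τ * q ^ N‖ < 1 := by
      rw [norm_mul, norm_pow]
      exact mul_lt_one_of_nonneg_of_lt_one_left (norm_nonneg _) hτ (pow_le_one₀ (norm_nonneg _) hq.le)
    rw [ih, tsum_pow_div_qPoch_step hq hτ' hβ', sum_range_succ, mul_add, add_assoc]
    have e1 := qPoch_ne_zero hβ N
    have e2 := qPoch_ne_zero (mul_pow_ne_one_of_norm_lt hq hτ) N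
    have e3 := sub_ne_zero.2 (hβ N).symm
    have e4 := sub_ne_zero.2 (mul_pow_ne_one_of_norm_lt hq hτ N).symm
    have e5 : q ^ ((N + 1) * (N + 1 - 1)) = q ^ (N * (N - 1)) * q ^ N * q ^ N := by
      rw [← pow_add, ← pow_add]; congr 1
      cases N with
      | zero => simp
      | succ k => simp only [Nat.add_sub_cancel]; ring
    have e6 : ∀ x : ℂ, x * q ^ N * q = x * q ^ (N + 1) := fun x => by ring
    rw [e6, e6]
    congr 1
    congr 1
    · rw [qPoch_succ]; field_simp
    · rw [qPoch_succ, qPoch_succ, e5, ← mul_assoc]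
      congr 1
      field_simp
      ring

/-- The case of the Rogers–Fine identity with one vanishing parameter. -/
theorem hasSum_rogersFine (hq : ‖q‖ < 1) (hτ : ‖τ‖ < 1) (hβ : ∀ i, β * q ^ i ≠ 1)
    (hβτ : ‖β * τ‖ < 1) :
    HasSum (fun n => (β * τ) ^ n * q ^ (n * (n - 1)) / (qPoch β q n * qPoch τ q (n + 1)))
      (∑' n, τ ^ n / qPoch β q n) := by
  obtain ⟨K, hK, hKb⟩ := exists_norm_inv_qPoch_le hq hβ
  obtain ⟨L, hL, hLb⟩ := exists_norm_inv_qPoch_le hq (mul_pow_ne_one_of_norm_lt hq hτ)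
  obtain ⟨B, hB, hBb⟩ := exists_norm_qPoch_le hq β
  have hg := summable_geometric_of_lt_one (norm_nonneg _) hβτ
  have hgτ := summable_geometric_of_lt_one (norm_nonneg _) hτ
  have bound : ∀ n m, ‖(β * τ) ^ n * q ^ (n * (n - 1)) / (qPoch β q n * qPoch τ q m)‖ ≤
      ‖β * τ‖ ^ n * (K * L) := fun n m => by
    rw [div_eq_mul_inv, mul_inv, norm_mul, norm_mul, norm_mul, norm_pow, norm_pow]
    have := hKb n
    have := hLb m
    have : ‖q‖ ^ (n * (n - 1)) ≤ 1 := pow_le_one₀ (norm_nonneg _) hq.le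
    calc _ ≤ ‖β * τ‖ ^ n * 1 * (K * L) := by gcongr
      _ = _ := by ring
  have hs : Summable fun n =>
      (β * τ) ^ n * q ^ (n * (n - 1)) / (qPoch β q n * qPoch τ q (n + 1)) :=
    .of_norm_bounded (hg.mul_right _) fun n => bound n (n + 1)
  rw [hs.hasSum_iff_tendsto_nat]
  -- The tail series are bounded uniformly in N because 1/(βq^N)_n = (β)_N/(β)_{N+n}, and both
  -- factors are bounded.
  have tail : ∀ N, ‖∑' n, (τ * q ^ N) ^ n / qPoch (β * q ^ N) q n‖ ≤ ∑' n, B * K * ‖τ‖ ^ n := by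
    intro N
    refine tsum_of_norm_bounded (hgτ.mul_left _).hasSum fun n => ?_
    have e : (qPoch (β * q ^ N) q n)⁻¹ = qPoch β q N * (qPoch β q (N + n))⁻¹ := by
      rw [qPoch_add, mul_inv, ← mul_assoc, mul_inv_cancel₀ (qPoch_ne_zero hβ N), one_mul]
    rw [div_eq_mul_inv, e, norm_mul, norm_mul, norm_pow, norm_mul, norm_pow]
    have h1 := hBb N
    have h2 := hKb (N + n)
    have : ‖q‖ ^ N ≤ 1 := pow_le_one₀ (norm_nonneg _) hq.le
    calc _ ≤ (‖τ‖ * 1) ^ n * (B * K) := by gcongr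
      _ = _ := by ring
  have hrem : Tendsto (fun N => (β * τ) ^ N * q ^ (N * (N - 1)) / (qPoch β q N * qPoch τ q N) *
        ∑' n, (τ * q ^ N) ^ n / qPoch (β * q ^ N) q n) atTop (𝓝 0) := by
    refine squeeze_zero_norm (a := fun N => ‖β * τ‖ ^ N * (K * L) * ∑' n, B * K * ‖τ‖ ^ n)
      (fun N => ?_) ?_
    · rw [norm_mul]
      exact mul_le_mul (bound N N) (tail N) (norm_nonneg _) (by positivity)
    · simpa using ((tendsto_pow_atTop_nhds_zero_of_lt_one (norm_nonneg _) hβτ).mul_const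
        (K * L)).mul_const (∑' n, B * K * ‖τ‖ ^ n)
  have := hrem.const_sub (∑' n, τ ^ n / qPoch β q n)
  rw [sub_zero] at this
  refine this.congr fun N => ?_
  rw [tsum_pow_div_qPoch_eq_sum hq hτ hβ N]
  ring

end Fine

/-! ### The q-binomial theorem and Durfee rectangles. -/

section QBinomial

variable {q : ℂ}

theorem mul_pow_self_ne_one (hq : ‖q‖ < 1) (i : ℕ) : q * q ^ i ≠ 1 :=
  mul_pow_ne_one_of_norm_lt hq hq i

/-- The `q`-binomial theorem. -/
theorem hasSum_qBinomial (hq : ‖q‖ < 1) (a : ℂ) {t : ℂ} (ht : ‖t‖ < 1) :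
    HasSum (fun n => qPoch a q n / qPoch q q n * t ^ n) (qPochInf (a * t) q / qPochInf t q) := by
  obtain ⟨K, hK, hKb⟩ := exists_norm_inv_qPoch_le hq (mul_pow_self_ne_one hq)
  obtain ⟨B, hB, hBb⟩ := exists_norm_qPoch_le hq a
  have bound : ∀ u : ℂ, ∀ n, ‖qPoch a q n / qPoch q q n * u ^ n‖ ≤ B * K * ‖u‖ ^ n := fun u n => by
    rw [div_eq_mul_inv, norm_mul, norm_mul, norm_pow]
    have := hBb n
    have := hKb n
    gcongr
  have hs : ∀ u : ℂ, ‖u‖ < 1 → Summable fun n => qPoch a q n / qPoch q q n * u ^ n := fun u hu =>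
    .of_norm_bounded ((summable_geometric_of_lt_one (norm_nonneg _) hu).mul_left _) (bound u)
  set F : ℂ → ℂ := fun u => ∑' n, qPoch a q n / qPoch q q n * u ^ n with hF
  have hlt : ∀ (N : ℕ) , ‖t * q ^ N‖ < 1 := fun N => by
    rw [norm_mul, norm_pow]
    exact mul_lt_one_of_nonneg_of_lt_one_left (norm_nonneg _) ht (pow_le_one₀ (norm_nonneg _) hq.le)
  -- The q-difference equation (1-u)F(u) = (1-au)F(uq); iterating it and using F(tq^N) → F(0) = 1
  -- produces the infinite products.
  have step : ∀ u : ℂ, ‖u‖ < 1 → ‖u * q‖ < 1 → (1 - u) * F u = (1 - a * u) * F (u * q) := by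
    intro u hu huq
    have h1 : F u - F (u * q) = u * (F u - a * F (u * q)) := by
      rw [hF]
      simp only
      rw [← (hs u hu).tsum_sub (hs _ huq), ← tsum_mul_left (a := a),
        ← (hs u hu).tsum_sub ((hs _ huq).mul_left _), ← tsum_mul_left,
        ((hs u hu).sub (hs _ huq)).tsum_eq_zero_add]
      simp only [pow_zero, sub_self, zero_add]
      congr 1; ext n
      have e1 := qPoch_ne_zero (mul_pow_self_ne_one hq) n
      have e2 := sub_ne_zero.2 (mul_pow_self_ne_one hq n).symm
      rw [qPoch_succ, qPoch_succ, mul_pow, mul_pow, pow_succ q n, mul_comm (q ^ n)]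
      generalize q * q ^ n = x at e2 ⊢
      field_simp
      ring
    linear_combination h1
  have iter : ∀ N, F t = qPoch (a * t) q N / qPoch t q N * F (t * q ^ N) := by
    intro N
    induction N with
    | zero => simp [qPoch_zero]
    | succ N ih =>
      have e1 := qPoch_ne_zero (mul_pow_ne_one_of_norm_lt hq ht) N
      have e2 := sub_ne_zero.2 (mul_pow_ne_one_of_norm_lt hq ht N).symm
      have h := step (t * q ^ N) (hlt N) (by simpa [pow_succ, mul_assoc] using hlt (N + 1))
      rw [ih, qPoch_succ, qPoch_succ, pow_succ, ← mul_assoc t]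
      field_simp
      linear_combination (qPoch (a * t) q N) * h
  have hlim : Tendsto (fun N => F (t * q ^ N)) atTop (𝓝 1) := by
    have h0 : Tendsto (fun N : ℕ => t * q ^ N) atTop (𝓝 0) := by
      simpa using (tendsto_pow_atTop_nhds_zero_of_norm_lt_one hq).const_mul t
    have := tendsto_tsum_of_dominated_convergence (𝓕 := atTop)
      (f := fun (N : ℕ) n => qPoch a q n / qPoch q q n * (t * q ^ N) ^ n)
      (g := fun n => qPoch a q n / qPoch q q n * 0 ^ n) (bound := fun n => B * K * ‖t‖ ^ n)
      ((summable_geometric_of_lt_one (norm_nonneg _) ht).mul_left _)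
      (fun n => (h0.pow n).const_mul _) (.of_forall fun N n => (bound _ n).trans ?_)
    · rw [tsum_eq_single 0 (fun n hn => by simp [hn])] at this
      simpa [qPoch_zero] using this
    · gcongr
      rw [norm_mul, norm_pow]
      exact mul_le_of_le_one_right (norm_nonneg _) (pow_le_one₀ (norm_nonneg _) hq.le)
  have h2 := ((tendsto_qPoch hq (a * t)).div (tendsto_qPoch hq t)
    (qPochInf_ne_zero hq (mul_pow_ne_one_of_norm_lt hq ht))).mul hlim
  have h3 : F t = qPochInf (a * t) q / qPochInf t q * 1 :=
    tendsto_nhds_unique (tendsto_const_nhds.congr iter) h2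
  rw [mul_one] at h3
  rw [← h3]
  exact (hs t ht).hasSum

/-- Euler's expansion of `1 / (t)_∞`. -/
theorem hasSum_pow_div_qPoch_self (hq : ‖q‖ < 1) {t : ℂ} (ht : ‖t‖ < 1) :
    HasSum (fun n => t ^ n / qPoch q q n) (1 / qPochInf t q) := by
  have := hasSum_qBinomial hq 0 ht
  have e : qPochInf 0 q = 1 := by simp [qPochInf]
  have e' : ∀ n, qPoch 0 q n = 1 := fun n => by simp [qPoch]
  simp only [zero_mul, e, e'] at this
  exact this.congr_fun (fun n => by ring)

/-- Cauchy's identity for Durfee rectangles. -/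
theorem hasSum_durfee (hq : ‖q‖ < 1) (k : ℕ) :
    HasSum (fun m => q ^ (m * m + m * k) / (qPoch q q m * qPoch q q (m + k)))
      (1 / qPochInf q q) := by
  have hβ : ∀ i, q ^ (k + 1) * q ^ i ≠ 1 := fun i => by
    have := mul_pow_self_ne_one hq (k + i)
    rwa [pow_add, ← mul_assoc, ← pow_succ'] at this
  set β := q ^ (k + 1) with hβd
  have hβ' : ∀ i, β * q * q ^ i ≠ 1 := fun i => by
    have := hβ (i + 1); rwa [pow_succ', ← mul_assoc] at this
  have hβ1 : ‖β‖ < 1 := by rw [norm_pow]; exact pow_lt_one₀ (norm_nonneg _) hq (by simp)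
  have hb : 1 - β ≠ 0 := sub_ne_zero.2 (by simpa using (hβ 0).symm)
  have hβqq : ‖β * q * q‖ < 1 := by
    rw [norm_mul, norm_mul]
    exact mul_lt_one_of_nonneg_of_lt_one_left (by positivity)
      (mul_lt_one_of_nonneg_of_lt_one_left (by positivity) hβ1 hq.le) hq.le
  -- With β = q^{k+1}, Rogers–Fine is applied at (βq, q). One side becomes the Durfee series without
  -- its m = 0 term, up to a factor.
  have h1 := hasSum_rogersFine hq hq hβ' hβqq
  have hsum := (summable_pow_div_qPoch hq hq hβ').of_norm
  -- The other side telescopes: βq^n/(β)_{n+1} = 1/(β)_{n+1} - 1/(β)_n.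
  have h2 : β / (1 - β) * ∑' n, q ^ n / qPoch (β * q) q n = 1 / qPochInf β q - 1 := by
    rw [← tsum_mul_left]
    refine HasSum.tsum_eq ?_
    rw [(hsum.mul_left _).hasSum_iff_tendsto_nat]
    have ht := ((tendsto_qPoch hq β).inv₀ (qPochInf_ne_zero hq hβ)).sub_const 1
    rw [← one_div] at ht
    refine ht.congr fun N => ?_
    have hN : (qPoch β q N)⁻¹ - 1 =
        ∑ n ∈ range N, ((qPoch β q (n + 1))⁻¹ - (qPoch β q n)⁻¹) := by
      rw [sum_range_sub fun n => (qPoch β q n)⁻¹]; simp [qPoch_zero]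
    rw [hN]
    refine sum_congr rfl fun n _ => ?_
    have e1 := qPoch_ne_zero hβ n
    have e3 := sub_ne_zero.2 (hβ n).symm
    have e2 := qPoch_ne_zero hβ' n
    have e4 : qPoch β q n * (1 - β * q ^ n) = (1 - β) * qPoch (β * q) q n := by
      rw [← qPoch_succ, qPoch_succ_left]
    have e5 : (qPoch β q (n + 1))⁻¹ - (qPoch β q n)⁻¹ =
        β * q ^ n / (qPoch β q n * (1 - β * q ^ n)) := by
      rw [qPoch_succ]; field_simp; ring
    rw [e5, e4]
    field_simp
  have h3 := (h1.mul_left (β / (1 - β))).mul_left (1 / qPoch q q k)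
  rw [h2] at h3
  have e0 := qPoch_ne_zero (mul_pow_self_ne_one hq) k
  have e1 := qPochInf_ne_zero hq hβ
  refine (hasSum_nat_add_iff' 1).1 ?_
  have hA : ∀ m, q ^ ((m + 1) * (m + 1) + (m + 1) * k) / (qPoch q q (m + 1) *
      qPoch q q (m + 1 + k)) = 1 / qPoch q q k * (β / (1 - β) * ((β * q * q) ^ m *
        q ^ (m * (m - 1)) / (qPoch (β * q) q m * qPoch q q (m + 1)))) := by
    intro m
    have e2 := qPoch_ne_zero (mul_pow_self_ne_one hq) (m + 1)
    have e3 := qPoch_ne_zero hβ' m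
    have e4 : qPoch q q (m + 1 + k) = qPoch q q k * ((1 - β) * qPoch (β * q) q m) := by
      rw [← qPoch_succ_left, add_comm (m + 1), qPoch_add, hβd, pow_succ']
    have e5 : q ^ ((m + 1) * (m + 1) + (m + 1) * k) =
        β * ((β * q * q) ^ m * q ^ (m * (m - 1))) := by
      rw [hβd, ← pow_succ, ← pow_succ, ← pow_mul, ← pow_add, ← pow_add]
      congr 1
      cases m with
      | zero => simp; ring
      | succ m => simp only [Nat.add_sub_cancel]; ring
    rw [e4, e5]
    field_simp
  have hB : 1 / qPochInf q q - ∑ i ∈ range 1, q ^ (i * i + i * k) /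
      (qPoch q q i * qPoch q q (i + k)) = 1 / qPoch q q k * (1 / qPochInf β q - 1) := by
    have e4 : qPochInf q q = qPoch q q k * qPochInf β q := by
      rw [qPochInf_eq_qPoch_mul hq q k, hβd, pow_succ']
    rw [e4]
    simp only [sum_range_one, zero_mul, zero_add, pow_zero, qPoch_zero, one_mul]
    field_simp
  rw [hB]
  exact h3.congr_fun hA

end QBinomial

/-! ### Locally uniform bounds away from the poles. -/

section UniformBounds

theorem norm_inv_one_sub_le_two {x : ℂ} (hx : ‖x‖ ≤ 1 / 2) : x ≠ 1 ∧ ‖(1 - x)⁻¹‖ ≤ 2 := by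
  have h : 1 / 2 ≤ ‖1 - x‖ := by
    have := norm_sub_norm_le (1 : ℂ) x
    rw [norm_one] at this
    linarith
  refine ⟨fun h1 => ?_, ?_⟩
  · rw [h1, sub_self, norm_zero] at h; norm_num at h
  · rw [norm_inv]
    exact (inv_anti₀ (by norm_num) h).trans (by norm_num)

/-- Off its poles, `1 / (1 - z q ^ n)` is bounded for `n ≥ 1`, locally uniformly in `(z, q)`. -/
theorem exists_eventually_norm_inv_le_nat {z₀ q₀ : ℂ} (hq : ‖q₀‖ < 1)
    (h : ∀ n : ℕ, z₀ * q₀ ^ (n + 1) ≠ 1) :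
    ∃ K : ℝ, 0 < K ∧ ∀ᶠ p : ℂ × ℂ in 𝓝 (z₀, q₀), ∀ n : ℕ,
      p.1 * p.2 ^ (n + 1) ≠ 1 ∧ ‖(1 - p.1 * p.2 ^ (n + 1))⁻¹‖ ≤ K := by
  obtain ⟨b, hqb, hb⟩ := exists_between hq
  have hb0 : 0 ≤ b := (norm_nonneg _).trans hqb.le
  -- Beyond N the products have norm below 1/2, so the inverse is at most 2; the finitely many
  -- remaining indices are handled by continuity.
  obtain ⟨N, hN⟩ : ∃ N, (‖z₀‖ + 1) * b ^ N < 1 / 2 := by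
    have := (tendsto_pow_atTop_nhds_zero_of_lt_one hb0 hb).const_mul (‖z₀‖ + 1)
    rw [mul_zero] at this
    exact (this.eventually (gt_mem_nhds (by norm_num))).exists
  have hsmall : ∀ᶠ p : ℂ × ℂ in 𝓝 (z₀, q₀), ∀ n ∈ range N,
      p.1 * p.2 ^ (n + 1) ≠ 1 ∧
        ‖(1 - p.1 * p.2 ^ (n + 1))⁻¹‖ < ‖(1 - z₀ * q₀ ^ (n + 1))⁻¹‖ + 1 := by
    rw [Filter.eventually_all_finset]
    intro n _
    have hc : ContinuousAt (fun p : ℂ × ℂ => p.1 * p.2 ^ (n + 1)) (z₀, q₀) := by fun_prop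
    have hc' : ContinuousAt (fun p : ℂ × ℂ => ‖(1 - p.1 * p.2 ^ (n + 1))⁻¹‖) (z₀, q₀) :=
      ((continuousAt_const.sub hc).inv₀ (sub_ne_zero.2 (h n).symm)).norm
    exact (hc.eventually_ne (h n)).and (hc'.eventually (gt_mem_nhds (lt_add_one _)))
  refine ⟨2 + ∑ n ∈ range N, (‖(1 - z₀ * q₀ ^ (n + 1))⁻¹‖ + 1), by positivity, ?_⟩
  have h1 : ∀ᶠ p : ℂ × ℂ in 𝓝 (z₀, q₀), ‖p.1‖ < ‖z₀‖ + 1 :=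
    continuousAt_fst.norm.eventually (gt_mem_nhds (lt_add_one _))
  have h2 : ∀ᶠ p : ℂ × ℂ in 𝓝 (z₀, q₀), ‖p.2‖ < b :=
    continuousAt_snd.norm.eventually (gt_mem_nhds hqb)
  filter_upwards [h1, h2, hsmall] with p hp1 hp2 hp3 n
  by_cases hn : n < N
  · have := hp3 n (mem_range.2 hn)
    refine ⟨this.1, this.2.le.trans ?_⟩
    have := single_le_sum (f := fun n => ‖(1 - z₀ * q₀ ^ (n + 1))⁻¹‖ + 1)
      (fun i _ => by positivity) (mem_range.2 hn)
    linarith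
  · have := norm_inv_one_sub_le_two (x := p.1 * p.2 ^ (n + 1)) (by
      rw [norm_mul, norm_pow]
      calc _ ≤ (‖z₀‖ + 1) * b ^ (n + 1) := by gcongr
        _ ≤ (‖z₀‖ + 1) * b ^ N :=
          mul_le_mul_of_nonneg_left (pow_le_pow_of_le_one hb0 hb.le (by omega)) (by positivity)
        _ ≤ _ := hN.le)
    refine ⟨this.1, this.2.trans ?_⟩
    have : 0 ≤ ∑ n ∈ range N, (‖(1 - z₀ * q₀ ^ (n + 1))⁻¹‖ + 1) := by positivity
    linarith

/-- The identity 1/(1 - w⁻¹) = -w/(1 - w) with w = x/z reduces negative powers of q to positive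
ones. -/
theorem inv_one_sub_mul_inv {z x : ℂ} (hz : z ≠ 0) (hx : x ≠ 0) (h : z⁻¹ * x ≠ 1) :
    z * x⁻¹ ≠ 1 ∧ (1 - z * x⁻¹)⁻¹ = -(z⁻¹ * x * (1 - z⁻¹ * x)⁻¹) := by
  have h1 : z * x⁻¹ = (z⁻¹ * x)⁻¹ := by rw [mul_inv, inv_inv]
  have hw : z⁻¹ * x ≠ 0 := mul_ne_zero (inv_ne_zero hz) hx
  rw [h1]
  generalize z⁻¹ * x = w at h hw
  refine ⟨by simpa using h, ?_⟩
  have e1 : 1 - w ≠ 0 := sub_ne_zero.2 h.symm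
  have e2 : w - 1 ≠ 0 := sub_ne_zero.2 h
  field_simp
  ring

/-- Off its poles, `1 / (1 - z q ^ n)` is bounded for `n : ℤ`, locally uniformly in `(z, q)`. -/
theorem exists_eventually_norm_inv_le {z₀ q₀ : ℂ} (hq : ‖q₀‖ < 1) (hq0 : q₀ ≠ 0) (hz : z₀ ≠ 0)
    (h : ∀ n : ℤ, z₀ * q₀ ^ n ≠ 1) :
    ∃ K : ℝ, 0 < K ∧ ∀ᶠ p : ℂ × ℂ in 𝓝 (z₀, q₀), ∀ n : ℤ,
      p.1 * p.2 ^ n ≠ 1 ∧ ‖(1 - p.1 * p.2 ^ n)⁻¹‖ ≤ K := by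
  have h0 : z₀ ≠ 1 := by simpa using h 0
  have hpos : ∀ n : ℕ, z₀ * q₀ ^ (n + 1) ≠ 1 := fun n => by
    simpa only [zpow_natCast] using h ((n + 1 : ℕ) : ℤ)
  have hneg : ∀ n : ℕ, z₀⁻¹ * q₀ ^ (n + 1) ≠ 1 := fun n h1 => by
    refine h (-((n + 1 : ℕ) : ℤ)) ?_
    rw [zpow_neg, zpow_natCast, ← inv_inv (z₀ * (q₀ ^ (n + 1))⁻¹), mul_inv, inv_inv, h1, inv_one]
  obtain ⟨K, hK, hKb⟩ := exists_eventually_norm_inv_le_nat hq hpos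
  obtain ⟨L, hL, hLb⟩ := exists_eventually_norm_inv_le_nat hq hneg
  have hf : ContinuousAt (fun p : ℂ × ℂ => p.1) (z₀, q₀) := continuousAt_fst
  have hs : ContinuousAt (fun p : ℂ × ℂ => p.2) (z₀, q₀) := continuousAt_snd
  have hi : ContinuousAt (fun p : ℂ × ℂ => p.1⁻¹) (z₀, q₀) := hf.inv₀ hz
  have hj : ContinuousAt (fun p : ℂ × ℂ => (1 - p.1)⁻¹) (z₀, q₀) :=
    (continuousAt_const.sub hf).inv₀ (sub_ne_zero.2 h0.symm)
  have hc : Tendsto (fun p : ℂ × ℂ => (p.1⁻¹, p.2)) (𝓝 (z₀, q₀)) (𝓝 (z₀⁻¹, q₀)) :=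
    hi.prodMk hs
  have hLb' := hc.eventually hLb
  have h1 : ∀ᶠ p : ℂ × ℂ in 𝓝 (z₀, q₀), ‖p.1⁻¹‖ < ‖z₀⁻¹‖ + 1 :=
    hi.norm.eventually (gt_mem_nhds (lt_add_one ‖z₀⁻¹‖))
  have h2 : ∀ᶠ p : ℂ × ℂ in 𝓝 (z₀, q₀), p.1 ≠ 1 := hf.eventually_ne h0
  have h3 : ∀ᶠ p : ℂ × ℂ in 𝓝 (z₀, q₀), ‖(1 - p.1)⁻¹‖ < ‖(1 - z₀)⁻¹‖ + 1 :=
    hj.norm.eventually (gt_mem_nhds (lt_add_one ‖(1 - z₀)⁻¹‖))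
  have h4 : ∀ᶠ p : ℂ × ℂ in 𝓝 (z₀, q₀), p.1 ≠ 0 := hf.eventually_ne hz
  have h5 : ∀ᶠ p : ℂ × ℂ in 𝓝 (z₀, q₀), p.2 ≠ 0 := hs.eventually_ne hq0
  have h6 : ∀ᶠ p : ℂ × ℂ in 𝓝 (z₀, q₀), ‖p.2‖ < 1 := hs.norm.eventually (gt_mem_nhds hq)
  refine ⟨K + (‖z₀⁻¹‖ + 1) * L + (‖(1 - z₀)⁻¹‖ + 1), by positivity, ?_⟩
  filter_upwards [hKb, hLb', h1, h2, h3, h4, h5, h6] with p pK pL p1 p2 p3 p4 p5 p6 n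
  have e1 : 0 ≤ (‖z₀⁻¹‖ + 1) * L := by positivity
  have e2 : 0 ≤ ‖(1 - z₀)⁻¹‖ + 1 := by positivity
  obtain ⟨m, rfl | rfl⟩ := n.eq_nat_or_neg
  · cases m with
    | zero =>
      simp only [Nat.cast_zero, zpow_zero, mul_one]
      exact ⟨p2, by linarith⟩
    | succ m =>
      rw [zpow_natCast]
      exact ⟨(pK m).1, by linarith [(pK m).2]⟩
  · cases m with
    | zero =>
      simp only [Nat.cast_zero, neg_zero, zpow_zero, mul_one]
      exact ⟨p2, by linarith⟩
    | succ m =>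
      obtain ⟨l1, l2⟩ := pL m
      rw [zpow_neg, zpow_natCast]
      obtain ⟨l3, l4⟩ := inv_one_sub_mul_inv p4 (pow_ne_zero (m + 1) p5) l1
      refine ⟨l3, ?_⟩
      rw [l4, norm_neg, norm_mul, norm_mul, norm_pow]
      have : ‖p.2‖ ^ (m + 1) ≤ 1 := pow_le_one₀ (norm_nonneg _) p6.le
      have l5 : ‖p.1⁻¹‖ * ‖p.2‖ ^ (m + 1) * ‖(1 - p.1⁻¹ * p.2 ^ (m + 1))⁻¹‖ ≤
          (‖z₀⁻¹‖ + 1) * 1 * L := by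
        refine mul_le_mul (mul_le_mul p1.le this (by positivity) (by positivity)) l2
          (by positivity) (by positivity)
      linarith

end UniformBounds

/-! ### The Bailey kernel and the partial fraction expansion. -/

section Bailey

/-- `1 / (q;q)_k`, understood as `0` for `k < 0`. -/
noncomputable def invPoch (q : ℂ) (k : ℤ) : ℂ := if 0 ≤ k then (qPoch q q k.toNat)⁻¹ else 0

/-- The alternating theta coefficient `(-1) ^ r q ^ (r (r - 1) / 2)`. -/
noncomputable def thetaCoeff (q : ℂ) (r : ℤ) : ℂ := (-1) ^ r * q ^ (r * (r - 1) / 2)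

variable {q : ℂ}

theorem invPoch_natCast (q : ℂ) (n : ℕ) : invPoch q n = (qPoch q q n)⁻¹ := by simp [invPoch]

theorem invPoch_of_neg (q : ℂ) {k : ℤ} (hk : k < 0) : invPoch q k = 0 := by
  simp [invPoch, hk]

/-- The convention 1/(q)_k = 0 for k < 0 makes this valid for every integer: at k = 0 the factor 1 -
q^k vanishes. All later shifts of the kernel can thus ignore boundary terms. -/
theorem invPoch_sub_one (hq : ‖q‖ < 1) (k : ℤ) :
    invPoch q (k - 1) = (1 - q ^ k) * invPoch q k := by
  rcases lt_trichotomy k 0 with h | rfl | h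
  · rw [invPoch_of_neg _ h, invPoch_of_neg _ (by omega), mul_zero]
  · simp [invPoch_of_neg]
  · obtain ⟨n, rfl⟩ : ∃ n : ℕ, k = (n + 1 : ℕ) := ⟨(k - 1).toNat, by omega⟩
    have e : ((n + 1 : ℕ) : ℤ) - 1 = n := by push_cast; ring
    have e1 := qPoch_ne_zero (mul_pow_self_ne_one hq) n
    have e2 := sub_ne_zero.2 (mul_pow_self_ne_one hq n).symm
    rw [e, invPoch_natCast, invPoch_natCast, qPoch_succ, zpow_natCast, pow_succ']
    generalize q * q ^ n = x at e2 ⊢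
    field_simp

theorem exists_norm_invPoch_le (hq : ‖q‖ < 1) : ∃ K : ℝ, 0 < K ∧ ∀ k, ‖invPoch q k‖ ≤ K := by
  obtain ⟨K, hK, h⟩ := exists_norm_inv_qPoch_le hq (mul_pow_self_ne_one hq)
  refine ⟨K, hK, fun k => ?_⟩
  unfold invPoch
  split_ifs
  · exact h _
  · simpa using hK.le

theorem thetaCoeff_add_one (hq0 : q ≠ 0) (r : ℤ) :
    thetaCoeff q (r + 1) = -(q ^ r * thetaCoeff q r) := by
  have e : (r + 1) * (r + 1 - 1) / 2 = r * (r - 1) / 2 + r := by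
    rw [show (r + 1) * (r + 1 - 1) = r * (r - 1) + r * 2 by ring]
    exact Int.add_mul_ediv_right _ _ (by norm_num)
  rw [thetaCoeff, thetaCoeff, e, zpow_add₀ (by norm_num), zpow_add₀ hq0]
  simp
  ring

theorem thetaCoeff_one_sub (q : ℂ) (r : ℤ) : thetaCoeff q (1 - r) = -thetaCoeff q r := by
  rw [thetaCoeff, thetaCoeff, show (1 - r) * (1 - r - 1) = r * (r - 1) by ring,
    zpow_sub₀ (by norm_num)]
  have : ((-1 : ℂ) ^ r)⁻¹ = (-1) ^ r := by
    rw [← inv_zpow]; norm_num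
  rw [div_eq_mul_inv, this]
  simp

theorem summable_mul_invPoch_mul_invPoch (f : ℤ → ℂ) (q : ℂ) (a b : ℤ) :
    Summable fun r => f r * (invPoch q (a - r) * invPoch q (b + r)) := by
  refine summable_of_hasFiniteSupport ((Set.finite_Icc (-b) a).subset fun r hr => ?_)
  by_contra h
  refine hr ?_
  simp only
  rw [Set.mem_Icc, not_and_or, not_le, not_le] at h
  rcases h with h | h
  · rw [invPoch_of_neg q (k := b + r) (by omega)]; simp
  · rw [invPoch_of_neg q (k := a - r) (by omega)]; simp

theorem tsum_eq_zero_of_antisymm {f : ℤ → ℂ} (c : ℤ) (h : ∀ r, f (c - r) = -f r) :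
    ∑' r, f r = 0 := by
  have h1 := (Equiv.subLeft c).tsum_eq f
  simp only [Equiv.subLeft_apply, h, tsum_neg] at h1
  exact self_eq_neg.1 h1.symm

/-- The alternating sum of the kernel of the Bailey transform vanishes. -/
theorem tsum_thetaCoeff_mul_invPoch (hq : ‖q‖ < 1) (hq0 : q ≠ 0) {n : ℕ} (hn : n ≠ 0) :
    ∑' r : ℤ, thetaCoeff q r * (invPoch q (n - r) * invPoch q (n + r)) = 0 := by
  set V := ∑' r : ℤ, thetaCoeff q r * (invPoch q (n - r) * invPoch q (n + r)) with hV
  set W := ∑' r : ℤ, thetaCoeff q r * (invPoch q (n - r) * invPoch q (n + 1 + r)) with hW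
  -- Two ways of raising an index of the kernel by one give V = q^n W and V = W; in each, one of the
  -- two resulting sums vanishes by antisymmetry. Hence (1 - q^n)V = 0.
  have h1 : V = q ^ n * W := by
    have a1 : ∑' r : ℤ, thetaCoeff q r * (invPoch q (n + 1 - r) * invPoch q (n + r)) = 0 :=
      tsum_eq_zero_of_antisymm 1 fun r => by
        rw [thetaCoeff_one_sub, show (n : ℤ) + 1 - (1 - r) = n + r by ring,
          show (n : ℤ) + (1 - r) = n + 1 - r by ring]
        ring
    have a2 : V = ∑' r : ℤ, (thetaCoeff q r * (invPoch q (n + 1 - r) * invPoch q (n + r)) -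
        (thetaCoeff q r * q ^ (n + 1 - r)) * (invPoch q (n + 1 - r) * invPoch q (n + r))) := by
      rw [hV]
      congr 1; ext r
      rw [show (n : ℤ) - r = n + 1 - r - 1 by ring, invPoch_sub_one hq]
      ring
    rw [(summable_mul_invPoch_mul_invPoch _ q _ _).tsum_sub
      (summable_mul_invPoch_mul_invPoch _ q _ _), a1, zero_sub, ← (Equiv.addRight 1).tsum_eq,
      ← tsum_neg] at a2
    rw [a2, hW, ← tsum_mul_left]
    congr 1; ext r
    simp only [Equiv.coe_addRight]
    rw [thetaCoeff_add_one hq0, show (n : ℤ) + 1 - (r + 1) = n - r by ring,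
      show (n : ℤ) + (r + 1) = n + 1 + r by ring, zpow_sub₀ hq0, zpow_natCast]
    have := zpow_ne_zero r hq0
    field_simp
  have h2 : V = W := by
    have a1 : ∑' r : ℤ, (thetaCoeff q r * q ^ (n + 1 + r)) *
        (invPoch q (n - r) * invPoch q (n + 1 + r)) = 0 :=
      tsum_eq_zero_of_antisymm (-1) fun r => by
        have e : ∀ s, thetaCoeff q s * q ^ ((n : ℤ) + 1 + s) = -thetaCoeff q (s + 1) * q ^ (n + 1) :=
          fun s => by
            rw [thetaCoeff_add_one hq0, zpow_add₀ hq0]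
            norm_cast
            ring
        rw [e, e, show (n : ℤ) + 1 + (-1 - r) = n - r by ring,
          show (n : ℤ) - (-1 - r) = n + 1 + r by ring, show -1 - r + 1 = 1 - (r + 1) by ring,
          thetaCoeff_one_sub]
        ring
    have a2 : V = ∑' r : ℤ, (thetaCoeff q r * (invPoch q (n - r) * invPoch q (n + 1 + r)) -
        (thetaCoeff q r * q ^ (n + 1 + r)) * (invPoch q (n - r) * invPoch q (n + 1 + r))) := by
      rw [hV]
      congr 1; ext r
      rw [show (n : ℤ) + r = n + 1 + r - 1 by ring, invPoch_sub_one hq]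
      ring_nf
    rwa [(summable_mul_invPoch_mul_invPoch _ q _ _).tsum_sub
      (summable_mul_invPoch_mul_invPoch _ q _ _), a1, sub_zero] at a2
  have h3 : (1 - q ^ n) * V = 0 := by rw [sub_mul, ← sub_eq_zero.2 h1, one_mul, h2]
  refine (mul_eq_zero.1 h3).resolve_left (sub_ne_zero.2 fun h => ?_)
  have := pow_lt_one₀ (norm_nonneg q) hq hn
  rw [← norm_pow, ← h, norm_one] at this
  exact lt_irrefl _ this

theorem tsum_thetaCoeff_mul_pow_mul_invPoch (hq : ‖q‖ < 1) (hq0 : q ≠ 0) {n : ℕ} (hn : n ≠ 0) :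
    ∑' r : ℤ, (thetaCoeff q r * q ^ r) * (invPoch q (n - r) * invPoch q (n + r)) = 0 := by
  rw [← tsum_thetaCoeff_mul_invPoch hq hq0 hn, ← (Equiv.neg ℤ).tsum_eq]
  congr 1; ext r
  rw [Equiv.neg_apply]
  have : thetaCoeff q (-r) * q ^ (-r) = thetaCoeff q r := by
    rw [mul_comm, ← neg_neg (q ^ (-r) * thetaCoeff q (-r)), ← thetaCoeff_add_one hq0,
      show -r + 1 = 1 - r by ring, thetaCoeff_one_sub, neg_neg]
  rw [this]
  ring_nf

theorem tsum_mul_invPoch_zero (f : ℤ → ℂ) (q : ℂ) :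
    ∑' r : ℤ, f r * (invPoch q ((0 : ℕ) - r) * invPoch q ((0 : ℕ) + r)) = f 0 := by
  rw [tsum_eq_single 0]
  · have : invPoch q 0 = 1 := by simpa [qPoch_zero] using invPoch_natCast q 0
    simp [this]
  · intro r hr
    rcases lt_or_gt_of_ne hr with h | h
    · rw [invPoch_of_neg q (k := ((0 : ℕ) : ℤ) + r) (by simpa using h)]; simp
    · rw [invPoch_of_neg q (k := ((0 : ℕ) : ℤ) - r) (by simpa using h)]; simp

/-- The partial fraction expansion of `1 / ((1 - z) (zq)_n (q/z)_n)`. -/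
theorem tsum_partialFraction (hq : ‖q‖ < 1) (hq0 : q ≠ 0) {z : ℂ} (hz : z ≠ 0)
    (h : ∀ n : ℤ, z * q ^ n ≠ 1) (n : ℕ) :
    ∑' r : ℤ, (thetaCoeff q r * q ^ r * (1 - z * q ^ r)⁻¹) *
        (invPoch q (n - r) * invPoch q (n + r)) =
      (1 - z)⁻¹ / (qPoch (z * q) q n * qPoch (z⁻¹ * q) q n) := by
  induction n with
  | zero => rw [tsum_mul_invPoch_zero]; simp [qPoch_zero, thetaCoeff]
  | succ n ih =>
    set N : ℤ := ((n + 1 : ℕ) : ℤ) with hN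
    have hd1 : 1 - z * q ^ N ≠ 0 := sub_ne_zero.2 (h _).symm
    have hd2 : 1 - z⁻¹ * q ^ N ≠ 0 := sub_ne_zero.2 fun h1 => h (-N) (by
      rw [zpow_neg]; have := zpow_ne_zero N hq0; field_simp at h1 ⊢; exact h1)
    -- Since (1-zx)(1-x/z) - (1-xy)(1-x/y) = x(1-zy)(1/y-1/z), with x = q^N and y = q^r, clearing
    -- the new factors changes the sum only by multiples of two vanishing alternating sums.
    have key : (1 - z * q ^ N) * (1 - z⁻¹ * q ^ N) *
        ∑' r : ℤ, (thetaCoeff q r * q ^ r * (1 - z * q ^ r)⁻¹) *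
          (invPoch q (N - r) * invPoch q (N + r)) =
        ∑' r : ℤ, (thetaCoeff q r * q ^ r * (1 - z * q ^ r)⁻¹) *
          (invPoch q (n - r) * invPoch q (n + r)) := by
      have e : ∀ r : ℤ, (1 - z * q ^ N) * (1 - z⁻¹ * q ^ N) *
          ((thetaCoeff q r * q ^ r * (1 - z * q ^ r)⁻¹) *
            (invPoch q (N - r) * invPoch q (N + r))) =
          (thetaCoeff q r * q ^ r * (1 - z * q ^ r)⁻¹) * (invPoch q (n - r) * invPoch q (n + r)) +
          (q ^ N * (thetaCoeff q r * (invPoch q (N - r) * invPoch q (N + r))) -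
            q ^ N * z⁻¹ * (thetaCoeff q r * q ^ r * (invPoch q (N - r) * invPoch q (N + r)))) := by
        intro r
        rw [show (n : ℤ) - r = N - r - 1 by simp [hN]; ring,
          show (n : ℤ) + r = N + r - 1 by simp [hN]; ring, invPoch_sub_one hq, invPoch_sub_one hq,
          zpow_sub₀ hq0, zpow_add₀ hq0]
        have := sub_ne_zero.2 (h r).symm
        have := zpow_ne_zero r hq0
        field_simp
        ring
      rw [← tsum_mul_left]
      simp only [e]
      have hA := summable_mul_invPoch_mul_invPoch (thetaCoeff q) q N N
      have hB := summable_mul_invPoch_mul_invPoch (fun r => thetaCoeff q r * q ^ r) q N N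
      rw [(summable_mul_invPoch_mul_invPoch _ q n n).tsum_add
        ((hA.mul_left _).sub (hB.mul_left _)), (hA.mul_left _).tsum_sub (hB.mul_left _),
        tsum_mul_left, tsum_mul_left, tsum_thetaCoeff_mul_invPoch hq hq0 n.succ_ne_zero,
        tsum_thetaCoeff_mul_pow_mul_invPoch hq hq0 n.succ_ne_zero]
      simp
    rw [ih] at key
    have e1 : qPoch (z * q) q (n + 1) = qPoch (z * q) q n * (1 - z * q ^ N) := by
      rw [qPoch_succ, hN, zpow_natCast]; ring
    have e2 : qPoch (z⁻¹ * q) q (n + 1) = qPoch (z⁻¹ * q) q n * (1 - z⁻¹ * q ^ N) := by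
      rw [qPoch_succ, hN, zpow_natCast]; ring
    rw [e1, e2, mul_mul_mul_comm, ← div_div, ← key,
      mul_div_cancel_left₀ _ (mul_ne_zero hd1 hd2)]

end Bailey

/-! ### Pentagonal exponents and their growth. -/

section Pentagonal

/-- The generalized pentagonal number `n (3 n + 1) / 2`. -/
def pent (n : ℤ) : ℕ := (n * (3 * n + 1) / 2).toNat

theorem two_mul_pent (n : ℤ) : 2 * (pent n : ℤ) = n * (3 * n + 1) := by
  have h0 : 0 ≤ n * (3 * n + 1) := by
    rcases le_or_gt 0 n with h | h
    · positivity
    · exact mul_nonneg_of_nonpos_of_nonpos h.le (by omega)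
  have h2 : (2 : ℤ) ∣ n * (3 * n + 1) := by
    rcases Int.even_or_odd' n with ⟨k, rfl | rfl⟩
    · exact ⟨k * (3 * (2 * k) + 1), by ring⟩
    · exact ⟨(2 * k + 1) * (3 * k + 2), by ring⟩
  rw [pent, Int.toNat_of_nonneg (Int.ediv_nonneg h0 (by norm_num)), Int.mul_ediv_cancel' h2]

theorem natAbs_le_pent (n : ℤ) : n.natAbs ≤ pent n := by
  have h := two_mul_pent n
  zify
  rcases abs_cases n with ⟨h1, h2⟩ | ⟨h1, h2⟩ <;> rw [h1] <;> nlinarith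

theorem summable_natAbs_pow_mul_geometric {b : ℝ} (hb0 : 0 ≤ b) (hb : b < 1) (k : ℕ) :
    Summable fun n : ℤ => (n.natAbs : ℝ) ^ k * b ^ n.natAbs := by
  have h := summable_pow_mul_geometric_of_norm_lt_one (R := ℝ) k
    (show ‖b‖ < 1 by rwa [Real.norm_of_nonneg hb0])
  exact .of_nat_of_neg (by simpa using h) (by simpa using h)

/-- The coefficient `(-1) ^ n q ^ (n (3 n + 1) / 2)`. -/
noncomputable def pentCoeff (q : ℂ) (n : ℤ) : ℂ := (-1) ^ n * q ^ pent n

theorem norm_pentCoeff_le {q : ℂ} {b : ℝ} (hqb : ‖q‖ ≤ b) (hb : b ≤ 1) (n : ℤ) :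
    ‖pentCoeff q n‖ ≤ b ^ n.natAbs := by
  have hb0 : 0 ≤ b := (norm_nonneg _).trans hqb
  rw [pentCoeff, norm_mul, norm_pow, norm_zpow, norm_neg, norm_one, one_zpow, one_mul]
  calc _ ≤ b ^ pent n := by gcongr
    _ ≤ _ := pow_le_pow_of_le_one hb0 hb (natAbs_le_pent n)

theorem summable_pentCoeff {q : ℂ} (hq : ‖q‖ < 1) : Summable (pentCoeff q) :=
  .of_norm_bounded (by simpa using summable_natAbs_pow_mul_geometric (norm_nonneg _) hq 0)
    (norm_pentCoeff_le le_rfl hq.le)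

/-- The exponents add up: r(r-1)/2 + r + r² = r(3r+1)/2. This is where Bailey's lemma creates
pentagonal numbers. -/
theorem thetaCoeff_mul_pow_mul_pow_sq {q : ℂ} (hq0 : q ≠ 0) (r : ℤ) :
    thetaCoeff q r * q ^ r * q ^ (r * r) = pentCoeff q r := by
  rw [thetaCoeff, pentCoeff, mul_assoc, mul_assoc, ← zpow_add₀ hq0, ← zpow_add₀ hq0,
    ← zpow_natCast q (pent r)]
  congr 2
  have h1 := two_mul_pent r
  have h2 : 2 * (r * (r - 1) / 2) = r * (r - 1) := Int.mul_ediv_cancel' (by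
    rcases Int.even_or_odd' r with ⟨k, rfl | rfl⟩
    · exact ⟨k * (2 * k - 1), by ring⟩
    · exact ⟨(2 * k + 1) * k, by ring⟩)
  linarith

theorem norm_thetaCoeff_mul_pow_le {q : ℂ} (hq : ‖q‖ < 1) (hq0 : q ≠ 0) (r : ℤ) :
    ‖thetaCoeff q r * q ^ r‖ ≤ 1 := by
  have e : ‖thetaCoeff q r * q ^ r‖ = ‖q‖ ^ (r * (r - 1) / 2 + r) := by
    rw [thetaCoeff, mul_assoc, ← zpow_add₀ hq0, norm_mul, norm_zpow, norm_zpow, norm_neg, norm_one,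
      one_zpow, one_mul]
  have h2 : 0 ≤ r * (r - 1) / 2 + r := by
    rw [← Int.add_mul_ediv_right _ _ (by norm_num : (2 : ℤ) ≠ 0)]
    refine Int.ediv_nonneg ?_ (by norm_num)
    rcases le_or_gt 0 r with h | h
    · nlinarith
    · nlinarith
  lift r * (r - 1) / 2 + r to ℕ using h2 with m
  rw [e, zpow_natCast]
  exact pow_le_one₀ (norm_nonneg _) hq.le

end Pentagonal

/-! ### Bailey's lemma, the pentagonal number theorem and the Appell–Lerch form of the rank
function. -/

section BaileyLemma

variable {q : ℂ}

/-- The kernel depends only on k = |r| and vanishes for n < k. Substituting n = m + k turns the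
series into the Durfee rectangle identity with parameter 2k. -/
theorem hasSum_pow_sq_mul_invPoch (hq : ‖q‖ < 1) (r : ℤ) :
    HasSum (fun n : ℕ => q ^ (n * n) * (invPoch q (n - r) * invPoch q (n + r)))
      (q ^ (r * r) / qPochInf q q) := by
  set k := r.natAbs with hk
  have e1 : ∀ n : ℕ, invPoch q (n - r) * invPoch q (n + r) =
      invPoch q (n - k) * invPoch q (n + k) := by
    intro n
    rcases Int.natAbs_eq r with h | h
    · rw [← hk] at h; rw [h]
    · rw [← hk] at h; rw [h, sub_neg_eq_add, mul_comm, ← sub_eq_add_neg]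
  have e2 : q ^ (r * r) = q ^ (k * k) := by
    rw [← zpow_natCast, hk, ← Int.natAbs_mul_self]
  simp only [e1, e2]
  rw [← (add_left_injective k).hasSum_iff]
  · have := (hasSum_durfee hq (2 * k)).mul_left (q ^ (k * k))
    rw [mul_one_div] at this
    refine this.congr_fun fun m => ?_
    have i1 : ((m + k : ℕ) : ℤ) - k = (m : ℕ) := by push_cast; ring
    have i2 : ((m + k : ℕ) : ℤ) + k = (m + 2 * k : ℕ) := by push_cast; ring
    simp only [Function.comp_apply]
    rw [i1, i2, invPoch_natCast, invPoch_natCast, show (m + k) * (m + k) =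
      k * k + (m * m + m * (2 * k)) by ring, pow_add, div_eq_mul_inv _ (_ * _), mul_inv]
    ring
  · intro n hn
    have : n < k := by
      by_contra h
      exact hn ⟨n - k, by simp only; omega⟩
    rw [invPoch_of_neg q (k := (n : ℤ) - k) (by omega)]
    simp

/-- The kernel vanishes unless |r| ≤ n, and then 2n² ≥ n + |r|. Taking s = √|q| thus gives a bound
that is a product of geometric terms in n and r, as needed to exchange the two sums. -/
theorem norm_pow_sq_mul_invPoch_le {K : ℝ} (hKb : ∀ k, ‖invPoch q k‖ ≤ K)
    {s : ℝ} (hs0 : 0 ≤ s) (hs1 : s < 1) (hsq : ‖q‖ = s * s) (n : ℕ) (r : ℤ) :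
    ‖q ^ (n * n) * (invPoch q (n - r) * invPoch q (n + r))‖ ≤
      K * K * (s ^ n * s ^ r.natAbs) := by
  have hK : 0 ≤ K := (norm_nonneg (invPoch q 0)).trans (hKb 0)
  by_cases hr : r.natAbs ≤ n
  · have h2 : ‖q‖ ^ (n * n) ≤ s ^ n * s ^ r.natAbs := by
      rw [hsq, ← sq, ← pow_mul, ← pow_add]
      exact pow_le_pow_of_le_one hs0 hs1.le (by nlinarith [Nat.le_mul_self n])
    rw [norm_mul, norm_mul, norm_pow, mul_comm (K * K)]
    exact mul_le_mul h2 (mul_le_mul (hKb _) (hKb _) (norm_nonneg _) hK) (by positivity)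
      (by positivity)
  · have : invPoch q (n - r) * invPoch q (n + r) = 0 := by
      rcases lt_or_ge (n : ℤ) r with h | h
      · rw [invPoch_of_neg q (k := (n : ℤ) - r) (by omega), zero_mul]
      · rw [invPoch_of_neg q (k := (n : ℤ) + r) (by omega), mul_zero]
    rw [this, mul_zero, norm_zero]
    positivity

theorem summable_bailey (hq : ‖q‖ < 1) {α : ℤ → ℂ} {A : ℝ} (hα : ∀ r, ‖α r‖ ≤ A) :
    Summable (Function.uncurry fun (n : ℕ) (r : ℤ) =>
      α r * (q ^ (n * n) * (invPoch q (n - r) * invPoch q (n + r)))) := by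
  obtain ⟨K, hK, hKb⟩ := exists_norm_invPoch_le hq
  have hA : 0 ≤ A := (norm_nonneg (α 0)).trans (hα 0)
  have hs0 : 0 ≤ √‖q‖ := Real.sqrt_nonneg _
  have hs1 : √‖q‖ < 1 := by rw [Real.sqrt_lt' one_pos, one_pow]; exact hq
  have hsq : ‖q‖ = √‖q‖ * √‖q‖ := (Real.mul_self_sqrt (norm_nonneg q)).symm
  generalize √‖q‖ = s at hs0 hs1 hsq
  have h0 : Summable fun r : ℤ => s ^ r.natAbs := by
    simpa only [pow_zero, one_mul] using summable_natAbs_pow_mul_geometric hs0 hs1 0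
  have h1 : Summable fun p : ℕ × ℤ => s ^ p.1 * s ^ p.2.natAbs :=
    (summable_geometric_of_lt_one hs0 hs1).mul_of_nonneg h0
      (fun n => pow_nonneg hs0 n) (fun r => pow_nonneg hs0 r.natAbs)
  refine .of_norm_bounded ((h1.mul_left (K * K)).mul_left A) fun p => ?_
  rw [Function.uncurry, norm_mul]
  exact mul_le_mul (hα p.2) (norm_pow_sq_mul_invPoch_le hKb hs0 hs1 hsq p.1 p.2)
    (norm_nonneg _) hA

/-- The limiting form of Bailey's lemma with `a = 1`. -/
theorem hasSum_bailey (hq : ‖q‖ < 1) {α : ℤ → ℂ} {A : ℝ} (hα : ∀ r, ‖α r‖ ≤ A) :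
    HasSum (fun n : ℕ => q ^ (n * n) * ∑' r : ℤ, α r * (invPoch q (n - r) * invPoch q (n + r)))
      ((∑' r, α r * q ^ (r * r)) / qPochInf q q) := by
  have hs := summable_bailey hq hα
  set F : ℕ → ℤ → ℂ := fun n r =>
    α r * (q ^ (n * n) * (invPoch q (n - r) * invPoch q (n + r))) with hF
  have e : ∀ n : ℕ, q ^ (n * n) * ∑' r : ℤ, α r * (invPoch q (n - r) * invPoch q (n + r)) =
      ∑' r : ℤ, F n r := fun n => by
    rw [← tsum_mul_left]; congr 1; ext r; simp only [hF]; ring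
  have h1 : ∑' r, α r * q ^ (r * r) / qPochInf q q = ∑' (n : ℕ) (r : ℤ), F n r := by
    rw [← hs.tsum_comm]
    congr 1; ext r
    simp only [hF]
    rw [tsum_mul_left, (hasSum_pow_sq_mul_invPoch hq r).tsum_eq, mul_div_assoc]
  have h2 : HasSum (fun n => ∑' r, F n r) (∑' n, ∑' r, F n r) := hs.prod.hasSum
  rw [← h1, tsum_div_const] at h2
  exact h2.congr_fun e

/-- Euler's pentagonal number theorem. -/
theorem qPochInf_self_eq_tsum_pentCoeff (hq : ‖q‖ < 1) (hq0 : q ≠ 0) :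
    qPochInf q q = ∑' n, pentCoeff q n := by
  have h := hasSum_bailey hq (norm_thetaCoeff_mul_pow_le hq hq0)
  simp only [thetaCoeff_mul_pow_mul_pow_sq hq0] at h
  -- For the alternating coefficients every inner sum with n ≠ 0 vanishes, so the Bailey series
  -- collapses to its n = 0 term.
  have h1 := hasSum_single (f := fun n : ℕ => q ^ (n * n) * ∑' r : ℤ, thetaCoeff q r * q ^ r *
    (invPoch q (n - r) * invPoch q (n + r))) 0 fun n hn => by
      simp only [tsum_thetaCoeff_mul_pow_mul_invPoch hq hq0 hn, mul_zero]
  have h2 := h.unique h1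
  rw [tsum_mul_invPoch_zero, div_eq_iff (qPochInf_ne_zero hq (mul_pow_self_ne_one hq))] at h2
  simp [h2, thetaCoeff]

/-- The Appell–Lerch sum `∑ (-1) ^ n q ^ (n (3 n + 1) / 2) / (1 - z q ^ n)`. -/
noncomputable def appellSum (z q : ℂ) : ℂ := ∑' n : ℤ, pentCoeff q n * (1 - z * q ^ n)⁻¹

/-- The rank generating function as an Appell–Lerch sum. -/
theorem R_eq_appellSum (hq : ‖q‖ < 1) (hq0 : q ≠ 0) {z : ℂ} (hz : z ≠ 0)
    (h : ∀ n : ℤ, z * q ^ n ≠ 1) : R z q = (1 - z) * appellSum z q / qPochInf q q := by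
  obtain ⟨K, hK, hKb⟩ := exists_eventually_norm_inv_le hq hq0 hz h
  have hKb := hKb.self_of_nhds
  have hα : ∀ r : ℤ, ‖thetaCoeff q r * q ^ r * (1 - z * q ^ r)⁻¹‖ ≤ 1 * K := fun r => by
    rw [norm_mul]
    exact mul_le_mul (norm_thetaCoeff_mul_pow_le hq hq0 r) (hKb r).2 (norm_nonneg _) zero_le_one
  have h1 := (hasSum_bailey hq hα).mul_left (1 - z)
  simp only [tsum_partialFraction hq hq0 hz h] at h1
  have hz1 : 1 - z ≠ 0 := sub_ne_zero.2 (by simpa using (h 0).symm)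
  have e : ∀ r : ℤ, thetaCoeff q r * q ^ r * (1 - z * q ^ r)⁻¹ * q ^ (r * r) =
      pentCoeff q r * (1 - z * q ^ r)⁻¹ := fun r => by
    rw [← thetaCoeff_mul_pow_mul_pow_sq hq0]; ring
  simp only [e] at h1
  rw [appellSum, mul_div_assoc, ← h1.tsum_eq, h1.summable.tsum_eq_zero_add, R]
  congr 1
  · simp [qPoch_zero, hz1]
  · congr 1; ext n
    rw [sq]
    field_simp

/-- At z = 1 the series counts Durfee squares. The Appell–Lerch form excludes this point, so its
value is obtained separately. -/
theorem R_one_eq (hq : ‖q‖ < 1) : R 1 q = 1 / qPochInf q q := by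
  have h := hasSum_durfee hq 0
  rw [← h.tsum_eq, h.summable.tsum_eq_zero_add, R]
  simp [qPoch_zero, sq]

end BaileyLemma

/-! ### The theta product and the quasi-periodicity of the crank cube. -/

section Theta

variable {q : ℂ}

theorem differentiable_qPochInf (hq : ‖q‖ < 1) : Differentiable ℂ fun z => qPochInf z q := by
  intro z₀
  set U := Metric.ball (0 : ℂ) (‖z₀‖ + 1) with hU
  have h : HasProdLocallyUniformlyOn (fun (i : ℕ) z => 1 + -(z * q ^ i))
      (fun z => ∏' i : ℕ, (1 + -(z * q ^ i))) U := by
    refine Summable.hasProdLocallyUniformlyOn_nat_one_add (u := fun i => (‖z₀‖ + 1) * ‖q‖ ^ i)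
      Metric.isOpen_ball ((summable_geometric_of_lt_one (norm_nonneg _) hq).mul_left _)
      (.of_forall fun n z hz => ?_) (fun n => by fun_prop)
    rw [norm_neg, norm_mul, norm_pow]
    rw [hU, mem_ball_zero_iff] at hz
    gcongr
  have hd : DifferentiableOn ℂ (fun z => ∏' i : ℕ, (1 + -(z * q ^ i))) U :=
    h.differentiableOn (.of_forall fun _ => by
      simpa [Finset.prod_fn] using DifferentiableOn.finsetProd (fun _ _ => by fun_prop))
      Metric.isOpen_ball
  have := hd.differentiableAt (Metric.isOpen_ball.mem_nhds (show z₀ ∈ U by simp [hU]))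
  simpa only [qPochInf, sub_eq_add_neg] using this

/-- The theta product `(z;q)_∞ (q/z;q)_∞`. -/
noncomputable def thetaProd (z q : ℂ) : ℂ := qPochInf z q * qPochInf (z⁻¹ * q) q

theorem analyticAt_qPochInf (hq : ‖q‖ < 1) (z : ℂ) : AnalyticAt ℂ (fun z => qPochInf z q) z :=
  (differentiable_qPochInf hq).analyticAt z

theorem analyticAt_qPochInf_inv_mul (hq : ‖q‖ < 1) {z : ℂ} (hz : z ≠ 0) :
    AnalyticAt ℂ (fun z => qPochInf (z⁻¹ * q) q) z :=
  (analyticAt_qPochInf hq (z⁻¹ * q)).comp_of_eq ((analyticAt_inv hz).mul analyticAt_const) rfl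

theorem analyticAt_thetaProd (hq : ‖q‖ < 1) {z : ℂ} (hz : z ≠ 0) :
    AnalyticAt ℂ (fun z => thetaProd z q) z :=
  (analyticAt_qPochInf hq z).mul (analyticAt_qPochInf_inv_mul hq hz)

theorem inv_mul_pow_ne_one {z : ℂ} (h : ∀ n : ℤ, z * q ^ n ≠ 1) (i : ℕ) :
    z⁻¹ * q ^ i ≠ 1 := fun h1 => by
  refine h (-(i : ℤ)) ?_
  rw [zpow_neg, zpow_natCast, ← inv_inv (z * (q ^ i)⁻¹), mul_inv, inv_inv, h1, inv_one]

theorem inv_mul_mul_pow_ne_one {z : ℂ} (h : ∀ n : ℤ, z * q ^ n ≠ 1) (i : ℕ) :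
    z⁻¹ * q * q ^ i ≠ 1 := by
  rw [mul_assoc, ← pow_succ']
  exact inv_mul_pow_ne_one h (i + 1)

theorem thetaProd_ne_zero (hq : ‖q‖ < 1) {z : ℂ} (h : ∀ n : ℤ, z * q ^ n ≠ 1) :
    thetaProd z q ≠ 0 :=
  mul_ne_zero (qPochInf_ne_zero hq fun i => by simpa using h i)
    (qPochInf_ne_zero hq (inv_mul_mul_pow_ne_one h))

theorem thetaProd_mul (hq : ‖q‖ < 1) (hq0 : q ≠ 0) {z : ℂ} (hz : z ≠ 0) :
    thetaProd (z * q) q = -z⁻¹ * thetaProd z q := by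
  have e : (z * q)⁻¹ * q = z⁻¹ := by field_simp
  rw [thetaProd, thetaProd, e, qPochInf_eq_one_sub_mul hq z, qPochInf_eq_one_sub_mul hq z⁻¹]
  field_simp
  ring

/-- The quotient `z (q)_∞⁶ / θ(z)³ = z (q)_∞³ C*(z,q)³`. -/
noncomputable def cubeQuot (q z : ℂ) : ℂ := z * qPochInf q q ^ 6 / thetaProd z q ^ 3

theorem cubeQuot_mul (hq : ‖q‖ < 1) (hq0 : q ≠ 0) {z : ℂ} (hz : z ≠ 0) :
    cubeQuot q (z * q) = -q * z ^ 3 * cubeQuot q z := by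
  rw [cubeQuot, cubeQuot, thetaProd_mul hq hq0 hz]
  by_cases h : thetaProd z q = 0
  · simp [h]
  · field_simp

theorem analyticAt_cubeQuot (hq : ‖q‖ < 1) {z : ℂ} (hz : z ≠ 0) (h : ∀ n : ℤ, z * q ^ n ≠ 1) :
    AnalyticAt ℂ (cubeQuot q) z :=
  (analyticAt_id.mul analyticAt_const).div ((analyticAt_thetaProd hq hz).pow 3)
    (pow_ne_zero _ (thetaProd_ne_zero hq h))

theorem pentCoeff_add_one (hq0 : q ≠ 0) (n : ℤ) :
    pentCoeff q (n + 1) = -(q ^ (3 * n + 2) * pentCoeff q n) := by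
  have h1 := two_mul_pent n
  have h2 := two_mul_pent (n + 1)
  rw [pentCoeff, pentCoeff, ← zpow_natCast, ← zpow_natCast, mul_left_comm, ← zpow_add₀ hq0,
    zpow_add₀ (by norm_num : (-1 : ℂ) ≠ 0), zpow_one,
    show (pent (n + 1) : ℤ) = 3 * n + 2 + pent n by linarith]
  ring

/-- Both sides obey the same first-order recurrence in n and agree at n = 0. The multiplier is the
Appell–Lerch coefficient, which is why ranks and cubes of cranks have matching pole expansions. -/
theorem cubeQuot_mul_zpow (hq : ‖q‖ < 1) (hq0 : q ≠ 0) {w : ℂ} (hw : w ≠ 0) (n : ℤ) :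
    cubeQuot q (w * q ^ (-n)) = pentCoeff q n * w ^ (-3 * n) * cubeQuot q w := by
  have step : ∀ n : ℤ, pentCoeff q (n + 1) * w ^ (-3 * (n + 1)) * cubeQuot q w =
      -(q⁻¹ * (w * q ^ (-(n + 1)))⁻¹ ^ 3) * (pentCoeff q n * w ^ (-3 * n) * cubeQuot q w) := by
    intro n
    have e1 : w ^ (-3 * (n + 1)) = w ^ (-3 * n) * (w ^ 3)⁻¹ := by
      rw [show -3 * (n + 1) = -3 * n + (-3) by ring, zpow_add₀ hw, zpow_neg w 3]
      norm_cast
    have e2 : q ^ (3 * n + 2) = (q ^ n) ^ 3 * q ^ 2 := by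
      rw [zpow_add₀ hq0, mul_comm 3 n, zpow_mul]
      norm_cast
    have e3 : q ^ (-(n + 1)) = (q ^ n * q)⁻¹ := by rw [zpow_neg, zpow_add_one₀ hq0]
    rw [pentCoeff_add_one hq0, e1, e2, e3]
    have := zpow_ne_zero n hq0
    field_simp
  have step' : ∀ n : ℤ, cubeQuot q (w * q ^ (-(n + 1))) =
      -(q⁻¹ * (w * q ^ (-(n + 1)))⁻¹ ^ 3) * cubeQuot q (w * q ^ (-n)) := by
    intro n
    have hx : w * q ^ (-(n + 1)) ≠ 0 := mul_ne_zero hw (zpow_ne_zero _ hq0)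
    have e : w * q ^ (-n) = w * q ^ (-(n + 1)) * q := by
      rw [mul_assoc, ← zpow_add_one₀ hq0]; congr 2; ring
    rw [e, cubeQuot_mul hq hq0 hx]
    generalize w * q ^ (-(n + 1)) = x at hx
    field_simp
  -- The recurrence factor is nonzero, so it can be cancelled to descend to negative n.
  have hc : ∀ n : ℤ, -(q⁻¹ * (w * q ^ (-(n + 1)))⁻¹ ^ 3) ≠ 0 := fun n =>
    neg_ne_zero.2 (mul_ne_zero (inv_ne_zero hq0)
      (pow_ne_zero _ (inv_ne_zero (mul_ne_zero hw (zpow_ne_zero _ hq0)))))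
  induction n using Int.induction_on with
  | zero => simp [pentCoeff, pent]
  | succ i ih => rw [step', step, ih]
  | pred i ih =>
    refine mul_left_cancel₀ (hc (-(i : ℤ) - 1)) ?_
    rw [← step', ← step, sub_add_cancel, ih]

end Theta

/-! ### Principal parts of the crank cube at its poles. -/

section LocalExpansion

variable {q : ℂ}

theorem exists_zpow_expansion (j : ℤ) : ∃ g : ℂ → ℂ, AnalyticAt ℂ g 1 ∧ ∀ w : ℂ, w ≠ 0 →
    w ^ j = 1 + j * (w - 1) + j * (j - 1) / 2 * (w - 1) ^ 2 + (w - 1) ^ 3 * g w := by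
  induction j using Int.induction_on with
  | zero => exact ⟨0, analyticAt_const, fun w _ => by simp⟩
  | succ i ih =>
    obtain ⟨g, hg, h⟩ := ih
    refine ⟨fun w => (i : ℂ) * (i - 1) / 2 + w * g w, by fun_prop, fun w hw => ?_⟩
    rw [zpow_add_one₀ hw, h w hw]
    push_cast
    ring
  | pred i ih =>
    obtain ⟨g, hg, h⟩ := ih
    refine ⟨fun w => (g w - (-i - 1) * (-i - 2) / 2) / w,
      (hg.sub analyticAt_const).div analyticAt_id one_ne_zero, fun w hw => ?_⟩
    rw [zpow_sub_one₀ hw, h w hw]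
    push_cast
    field_simp
    ring

theorem AnalyticAt.exists_eq_add_sub_mul {f : ℂ → ℂ} {a : ℂ} (hf : AnalyticAt ℂ f a) :
    ∃ g : ℂ → ℂ, AnalyticAt ℂ g a ∧ ∀ᶠ w in 𝓝 a, f w = f a + (w - a) * g w := by
  have h : AnalyticAt ℂ (fun w => f w - f a) a := hf.sub analyticAt_const
  have h1 : ((1 : ℕ) : ℕ∞) ≤ analyticOrderAt (fun w => f w - f a) a := by
    rw [natCast_le_analyticOrderAt_iff_iteratedDeriv_eq_zero h]
    intro i hi
    interval_cases i
    simp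
  obtain ⟨g, hg, he⟩ := (natCast_le_analyticOrderAt h).1 h1
  refine ⟨g, hg, he.mono fun w hw => ?_⟩
  rw [pow_one, smul_eq_mul] at hw
  linear_combination hw

theorem AnalyticAt.exists_eq_add_sub_sq_mul {f : ℂ → ℂ} {a : ℂ} (hf : AnalyticAt ℂ f a)
    (hd : deriv f a = 0) :
    ∃ g : ℂ → ℂ, AnalyticAt ℂ g a ∧ ∀ᶠ w in 𝓝 a, f w = f a + (w - a) ^ 2 * g w := by
  have h : AnalyticAt ℂ (fun w => f w - f a) a := hf.sub analyticAt_const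
  have h1 : ((2 : ℕ) : ℕ∞) ≤ analyticOrderAt (fun w => f w - f a) a := by
    rw [natCast_le_analyticOrderAt_iff_iteratedDeriv_eq_zero h]
    intro i hi
    interval_cases i
    · simp
    · simp [hd]
  obtain ⟨g, hg, he⟩ := (natCast_le_analyticOrderAt h).1 h1
  refine ⟨g, hg, he.mono fun w hw => ?_⟩
  rw [smul_eq_mul] at hw
  linear_combination hw

/-- The chain rule at the fixed point w = 1, where inversion has derivative -1, gives f'(1) =
-f'(1). -/
theorem deriv_eq_zero_of_inv_symm {f : ℂ → ℂ} (hf : DifferentiableAt ℂ f 1)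
    (h : ∀ w, f w⁻¹ = f w) : deriv f 1 = 0 := by
  have h1 : HasDerivAt (fun w => f w⁻¹) (deriv f 1 * -1) 1 := by
    have h2 : HasDerivAt (fun w : ℂ => w⁻¹) (-1) 1 := by
      simpa using hasDerivAt_inv (one_ne_zero (α := ℂ))
    exact HasDerivAt.comp (1 : ℂ) (h₂ := f) (by rw [inv_one]; exact hf.hasDerivAt) h2
  simp only [h] at h1
  have := h1.unique hf.hasDerivAt
  linear_combination (-1 / 2) * this

/-- Expansion of `(1 - w)³ z⁻¹ · cubeQuot` to second order at `w = 1`. -/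
theorem exists_cubeQuot_expansion (hq : ‖q‖ < 1) : ∃ k : ℂ → ℂ, AnalyticAt ℂ k 1 ∧
    ∀ᶠ w in 𝓝 (1 : ℂ), cubeQuot q w = w * (1 + (w - 1) ^ 2 * k w) / (1 - w) ^ 3 := by
  -- The regular factor: `cubeQuot` is w f(w)/(1-w)³, with f(1) = 1 and f symmetric under inversion,
  -- so f has no linear term at 1.
  set f : ℂ → ℂ := fun w =>
    (qPochInf q q ^ 2 / (qPochInf (w * q) q * qPochInf (w⁻¹ * q) q)) ^ 3 with hf
  have hE := qPochInf_ne_zero hq (mul_pow_self_ne_one hq)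
  have h1 : AnalyticAt ℂ f 1 := by
    refine AnalyticAt.pow (analyticAt_const.div (AnalyticAt.mul
      ((analyticAt_qPochInf hq (1 * q)).comp_of_eq (analyticAt_id.mul analyticAt_const) rfl)
      (analyticAt_qPochInf_inv_mul hq one_ne_zero)) ?_) 3
    simp [hE]
  have h2 : f 1 = 1 := by simp only [hf, one_mul, inv_one]; field_simp
  obtain ⟨k, hk, he⟩ := AnalyticAt.exists_eq_add_sub_sq_mul h1
    (deriv_eq_zero_of_inv_symm h1.differentiableAt fun w => by
      simp only [hf, inv_inv, mul_comm (qPochInf (w⁻¹ * q) q)])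
  refine ⟨k, hk, he.mono fun w hw => ?_⟩
  rw [h2] at hw
  rw [← hw, cubeQuot, thetaProd, qPochInf_eq_one_sub_mul hq w]
  simp only [hf, div_eq_mul_inv, mul_inv, mul_pow, inv_pow]
  ring

/-- The principal part at `y⁻¹ = 0` of `w ^ (-3 n) · cubeQuot`, where `y = 1 / (1 - w)`. -/
noncomputable def polarPart (c : ℂ) (n : ℤ) (y : ℂ) : ℂ :=
  (y ^ 3 - y ^ 2) + 3 * n * (y ^ 2 - y) + (c + 3 * pent n) * y

theorem two_mul_pent_complex (n : ℤ) : (pent n : ℂ) = n * (3 * n + 1) / 2 := by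
  have : (2 : ℂ) * pent n = n * (3 * n + 1) := by exact_mod_cast congrArg (Int.cast (R := ℂ)) (two_mul_pent n)
  linear_combination this / 2

/-- Multiply the second-order binomial expansion of w^{1-3n} by 1 + (w-1)²k(w) and read off the
terms in y = 1/(1-w). The constant c = k(1) does not depend on n. Grouping by y² - y anticipates the
q-derivative of the terms of A_1. -/
theorem exists_polarPart (hq : ‖q‖ < 1) : ∃ c : ℂ, ∀ n : ℤ, ∃ g : ℂ → ℂ, AnalyticAt ℂ g 1 ∧
    ∀ᶠ w in 𝓝[≠] (1 : ℂ), w ^ (-3 * n) * cubeQuot q w - polarPart c n (1 - w)⁻¹ = g w := by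
  obtain ⟨k, hk, he⟩ := exists_cubeQuot_expansion hq
  refine ⟨k 1, fun n => ?_⟩
  obtain ⟨g, hg, hge⟩ := exists_zpow_expansion (1 - 3 * n)
  have hz : AnalyticAt ℂ (fun w : ℂ => w ^ (1 - 3 * n) * k w) 1 :=
    (analyticAt_id.fun_zpow one_ne_zero).mul hk
  obtain ⟨l, hl, hle⟩ := AnalyticAt.exists_eq_add_sub_mul hz
  refine ⟨fun w => -(g w + l w), (hg.add hl).neg, ?_⟩
  filter_upwards [he.filter_mono nhdsWithin_le_nhds, hle.filter_mono nhdsWithin_le_nhds,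
    (eventually_ne_nhds one_ne_zero).filter_mono nhdsWithin_le_nhds,
    self_mem_nhdsWithin] with w h1 h2 h3 h4
  have h5 : 1 - w ≠ 0 := sub_ne_zero.2 (Ne.symm h4)
  have h6 := hge w h3
  rw [one_zpow, one_mul] at h2
  have h7 : w ^ (-3 * n) * w = w ^ (1 - 3 * n) := by
    rw [← zpow_add_one₀ h3]; congr 1; ring
  have h8 : w ^ (-3 * n) * cubeQuot q w =
      (w ^ (1 - 3 * n) + (w - 1) ^ 2 * (w ^ (1 - 3 * n) * k w)) / (1 - w) ^ 3 := by
    rw [h1, ← h7]; ring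
  rw [h8, h2, h6, polarPart, two_mul_pent_complex]
  push_cast
  field_simp
  ring

end LocalExpansion

/-! ### Removable singularities and a Liouville argument on circles. -/

section RemovableExtension

/-- The extension is the punctured limit of D. A local representative of D at z computes this limit
at every nearby point too, so the limit function is analytic. -/
theorem exists_analytic_extension {D : ℂ → ℂ} {U : Set ℂ} (hU : IsOpen U)
    (hloc : ∀ z ∈ U, ∃ g, AnalyticAt ℂ g z ∧ ∀ᶠ w in 𝓝[≠] z, D w = g w) :
    ∃ F : ℂ → ℂ, (∀ z ∈ U, AnalyticAt ℂ F z) ∧ ∀ z ∈ U, ContinuousAt D z → D z = F z := by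
  have key : ∀ z ∈ U, ∀ g : ℂ → ℂ, ContinuousAt g z → (∀ᶠ w in 𝓝[≠] z, D w = g w) →
      limUnder (𝓝[≠] z) D = g z := fun z _ g hg h =>
    ((hg.tendsto.mono_left nhdsWithin_le_nhds).congr' (h.mono fun _ hw => hw.symm)).limUnder_eq
  refine ⟨fun z => limUnder (𝓝[≠] z) D, fun z hz => ?_, fun z hz hc => ?_⟩
  · obtain ⟨g, hg, h⟩ := hloc z hz
    refine hg.congr ?_
    rw [eventually_nhdsWithin_iff] at h
    filter_upwards [h.eventually_nhds, hg.eventually_analyticAt, hU.mem_nhds hz] with w hw hgw hwU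
    refine (key w hwU g hgw.continuousAt ?_).symm
    by_cases hwz : w = z
    · subst hwz
      exact eventually_nhdsWithin_iff.2 hw
    · filter_upwards [hw.filter_mono nhdsWithin_le_nhds,
        (eventually_ne_nhds hwz).filter_mono nhdsWithin_le_nhds] with x hx hxz
      exact hx hxz
  · exact ((hc.tendsto.mono_left nhdsWithin_le_nhds).limUnder_eq).symm

variable {s : ℝ}

theorem exists_zpow_odd_gt (hs0 : 0 < s) (hs1 : s < 1) (R : ℝ) : ∃ n : ℤ, R < s ^ (2 * n + 1) := by
  obtain ⟨m, hm⟩ := pow_unbounded_of_one_lt R ((one_lt_inv₀ hs0).2 hs1)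
  refine ⟨-(m + 1 : ℤ), hm.trans_le ?_⟩
  rw [← zpow_natCast, inv_zpow', show (2 * (-(m + 1 : ℤ)) + 1) = -(2 * m + 1) by ring]
  exact zpow_le_zpow_right_of_le_one₀ hs0 hs1.le (by omega)

theorem exists_zpow_odd_lt (hs0 : 0 < s) (hs1 : s < 1) {r : ℝ} (hr : 0 < r) :
    ∃ n : ℤ, s ^ (2 * n + 1) < r := by
  obtain ⟨m, hm⟩ := exists_pow_lt_of_lt_one hr hs1
  refine ⟨m, lt_of_le_of_lt ?_ hm⟩
  rw [← zpow_natCast]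
  exact zpow_le_zpow_right_of_le_one₀ hs0 hs1.le (by omega)

/-- The union of the circles `‖z‖ = s ^ (2 n + 1)`. -/
def oddCircles (s : ℝ) : Set ℂ := {z | ∃ n : ℤ, ‖z‖ = s ^ (2 * n + 1)}

theorem frontier_annulus_subset {a b : ℝ} :
    frontier {z : ℂ | a < ‖z‖ ∧ ‖z‖ < b} ⊆ {z | ‖z‖ = a ∨ ‖z‖ = b} := by
  have h : {z : ℂ | a < ‖z‖ ∧ ‖z‖ < b} = {z : ℂ | a < ‖z‖} ∩ {z | ‖z‖ < b} := rfl
  rw [h]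
  refine (frontier_inter_subset _ _).trans ?_
  rintro z (⟨h, _⟩ | ⟨_, h⟩)
  · exact Or.inl (frontier_lt_subset_eq continuous_const continuous_norm h).symm
  · exact Or.inr (frontier_lt_subset_eq continuous_norm continuous_const h)

/-- The maximum principle on an annulus around z bounded by two of the circles. -/
theorem norm_le_of_oddCircles (hs0 : 0 < s) (hs1 : s < 1) {F : ℂ → ℂ}
    (hF : ∀ z, z ≠ 0 → AnalyticAt ℂ F z) {M : ℝ} (hM : ∀ z ∈ oddCircles s, ‖F z‖ ≤ M) {z : ℂ}
    (hz : z ≠ 0) : ‖F z‖ ≤ M := by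
  obtain ⟨m, hm⟩ := exists_zpow_odd_gt hs0 hs1 ‖z‖
  obtain ⟨n, hn⟩ := exists_zpow_odd_lt hs0 hs1 (norm_pos_iff.2 hz)
  have hn0 : 0 < s ^ (2 * n + 1) := zpow_pos hs0 _
  have hcl : closure {z : ℂ | s ^ (2 * n + 1) < ‖z‖ ∧ ‖z‖ < s ^ (2 * m + 1)} ⊆
      {z | s ^ (2 * n + 1) ≤ ‖z‖} :=
    closure_minimal (fun w hw => hw.1.le) (isClosed_le continuous_const continuous_norm)
  refine Complex.norm_le_of_forall_mem_frontier_norm_le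
    (U := {z : ℂ | s ^ (2 * n + 1) < ‖z‖ ∧ ‖z‖ < s ^ (2 * m + 1)}) ?_ ?_ ?_
    (subset_closure ⟨hn, hm⟩)
  · exact Metric.isBounded_ball.subset fun w hw => mem_ball_zero_iff.2 hw.2
  · refine DifferentiableOn.diffContOnCl fun w hw => ?_
    exact (hF w (norm_pos_iff.1 (hn0.trans_le (hcl hw)))).differentiableAt.differentiableWithinAt
  · intro w hw
    rcases frontier_annulus_subset hw with h | h
    · exact hM w ⟨n, h⟩
    · exact hM w ⟨m, h⟩

/-- A function on `ℂ \ {0}` with removable singularities, bounded on the circles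
`‖z‖ = s ^ (2 n + 1)` and tending to `0` along them at infinity, vanishes. -/
theorem eq_zero_of_oddCircles (hs0 : 0 < s) (hs1 : s < 1) {D : ℂ → ℂ}
    (hloc : ∀ z, z ≠ 0 → ∃ g, AnalyticAt ℂ g z ∧ ∀ᶠ w in 𝓝[≠] z, D w = g w)
    (hc : ∀ z ∈ oddCircles s, ContinuousAt D z) {M : ℝ} (hM : ∀ z ∈ oddCircles s, ‖D z‖ ≤ M)
    (hlim : Tendsto D (Bornology.cobounded ℂ ⊓ 𝓟 (oddCircles s)) (𝓝 0)) {z : ℂ} (hz : z ≠ 0)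
    (hcz : ContinuousAt D z) : D z = 0 := by
  have hne : ∀ w ∈ oddCircles s, w ≠ 0 := by
    rintro w ⟨n, hn⟩ rfl
    rw [norm_zero] at hn
    exact (zpow_pos hs0 (2 * n + 1)).ne hn
  obtain ⟨F, hF, hDF⟩ := exists_analytic_extension (U := {0}ᶜ) isOpen_compl_singleton hloc
  have hb : ∀ w, w ≠ 0 → ‖F w‖ ≤ M := fun w hw =>
    norm_le_of_oddCircles hs0 hs1 hF (fun w hw => by
      rw [← hDF w (hne w hw) (hc w hw)]; exact hM w hw) hw
  -- Being bounded, the extension also has a removable singularity at 0; the maximum principle then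
  -- applies on whole disks.
  have hd := Complex.differentiableOn_update_limUnder_of_bddAbove (f := F) (c := 0)
    (s := Set.univ) univ_mem
    (fun w hw => (hF w hw.2).differentiableAt.differentiableWithinAt)
    ⟨M, by rintro _ ⟨w, hw, rfl⟩; exact hb w hw.2⟩
  set f := Function.update F 0 (limUnder (𝓝[≠] 0) F) with hf
  have hfF : ∀ w, w ≠ 0 → f w = F w := fun w hw => Function.update_of_ne hw _ _
  rw [hDF z hz hcz, ← hfF z hz, ← norm_le_zero_iff]
  refine le_of_forall_pos_le_add fun ε hε => ?_
  rw [zero_add]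
  have h1 := (hlim.norm.eventually (gt_mem_nhds (by simpa using hε)))
  rw [eventually_inf_principal, ← comap_norm_atTop, eventually_comap] at h1
  obtain ⟨R, hR⟩ := eventually_atTop.1 h1
  obtain ⟨m, hm⟩ := exists_zpow_odd_gt hs0 hs1 (max R ‖z‖)
  refine Complex.norm_le_of_forall_mem_frontier_norm_le (U := Metric.ball 0 (s ^ (2 * m + 1)))
    Metric.isBounded_ball ?_ (fun w hw => ?_)
    (subset_closure (mem_ball_zero_iff.2 ((le_max_right _ _).trans_lt hm)))
  · exact (hd.mono (Set.subset_univ _)).diffContOnCl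
  · have hw' : ‖w‖ = s ^ (2 * m + 1) := by
      simpa using Metric.frontier_ball_subset_sphere hw
    have hwC : w ∈ oddCircles s := ⟨m, hw'⟩
    rw [hfF w (hne w hwC), ← hDF w (hne w hwC) (hc w hwC)]
    exact (hR _ ((le_max_left _ _).trans (hw' ▸ hm.le)) w rfl hwC).le

end RemovableExtension

/-! ### The series of principal parts and its local analyticity. -/

section PolarSeries

variable {q : ℂ}

theorem pent_le (n : ℤ) : pent n ≤ 2 * n.natAbs ^ 2 := by
  have h := two_mul_pent n
  zify
  rw [sq_abs]
  rcases lt_trichotomy n 0 with h1 | rfl | h1 <;> nlinarith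

theorem norm_polarPart_le (c : ℂ) (n : ℤ) {y : ℂ} {K : ℝ} (hy : ‖y‖ ≤ K) :
    ‖polarPart c n y‖ ≤ (K ^ 3 + K ^ 2 + ‖c‖ * K) + 3 * (K ^ 2 + K) * n.natAbs +
      6 * K * n.natAbs ^ 2 := by
  have hK : 0 ≤ K := (norm_nonneg _).trans hy
  have h1 : ‖y‖ ^ 2 ≤ K ^ 2 := by gcongr
  have h2 : ‖y‖ ^ 3 ≤ K ^ 3 := by gcongr
  have h3 : (pent n : ℝ) ≤ 2 * n.natAbs ^ 2 := by exact_mod_cast pent_le n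
  have hn : ‖(n : ℂ)‖ = n.natAbs := by rw [Complex.norm_intCast]; simp
  have a1 : ‖y ^ 3 - y ^ 2‖ ≤ K ^ 3 + K ^ 2 :=
    (norm_sub_le _ _).trans (by rw [norm_pow, norm_pow]; linarith)
  have a2 : ‖3 * (n : ℂ) * (y ^ 2 - y)‖ ≤ 3 * n.natAbs * (K ^ 2 + K) := by
    rw [norm_mul, norm_mul, hn, Complex.norm_ofNat]
    gcongr
    exact (norm_sub_le _ _).trans (by rw [norm_pow]; linarith)
  have a3 : ‖(c + 3 * (pent n : ℂ)) * y‖ ≤ (‖c‖ + 3 * (2 * n.natAbs ^ 2)) * K := by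
    rw [norm_mul]
    gcongr
    refine (norm_add_le _ _).trans ?_
    rw [norm_mul, Complex.norm_ofNat, Complex.norm_natCast]
    linarith
  calc _ ≤ (K ^ 3 + K ^ 2) + 3 * n.natAbs * (K ^ 2 + K) + (‖c‖ + 3 * (2 * n.natAbs ^ 2)) * K :=
        (norm_add₃_le).trans (add_le_add (add_le_add a1 a2) a3)
    _ = _ := by ring

/-- The dominating series for `∑ pentCoeff q n * polarPart c n y`. -/
noncomputable def polarBound (c : ℂ) (K b : ℝ) (n : ℤ) : ℝ :=
  ((K ^ 3 + K ^ 2 + ‖c‖ * K) + 3 * (K ^ 2 + K) * n.natAbs + 6 * K * n.natAbs ^ 2) * b ^ n.natAbs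

theorem summable_polarBound (c : ℂ) (K : ℝ) {b : ℝ} (hb0 : 0 ≤ b) (hb : b < 1) :
    Summable (polarBound c K b) := by
  have h (k) := summable_natAbs_pow_mul_geometric hb0 hb k
  refine ((((h 0).mul_left (K ^ 3 + K ^ 2 + ‖c‖ * K)).add
    ((h 1).mul_left (3 * (K ^ 2 + K)))).add ((h 2).mul_left (6 * K))).congr fun n => ?_
  rw [polarBound]
  ring

theorem norm_pentCoeff_mul_polarPart_le (hq : ‖q‖ < 1) (c : ℂ) (n : ℤ) {y : ℂ} {K : ℝ}
    (hy : ‖y‖ ≤ K) : ‖pentCoeff q n * polarPart c n y‖ ≤ polarBound c K ‖q‖ n := by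
  rw [norm_mul, mul_comm, polarBound]
  have hK : 0 ≤ K := (norm_nonneg _).trans hy
  exact mul_le_mul (norm_polarPart_le c n hy) (norm_pentCoeff_le le_rfl hq.le n) (norm_nonneg _)
    (by positivity)

/-- Here q is fixed but z₀ may itself be a pole; an index with z₀q^n = 1 is excluded. A finite
window of indices is treated by continuity, and outside it |zq^n| or |zq^n|⁻¹ is below 1/2. -/
theorem exists_eventually_norm_inv_le_fixed (hq : ‖q‖ < 1) (hq0 : q ≠ 0) {z₀ : ℂ} (hz : z₀ ≠ 0) :
    ∃ K : ℝ, 0 < K ∧ ∀ᶠ z in 𝓝 z₀, ∀ n : ℤ, z₀ * q ^ n ≠ 1 →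
      z * q ^ n ≠ 1 ∧ ‖(1 - z * q ^ n)⁻¹‖ ≤ K := by
  have hlim := tendsto_pow_atTop_nhds_zero_of_lt_one (norm_nonneg q) hq
  obtain ⟨N, hN⟩ : ∃ N : ℕ, ∀ m ≥ N, (‖z₀‖ + 1) * ‖q‖ ^ m < 1 / 2 := by
    have := hlim.const_mul (‖z₀‖ + 1)
    rw [mul_zero] at this
    exact eventually_atTop.1 (this.eventually (gt_mem_nhds (by norm_num)))
  obtain ⟨N', hN'⟩ : ∃ N : ℕ, ∀ m ≥ N, (‖z₀⁻¹‖ + 1) * ‖q‖ ^ m < 1 / 2 := by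
    have := hlim.const_mul (‖z₀⁻¹‖ + 1)
    rw [mul_zero] at this
    exact eventually_atTop.1 (this.eventually (gt_mem_nhds (by norm_num)))
  set T : Finset ℤ := Icc (-(N' : ℤ)) N with hT
  have hmid : ∀ᶠ z in 𝓝 z₀, ∀ n ∈ T, z₀ * q ^ n ≠ 1 →
      z * q ^ n ≠ 1 ∧ ‖(1 - z * q ^ n)⁻¹‖ < ‖(1 - z₀ * q ^ n)⁻¹‖ + 1 := by
    rw [Filter.eventually_all_finset]
    intro n _
    by_cases h : z₀ * q ^ n = 1
    · exact .of_forall fun _ h' => absurd h h'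
    have hc : ContinuousAt (fun z : ℂ => z * q ^ n) z₀ := by fun_prop
    have hc' : ContinuousAt (fun z : ℂ => ‖(1 - z * q ^ n)⁻¹‖) z₀ :=
      ((continuousAt_const.sub hc).inv₀ (sub_ne_zero.2 (Ne.symm h))).norm
    filter_upwards [hc.eventually_ne h, hc'.eventually (gt_mem_nhds (lt_add_one _))] with z h1 h2 _
    exact ⟨h1, h2⟩
  have h1 : ∀ᶠ z in 𝓝 z₀, ‖z‖ < ‖z₀‖ + 1 :=
    continuousAt_id.norm.eventually (gt_mem_nhds (lt_add_one _))
  have h2 : ∀ᶠ z in 𝓝 z₀, ‖z⁻¹‖ < ‖z₀⁻¹‖ + 1 :=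
    (continuousAt_inv₀ hz).norm.eventually (gt_mem_nhds (lt_add_one _))
  refine ⟨2 + ∑ n ∈ T, (‖(1 - z₀ * q ^ n)⁻¹‖ + 1), by positivity, ?_⟩
  have hsum : 0 ≤ ∑ n ∈ T, (‖(1 - z₀ * q ^ n)⁻¹‖ + 1) := by positivity
  filter_upwards [h1, h2, hmid, eventually_ne_nhds hz] with z hz1 hz2 hz3 hz0 n hn
  by_cases hnT : n ∈ T
  · refine ⟨(hz3 n hnT hn).1, (hz3 n hnT hn).2.le.trans ?_⟩
    have := single_le_sum (f := fun n => ‖(1 - z₀ * q ^ n)⁻¹‖ + 1)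
      (fun i _ => by positivity) hnT
    linarith
  rw [hT, Finset.mem_Icc, not_and_or, not_le, not_le] at hnT
  rcases hnT with h | h
  · obtain ⟨m, rfl⟩ : ∃ m : ℕ, n = -(m : ℤ) := ⟨n.natAbs, by omega⟩
    have hm : ‖z⁻¹ * q ^ m‖ ≤ 1 / 2 := by
      rw [norm_mul, norm_pow]
      exact le_trans (by gcongr) (hN' m (by omega)).le
    have h3 := norm_inv_one_sub_le_two hm
    obtain ⟨h4, h5⟩ := inv_one_sub_mul_inv hz0 (pow_ne_zero m hq0) h3.1
    rw [zpow_neg, zpow_natCast]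
    refine ⟨h4, ?_⟩
    rw [h5, norm_neg, norm_mul]
    calc _ ≤ 1 / 2 * (2 : ℝ) := mul_le_mul hm h3.2 (norm_nonneg _) (by norm_num)
      _ ≤ _ := by linarith
  · lift n to ℕ using by omega
    rw [zpow_natCast]
    have h3 := norm_inv_one_sub_le_two (x := z * q ^ n) (by
      rw [norm_mul, norm_pow]
      exact le_trans (by gcongr) (hN n (by omega)).le)
    exact ⟨h3.1, by linarith [h3.2]⟩

/-- The Mittag-Leffler series of `cubeQuot`. -/
noncomputable def polarSeries (c q z : ℂ) : ℂ :=
  ∑' n : ℤ, pentCoeff q n * polarPart c n (1 - z * q ^ n)⁻¹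

theorem analyticAt_polarPart (c : ℂ) (n : ℤ) {z : ℂ} (h : z * q ^ n ≠ 1) :
    AnalyticAt ℂ (fun z => pentCoeff q n * polarPart c n (1 - z * q ^ n)⁻¹) z := by
  have h1 : AnalyticAt ℂ (fun z => (1 - z * q ^ n)⁻¹) z :=
    (analyticAt_const.sub (analyticAt_id.mul analyticAt_const)).inv (sub_ne_zero.2 h.symm)
  unfold polarPart
  fun_prop

/-- Near any `z₀ ≠ 0`, removing the possible singular term leaves an analytic function. -/
theorem analyticAt_tsum_regular (hq : ‖q‖ < 1) (hq0 : q ≠ 0) (c : ℂ) {z₀ : ℂ} (hz : z₀ ≠ 0) :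
    AnalyticAt ℂ (fun z => ∑' n : ℤ, if z₀ * q ^ n = 1 then 0 else
      pentCoeff q n * polarPart c n (1 - z * q ^ n)⁻¹) z₀ ∧
    ∀ᶠ z in 𝓝 z₀, Summable fun n : ℤ => if z₀ * q ^ n = 1 then 0 else
      pentCoeff q n * polarPart c n (1 - z * q ^ n)⁻¹ := by
  obtain ⟨K, hK, hKb⟩ := exists_eventually_norm_inv_le_fixed hq hq0 hz
  obtain ⟨U, hUb, hUo, hzU⟩ := eventually_nhds_iff.1 hKb
  have hs := summable_polarBound c K (norm_nonneg q) hq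
  have hle : ∀ (n : ℤ) (z : ℂ), z ∈ U → ‖if z₀ * q ^ n = 1 then 0 else
      pentCoeff q n * polarPart c n (1 - z * q ^ n)⁻¹‖ ≤ polarBound c K ‖q‖ n := by
    intro n z hzU
    split_ifs with h
    · rw [norm_zero, polarBound]; positivity
    · exact norm_pentCoeff_mul_polarPart_le hq c n (hUb z hzU n h).2
  refine ⟨?_, ?_⟩
  · refine (Complex.differentiableOn_tsum_of_summable_norm hs (fun n z hzU => ?_) hUo
      hle).analyticAt (hUo.mem_nhds hzU)
    split_ifs with h
    · exact differentiableWithinAt_const _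
    · exact (analyticAt_polarPart c n (hUb z hzU n h).1).differentiableAt.differentiableWithinAt
  · filter_upwards [hUo.mem_nhds hzU] with z hz'
    exact .of_norm_bounded hs fun n => hle n z hz'

theorem zpow_injective_of_norm_lt_one (hq : ‖q‖ < 1) (hq0 : q ≠ 0) {m n : ℤ} (h : q ^ m = q ^ n) :
    m = n := by
  have := congrArg norm h
  rw [norm_zpow, norm_zpow] at this
  exact zpow_right_injective₀ (norm_pos_iff.2 hq0) hq.ne this

theorem exists_analytic_cubeQuot_sub_polarSeries (hq : ‖q‖ < 1) (hq0 : q ≠ 0) : ∃ c : ℂ,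
    ∀ z₀ : ℂ, z₀ ≠ 0 → ∃ g, AnalyticAt ℂ g z₀ ∧
      ∀ᶠ z in 𝓝[≠] z₀, cubeQuot q z - polarSeries c q z = g z := by
  obtain ⟨c, hc⟩ := exists_polarPart hq
  refine ⟨c, fun z₀ hz => ?_⟩
  obtain ⟨hr, hrs⟩ := analyticAt_tsum_regular hq hq0 c hz
  by_cases h : ∀ n : ℤ, z₀ * q ^ n ≠ 1
  · simp only [h, if_false] at hr
    exact ⟨_, (analyticAt_cubeQuot hq hz h).sub hr, .of_forall fun z => rfl⟩
  push Not at h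
  obtain ⟨m, hm⟩ := h
  -- The powers of q are distinct, so exactly one term is singular at z₀.
  have huniq : ∀ n : ℤ, z₀ * q ^ n = 1 ↔ n = m := fun n =>
    ⟨fun h => zpow_injective_of_norm_lt_one hq hq0 (mul_left_cancel₀ hz (h.trans hm.symm)),
      fun h => h ▸ hm⟩
  obtain ⟨g, hg, hge⟩ := hc m
  have hgm : AnalyticAt ℂ (fun z => pentCoeff q m * g (z * q ^ m)) z₀ :=
    analyticAt_const.mul (hg.comp_of_eq (analyticAt_id.mul analyticAt_const) hm)
  refine ⟨_, hgm.sub hr, ?_⟩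
  have ht : Tendsto (fun z : ℂ => z * q ^ m) (𝓝[≠] z₀) (𝓝[≠] 1) := by
    refine tendsto_nhdsWithin_iff.2 ⟨?_, ?_⟩
    · rw [← hm]
      exact (continuous_id.mul continuous_const).continuousAt.tendsto.mono_left nhdsWithin_le_nhds
    · filter_upwards [self_mem_nhdsWithin] with z hz' h1
      exact hz' (mul_right_cancel₀ (zpow_ne_zero m hq0) (h1.trans hm.symm))
  filter_upwards [ht.eventually hge, hrs.filter_mono nhdsWithin_le_nhds,
    (eventually_ne_nhds hz).filter_mono nhdsWithin_le_nhds] with z h1 h2 h3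
  -- Quasi-periodicity moves the pole at z₀ to the pole of w = zq^m at 1, where the principal part
  -- is known.
  have h4 : cubeQuot q z =
      pentCoeff q m * ((z * q ^ m) ^ (-3 * m) * cubeQuot q (z * q ^ m)) := by
    rw [← mul_assoc, ← cubeQuot_mul_zpow hq hq0 (mul_ne_zero h3 (zpow_ne_zero m hq0)), mul_assoc,
      ← zpow_add₀ hq0, add_neg_cancel, zpow_zero, mul_one]
  have h5 : polarSeries c q z = pentCoeff q m * polarPart c m (1 - z * q ^ m)⁻¹ +
      ∑' n : ℤ, if z₀ * q ^ n = 1 then 0 else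
        pentCoeff q n * polarPart c n (1 - z * q ^ n)⁻¹ := by
    have h6 : HasSum (fun n : ℤ => if n = m then pentCoeff q m * polarPart c m (1 - z * q ^ m)⁻¹
        else 0) (pentCoeff q m * polarPart c m (1 - z * q ^ m)⁻¹) := hasSum_ite_eq m _
    refine (tsum_congr fun n => ?_).trans (h6.add h2.hasSum).tsum_eq
    simp only [huniq]
    split_ifs with h7
    · rw [h7, add_zero]
    · rw [zero_add]
  rw [h4, h5, Pi.sub_apply, ← h1]
  ring

end PolarSeries

/-! ### The Mittag-Leffler expansion of the crank cube. -/

section MittagLeffler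

variable {q : ℂ}

/-- With |q| = s², the norm of zq^n is an odd power of s, hence at most s or at least 1/s. The
circles keep a uniform distance from all the poles. -/
theorem norm_inv_one_sub_le_of_oddCircles {s : ℝ} (hs0 : 0 < s) (hs1 : s < 1)
    (hsq : ‖q‖ = s ^ 2) {z : ℂ} (hz : z ∈ oddCircles s) (n : ℤ) :
    z * q ^ n ≠ 1 ∧ ‖(1 - z * q ^ n)⁻¹‖ ≤ (1 - s)⁻¹ := by
  obtain ⟨N, hN⟩ := hz
  have hx : ‖z * q ^ n‖ = s ^ (2 * (N + n) + 1) := by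
    rw [norm_mul, norm_zpow, hN, hsq, ← zpow_natCast s 2, ← zpow_mul, ← zpow_add₀ hs0.ne']
    congr 1; push_cast; ring
  have h1 : 1 - s ≤ ‖1 - z * q ^ n‖ := by
    rcases le_or_gt 0 (N + n) with h | h
    · have : ‖z * q ^ n‖ ≤ s := by
        rw [hx]
        calc _ ≤ s ^ (1 : ℤ) := zpow_le_zpow_right_of_le_one₀ hs0 hs1.le (by omega)
          _ = s := zpow_one s
      have h2 := norm_sub_norm_le (1 : ℂ) (z * q ^ n)
      rw [norm_one] at h2
      linarith
    · have : s⁻¹ ≤ ‖z * q ^ n‖ := by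
        rw [hx, ← zpow_neg_one]
        exact zpow_le_zpow_right_of_le_one₀ hs0 hs1.le (by omega)
      have h2 := norm_sub_norm_le (z * q ^ n) 1
      rw [norm_one, norm_sub_rev] at h2
      -- This gives 1/s - 1 ≥ 1 - s, so the outer case satisfies the same bound as the inner one.
      have h3 : 2 ≤ s + s⁻¹ := by
        have : s * s⁻¹ = 1 := mul_inv_cancel₀ hs0.ne'
        nlinarith [sq_nonneg (s - s⁻¹), inv_pos.2 hs0, sq_nonneg (s + s⁻¹ - 2)]
      linarith
  have hpos : 0 < 1 - s := sub_pos.2 hs1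
  refine ⟨fun h => ?_, ?_⟩
  · rw [h, sub_self, norm_zero] at h1; linarith
  · rw [norm_inv]; exact inv_anti₀ hpos h1

/-- Quasi-periodicity transports each circle to the compact circle |w| = s at the cost of a factor
s^{3n²+2n}. Comparing this exponent with 0, 2n and -(2n+1) gives boundedness, decay at 0 and decay
at infinity. -/
theorem exists_norm_cubeQuot_le {s : ℝ} (hs0 : 0 < s) (hs1 : s < 1) (hsq : ‖q‖ = s ^ 2) :
    ∃ B : ℝ, 0 < B ∧ ∀ z ∈ oddCircles s,
      ‖cubeQuot q z‖ ≤ B ∧ ‖cubeQuot q z‖ ≤ B * (s⁻¹ * ‖z‖) ∧ ‖cubeQuot q z‖ ≤ B * ‖z‖⁻¹ := by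
  have hq : ‖q‖ < 1 := by rw [hsq]; exact pow_lt_one₀ hs0.le hs1 (by norm_num)
  have hq0 : q ≠ 0 := norm_pos_iff.1 (by rw [hsq]; positivity)
  have hmem : ∀ z ∈ Metric.sphere (0 : ℂ) s, z ∈ oddCircles s ∧ z ≠ 0 := fun z hz => by
    rw [mem_sphere_zero_iff_norm] at hz
    exact ⟨⟨0, by simpa using hz⟩, norm_pos_iff.1 (hz ▸ hs0)⟩
  have hcont : ContinuousOn (cubeQuot q) (Metric.sphere 0 s) := fun z hz =>
    (analyticAt_cubeQuot hq (hmem z hz).2 fun n =>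
      (norm_inv_one_sub_le_of_oddCircles hs0 hs1 hsq (hmem z hz).1 n).1).continuousAt.continuousWithinAt
  obtain ⟨B, hB⟩ := (isCompact_sphere (0 : ℂ) s).exists_bound_of_continuousOn hcont
  refine ⟨max B 1, by positivity, fun z hz => ?_⟩
  obtain ⟨n, hn⟩ := hz
  have hz0 : z ≠ 0 := norm_pos_iff.1 (hn ▸ zpow_pos hs0 _)
  set w := z * q ^ (-n) with hw
  have hqn := zpow_ne_zero (-n) hq0
  have hw0 : w ≠ 0 := mul_ne_zero hz0 hqn
  have hnq : ∀ m : ℤ, ‖q‖ ^ m = s ^ (2 * m) := fun m => by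
    rw [hsq, ← zpow_natCast s 2, ← zpow_mul]; norm_cast
  have hws : ‖w‖ = s := by
    rw [hw, norm_mul, norm_zpow, hn, hnq, ← zpow_add₀ hs0.ne']
    convert zpow_one s using 2
    ring
  have hzw : z = w * q ^ (-(-n)) := by
    rw [hw, mul_assoc, ← zpow_add₀ hq0, add_neg_cancel, zpow_zero, mul_one]
  have hG : ‖cubeQuot q z‖ = s ^ (3 * n ^ 2 + 2 * n) * ‖cubeQuot q w‖ := by
    have hp : ‖pentCoeff q (-n)‖ = s ^ (3 * n ^ 2 - n) := by
      rw [pentCoeff, norm_mul, norm_pow, norm_zpow, norm_neg, norm_one, one_zpow, one_mul,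
        ← zpow_natCast, hnq]
      congr 1
      rw [two_mul_pent]; ring
    rw [hzw, cubeQuot_mul_zpow hq hq0 hw0, norm_mul, norm_mul, norm_zpow, hws, hp,
      ← zpow_add₀ hs0.ne']
    congr 2; ring
  have hGw : ‖cubeQuot q w‖ ≤ max B 1 :=
    (hB w (mem_sphere_zero_iff_norm.2 hws)).trans (le_max_left _ _)
  have hle : ∀ j : ℤ, j ≤ 3 * n ^ 2 + 2 * n → ‖cubeQuot q z‖ ≤ max B 1 * s ^ j := fun j hj => by
    rw [hG, mul_comm]
    exact mul_le_mul hGw (zpow_le_zpow_right_of_le_one₀ hs0 hs1.le hj) (by positivity)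
      (by positivity)
  have h1 : 0 ≤ (3 * n + 1) * (n + 1) := by
    rcases le_or_gt 0 n with h | h
    · positivity
    · exact mul_nonneg_of_nonpos_of_nonpos (by omega) (by omega)
  refine ⟨?_, ?_, ?_⟩
  · have := hle 0 (by
      rcases lt_trichotomy n 0 with h | rfl | h <;> nlinarith)
    simpa using this
  · refine (hle (2 * n) (by nlinarith)).trans_eq ?_
    rw [hn, zpow_add_one₀ hs0.ne']
    field_simp
  · refine (hle (-(2 * n + 1)) (by nlinarith)).trans_eq ?_
    rw [hn, zpow_neg]

theorem tendsto_polarSeries {s : ℝ} (hs0 : 0 < s) (hs1 : s < 1) (hsq : ‖q‖ = s ^ 2) (c y₀ : ℂ)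
    {l : Filter ℂ} (hl : l ≤ 𝓟 (oddCircles s))
    (hy : ∀ n : ℤ, Tendsto (fun z => (1 - z * q ^ n)⁻¹) l (𝓝 y₀)) :
    Tendsto (polarSeries c q) l (𝓝 (∑' n : ℤ, pentCoeff q n * polarPart c n y₀)) := by
  have hq : ‖q‖ < 1 := by rw [hsq]; exact pow_lt_one₀ hs0.le hs1 (by norm_num)
  refine tendsto_tsum_of_dominated_convergence
    (summable_polarBound c (1 - s)⁻¹ (norm_nonneg q) hq) (fun n => ?_) ?_
  · have hc : Continuous fun y => pentCoeff q n * polarPart c n y := by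
      unfold polarPart; fun_prop
    exact (hc.tendsto y₀).comp (hy n)
  · filter_upwards [hl (mem_principal_self _)] with z hz n
    exact norm_pentCoeff_mul_polarPart_le hq c n
      (norm_inv_one_sub_le_of_oddCircles hs0 hs1 hsq hz n).2

/-- The Mittag-Leffler expansion of `cubeQuot`, with the linear relation satisfied by the residue
at `z = 1`. -/
theorem exists_cubeQuot_eq_polarSeries (hq : ‖q‖ < 1) (hq0 : q ≠ 0) : ∃ c : ℂ,
    (∀ z, z ≠ 0 → (∀ n : ℤ, z * q ^ n ≠ 1) → cubeQuot q z = polarSeries c q z) ∧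
      ∑' n : ℤ, pentCoeff q n * (c + 3 * pent n) = 0 := by
  obtain ⟨c, hc⟩ := exists_analytic_cubeQuot_sub_polarSeries hq hq0
  set s := √‖q‖ with hs
  have hs0 : 0 < s := Real.sqrt_pos.2 (norm_pos_iff.2 hq0)
  have hs1 : s < 1 := by rw [hs, Real.sqrt_lt' one_pos, one_pow]; exact hq
  have hsq : ‖q‖ = s ^ 2 := (Real.sq_sqrt (norm_nonneg q)).symm
  obtain ⟨B, hB, hBb⟩ := exists_norm_cubeQuot_le hs0 hs1 hsq
  have hsb := summable_polarBound c (1 - s)⁻¹ (norm_nonneg q) hq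
  have hne : ∀ z ∈ oddCircles s, z ≠ 0 := fun z ⟨n, hn⟩ =>
    norm_pos_iff.1 (hn ▸ zpow_pos hs0 _)
  have hcont : ∀ z, z ≠ 0 → (∀ n : ℤ, z * q ^ n ≠ 1) →
      ContinuousAt (fun z => cubeQuot q z - polarSeries c q z) z := fun z hz h => by
    refine (analyticAt_cubeQuot hq hz h).continuousAt.sub ?_
    have := (analyticAt_tsum_regular hq hq0 c hz).1
    simp only [h, if_false] at this
    exact this.continuousAt
  have hcontC : ∀ z ∈ oddCircles s,
      ContinuousAt (fun z => cubeQuot q z - polarSeries c q z) z := fun z hz =>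
    hcont z (hne z hz) fun n => (norm_inv_one_sub_le_of_oddCircles hs0 hs1 hsq hz n).1
  have hlim : Tendsto (fun z => cubeQuot q z - polarSeries c q z)
      (Bornology.cobounded ℂ ⊓ 𝓟 (oddCircles s)) (𝓝 0) := by
    have h1 : Tendsto (cubeQuot q) (Bornology.cobounded ℂ ⊓ 𝓟 (oddCircles s)) (𝓝 0) := by
      refine squeeze_zero_norm' (a := fun z => B * ‖z‖⁻¹)
        ((eventually_inf_principal.2 (.of_forall fun z hz => (hBb z hz).2.2))) ?_
      simpa using ((tendsto_inv_atTop_zero.comp tendsto_norm_cobounded_atTop).mono_left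
        inf_le_left).const_mul B
    have h2 := tendsto_polarSeries hs0 hs1 hsq c 0
      (l := Bornology.cobounded ℂ ⊓ 𝓟 (oddCircles s)) inf_le_right fun n => by
        refine Tendsto.mono_left ?_ inf_le_left
        refine tendsto_inv₀_cobounded.comp ?_
        rw [← tendsto_norm_atTop_iff_cobounded]
        have : Tendsto (fun z : ℂ => ‖z‖ * ‖q ^ n‖ - 1) (Bornology.cobounded ℂ) atTop :=
          tendsto_atTop_add_const_right _ _ (tendsto_norm_cobounded_atTop.atTop_mul_const
            (norm_pos_iff.2 (zpow_ne_zero n hq0)))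
        refine tendsto_atTop_mono (fun z => ?_) this
        have h2 := norm_sub_norm_le (z * q ^ n) 1
        rwa [norm_one, norm_sub_rev, norm_mul] at h2
    -- At infinity each y = 1/(1-zq^n) tends to 0, where the polar parts vanish since they have no
    -- constant term.
    have h3 : ∑' n : ℤ, pentCoeff q n * polarPart c n 0 = 0 := by simp [polarPart]
    rw [h3] at h2
    simpa using h1.sub h2
  have heq : ∀ z, z ≠ 0 → (∀ n : ℤ, z * q ^ n ≠ 1) → cubeQuot q z = polarSeries c q z :=
    fun z hz h => sub_eq_zero.1 (eq_zero_of_oddCircles hs0 hs1 hc hcontC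
      (M := B + ∑' n, polarBound c (1 - s)⁻¹ ‖q‖ n) (fun z hz => by
        refine (norm_sub_le _ _).trans (add_le_add (hBb z hz).1 ?_)
        exact tsum_of_norm_bounded hsb.hasSum fun n => norm_pentCoeff_mul_polarPart_le hq c n
          (norm_inv_one_sub_le_of_oddCircles hs0 hs1 hsq hz n).2)
      hlim hz (hcont z hz h))
  refine ⟨c, heq, ?_⟩
  -- A sequence on the circles tending to 0. There y → 1 and the polar parts tend to c + 3n(3n+1)/2,
  -- while `cubeQuot` tends to 0; this is the relation fixing c.
  set u : ℕ → ℂ := fun n => ((s ^ (2 * n + 1) : ℝ) : ℂ) with hu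
  have huC : ∀ n, u n ∈ oddCircles s := fun n => ⟨n, by
    rw [hu, Complex.norm_real, Real.norm_of_nonneg (by positivity)]; norm_cast⟩
  have hu0 : Tendsto u atTop (𝓝 0) := by
    have h1 : Tendsto (fun n : ℕ => s ^ (2 * n + 1)) atTop (𝓝 0) :=
      (tendsto_pow_atTop_nhds_zero_of_lt_one hs0.le hs1).comp
        (tendsto_atTop_mono (fun n => show n ≤ 2 * n + 1 by omega) tendsto_id)
    rw [← Complex.ofReal_zero]
    exact (Complex.continuous_ofReal.tendsto 0).comp h1
  have h1 := (tendsto_polarSeries hs0 hs1 hsq c 1 (l := map u atTop)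
    (by rw [le_principal_iff, Filter.mem_map]; exact Filter.Eventually.of_forall huC) fun n => by
      rw [tendsto_map'_iff]
      have : Tendsto (fun z : ℂ => (1 - z * q ^ n)⁻¹) (𝓝 0) (𝓝 (1 - 0 * q ^ n)⁻¹) := by
        refine ContinuousAt.tendsto (ContinuousAt.inv₀ (by fun_prop) (by simp))
      rw [zero_mul, sub_zero, inv_one] at this
      exact this.comp hu0)
  rw [tendsto_map'_iff] at h1
  have h2 : Tendsto (polarSeries c q ∘ u) atTop (𝓝 0) := by
    refine squeeze_zero_norm (a := fun n => B * (s⁻¹ * ‖u n‖)) (fun n => ?_) ?_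
    · rw [Function.comp_apply, ← heq (u n) (hne _ (huC n)) fun m =>
        (norm_inv_one_sub_le_of_oddCircles hs0 hs1 hsq (huC n) m).1]
      exact (hBb _ (huC n)).2.1
    · simpa using (hu0.norm.const_mul s⁻¹).const_mul B
  have h3 := tendsto_nhds_unique h1 h2
  rw [← h3]
  simp [polarPart]

end MittagLeffler

/-! ### Analyticity of the rank series in each variable. -/

section Analyticity

/-- The quadratic exponent beats any geometric growth: b^{n²}K^n = (b^n K)^n, with b^n K eventually
at most 1/2. -/
theorem summable_pow_sq_mul_pow {b K : ℝ} (hb0 : 0 ≤ b) (hb : b < 1) (hK : 0 ≤ K) :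
    Summable fun n : ℕ => b ^ (n + 1) ^ 2 * K ^ (n + 1) := by
  have h1 : Tendsto (fun n : ℕ => b ^ n * K) atTop (𝓝 0) := by
    simpa using (tendsto_pow_atTop_nhds_zero_of_lt_one hb0 hb).mul_const K
  have h2 := h1.eventually (ge_mem_nhds (show (0 : ℝ) < 1 / 2 by norm_num))
  rw [summable_nat_add_iff (f := fun n : ℕ => b ^ n ^ 2 * K ^ n) 1]
  refine .of_norm_bounded_eventually_nat (g := fun n => (1 / 2 : ℝ) ^ n)
    (summable_geometric_of_lt_one (by norm_num) (by norm_num)) ?_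
  filter_upwards [h2] with n hn
  rw [sq, pow_mul, ← mul_pow, Real.norm_of_nonneg (by positivity)]
  exact pow_le_pow_left₀ (by positivity) hn n

variable {z q : ℂ}

theorem norm_inv_qPoch_mul_le {K : ℝ} (h : ∀ n : ℕ, ‖(1 - z * q ^ (n + 1))⁻¹‖ ≤ K) (n : ℕ) :
    ‖(qPoch (z * q) q n)⁻¹‖ ≤ K ^ n := by
  rw [qPoch, ← prod_inv_distrib]
  have h1 : ∏ _i ∈ range n, K = K ^ n := by rw [prod_const, card_range]
  rw [← h1]
  refine (Finset.norm_prod_le _ _).trans (prod_le_prod (fun _ _ => norm_nonneg _) fun i _ => ?_)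
  rw [mul_assoc, ← pow_succ']
  exact h i

theorem qPoch_mul_ne_zero (h : ∀ n : ℕ, z * q ^ (n + 1) ≠ 1) (n : ℕ) : qPoch (z * q) q n ≠ 0 :=
  qPoch_ne_zero (fun i => by rw [mul_assoc, ← pow_succ']; exact h i) n

/-- Locally uniform domination of the series defining `R`. -/
theorem exists_eventually_norm_term_le (hq : ‖q‖ < 1) (hz : z ≠ 0)
    (h1 : ∀ n : ℕ, z * q ^ (n + 1) ≠ 1) (h2 : ∀ n : ℕ, z⁻¹ * q ^ (n + 1) ≠ 1) :
    ∃ u : ℕ → ℝ, Summable u ∧ ∀ᶠ p : ℂ × ℂ in 𝓝 (z, q), p.1 ≠ 0 ∧ ∀ n : ℕ,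
      qPoch (p.1 * p.2) p.2 (n + 1) ≠ 0 ∧ qPoch (p.1⁻¹ * p.2) p.2 (n + 1) ≠ 0 ∧
      ‖p.2 ^ ((n + 1) ^ 2) /
        (qPoch (p.1 * p.2) p.2 (n + 1) * qPoch (p.1⁻¹ * p.2) p.2 (n + 1))‖ ≤ u n := by
  obtain ⟨K, hK, hKb⟩ := exists_eventually_norm_inv_le_nat hq h1
  obtain ⟨L, hL, hLb⟩ := exists_eventually_norm_inv_le_nat hq h2
  obtain ⟨b, hqb, hb⟩ := exists_between hq
  have hb0 : 0 ≤ b := (norm_nonneg _).trans hqb.le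
  have hf : ContinuousAt (fun p : ℂ × ℂ => p.1) (z, q) := continuousAt_fst
  have hs : ContinuousAt (fun p : ℂ × ℂ => p.2) (z, q) := continuousAt_snd
  have hi : ContinuousAt (fun p : ℂ × ℂ => p.1⁻¹) (z, q) := hf.inv₀ hz
  have hc : Tendsto (fun p : ℂ × ℂ => (p.1⁻¹, p.2)) (𝓝 (z, q)) (𝓝 (z⁻¹, q)) := hi.prodMk hs
  have hLb' := hc.eventually hLb
  have hbd : ∀ᶠ p : ℂ × ℂ in 𝓝 (z, q), ‖p.2‖ < b := hs.norm.eventually (gt_mem_nhds hqb)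
  refine ⟨_, summable_pow_sq_mul_pow hb0 hb (mul_nonneg hK.le hL.le), ?_⟩
  filter_upwards [hKb, hLb', hbd, hf.eventually_ne hz] with p pK pL pb p0
  refine ⟨p0, fun n => ⟨qPoch_mul_ne_zero (fun n => (pK n).1) _,
    qPoch_mul_ne_zero (fun n => (pL n).1) _, ?_⟩⟩
  have e1 := norm_inv_qPoch_mul_le (fun n => (pK n).2) (n + 1)
  have e2 := norm_inv_qPoch_mul_le (fun n => (pL n).2) (n + 1)
  rw [div_eq_mul_inv, mul_inv, norm_mul, norm_mul, norm_pow, mul_pow]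
  refine mul_le_mul (pow_le_pow_left₀ (norm_nonneg _) pb.le _)
    (mul_le_mul e1 e2 (norm_nonneg _) (by positivity)) (by positivity) (by positivity)

theorem analyticAt_R_left (hq : ‖q‖ < 1) (hz : z ≠ 0)
    (h1 : ∀ n : ℕ, z * q ^ (n + 1) ≠ 1) (h2 : ∀ n : ℕ, z⁻¹ * q ^ (n + 1) ≠ 1) :
    AnalyticAt ℂ (fun w => R w q) z := by
  obtain ⟨u, hu, hev⟩ := exists_eventually_norm_term_le hq hz h1 h2
  have hev' := (Continuous.prodMk_left q).continuousAt.tendsto.eventually hev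
  obtain ⟨U, hU, hUo, hzU⟩ := eventually_nhds_iff.1 hev'
  refine analyticAt_const.add ((Complex.differentiableOn_tsum_of_summable_norm hu
    (fun n w hw => ?_) hUo fun n w hw => ((hU w hw).2 n).2.2).analyticAt (hUo.mem_nhds hzU))
  obtain ⟨w0, hw'⟩ := hU w hw
  refine DifferentiableAt.differentiableWithinAt (DifferentiableAt.div (by fun_prop) ?_
    (mul_ne_zero (hw' n).1 (hw' n).2.1))
  unfold qPoch
  refine DifferentiableAt.mul ?_ ?_
  · exact DifferentiableAt.fun_finsetProd fun i _ => by fun_prop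
  · refine DifferentiableAt.fun_finsetProd fun i _ => ?_
    have hi : DifferentiableAt ℂ (fun w : ℂ => w⁻¹) w := differentiableAt_inv w0
    exact ((hi.mul_const q).mul_const (q ^ i)).const_sub 1

theorem analyticAt_R_right (hq : ‖q‖ < 1) (hz : z ≠ 0)
    (h1 : ∀ n : ℕ, z * q ^ (n + 1) ≠ 1) (h2 : ∀ n : ℕ, z⁻¹ * q ^ (n + 1) ≠ 1) :
    AnalyticAt ℂ (fun t => R z t) q := by
  obtain ⟨u, hu, hev⟩ := exists_eventually_norm_term_le hq hz h1 h2
  have hev' := (Continuous.prodMk_right z).continuousAt.tendsto.eventually hev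
  obtain ⟨U, hU, hUo, hqU⟩ := eventually_nhds_iff.1 hev'
  refine analyticAt_const.add ((Complex.differentiableOn_tsum_of_summable_norm hu
    (fun n w hw => ?_) hUo fun n w hw => ((hU w hw).2 n).2.2).analyticAt (hUo.mem_nhds hqU))
  obtain ⟨w0, hw'⟩ := hU w hw
  refine DifferentiableAt.differentiableWithinAt (DifferentiableAt.div (by fun_prop) ?_
    (mul_ne_zero (hw' n).1 (hw' n).2.1))
  unfold qPoch
  exact DifferentiableAt.mul (DifferentiableAt.fun_finsetProd fun i _ => by fun_prop)
    (DifferentiableAt.fun_finsetProd fun i _ => by fun_prop)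

end Analyticity

/-! ### The crank product in terms of infinite Pochhammer symbols. -/

section CrankProduct

variable {z q : ℂ}

theorem hasProd_inv_one_sub_mul_pow (hq : ‖q‖ < 1) {a : ℂ} (h : ∀ i, a * q ^ i ≠ 1) :
    HasProd (fun i : ℕ => (1 - a * q ^ i)⁻¹) (qPochInf a q)⁻¹ := by
  have h1 : HasProd (fun i : ℕ => 1 - a * q ^ i) (qPochInf a q) :=
    (multipliable_one_sub_mul_pow hq a).hasProd
  have h2 := Tendsto.inv₀ h1 (qPochInf_ne_zero hq h)
  simp only [← prod_inv_distrib] at h2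
  exact h2

theorem C_eq (hq : ‖q‖ < 1) (h1 : ∀ n : ℕ, z * q ^ (n + 1) ≠ 1)
    (h2 : ∀ n : ℕ, z⁻¹ * q ^ (n + 1) ≠ 1) :
    C z q = qPochInf q q / (qPochInf (z * q) q * qPochInf (z⁻¹ * q) q) := by
  have p0 : HasProd (fun i : ℕ => 1 - q * q ^ i) (qPochInf q q) :=
    (multipliable_one_sub_mul_pow hq q).hasProd
  have p1 := hasProd_inv_one_sub_mul_pow (a := z * q) hq fun i => by
    rw [mul_assoc, ← pow_succ']; exact h1 i
  have p2 := hasProd_inv_one_sub_mul_pow (a := z⁻¹ * q) hq fun i => by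
    rw [mul_assoc, ← pow_succ']; exact h2 i
  have h3 := (p0.mul (p1.mul p2)).tprod_eq
  rw [div_eq_mul_inv, mul_inv, ← h3, C]
  congr 1; ext n
  rw [div_eq_mul_inv, mul_inv, pow_succ', mul_assoc, mul_assoc]

theorem cubeQuot_eq_Cstar (hq : ‖q‖ < 1) (hz1 : z ≠ 1)
    (h1 : ∀ n : ℕ, z * q ^ (n + 1) ≠ 1) (h2 : ∀ n : ℕ, z⁻¹ * q ^ (n + 1) ≠ 1) :
    cubeQuot q z = z * qPochInf q q ^ 3 * Cstar z q ^ 3 := by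
  have e0 : 1 - z ≠ 0 := sub_ne_zero.2 hz1.symm
  have e1 := qPochInf_ne_zero (a := z * q) hq fun i => by
    rw [mul_assoc, ← pow_succ']; exact h1 i
  have e2 := qPochInf_ne_zero (a := z⁻¹ * q) hq fun i => by
    rw [mul_assoc, ← pow_succ']; exact h2 i
  rw [cubeQuot, Cstar, C_eq hq h1 h2, thetaProd, qPochInf_eq_one_sub_mul hq z]
  field_simp

end CrankProduct

/-! ### Termwise differentiation of the Appell–Lerch sums. -/

section TermwiseDerivatives

variable {z q : ℂ}

/-- The domain of the Appell–Lerch sum. -/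
def AppellDomain (z q : ℂ) : Prop := z ≠ 0 ∧ q ≠ 0 ∧ ‖q‖ < 1 ∧ ∀ n : ℤ, z * q ^ n ≠ 1

theorem AppellDomain.exists_bound (h : AppellDomain z q) : ∃ K b : ℝ, 0 < K ∧ 0 ≤ b ∧ b < 1 ∧
    ∀ᶠ p : ℂ × ℂ in 𝓝 (z, q), AppellDomain p.1 p.2 ∧ ‖p.2‖ ≤ b ∧
      ∀ n : ℤ, ‖(1 - p.1 * p.2 ^ n)⁻¹‖ ≤ K := by
  obtain ⟨hz, hq0, hq, hn⟩ := h
  obtain ⟨K, hK, hKb⟩ := exists_eventually_norm_inv_le hq hq0 hz hn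
  obtain ⟨b, hqb, hb⟩ := exists_between hq
  have hf : ContinuousAt (fun p : ℂ × ℂ => p.1) (z, q) := continuousAt_fst
  have hs : ContinuousAt (fun p : ℂ × ℂ => p.2) (z, q) := continuousAt_snd
  have hbd : ∀ᶠ p : ℂ × ℂ in 𝓝 (z, q), ‖p.2‖ < b := hs.norm.eventually (gt_mem_nhds hqb)
  refine ⟨K, b, hK, (norm_nonneg _).trans hqb.le, hb, ?_⟩
  filter_upwards [hKb, hbd, hf.eventually_ne hz, hs.eventually_ne hq0] with p pK pb p1 p2
  exact ⟨⟨p1, p2, pb.trans hb, fun n => (pK n).1⟩, pb.le, fun n => (pK n).2⟩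

theorem AppellDomain.eventually_left (h : AppellDomain z q) :
    ∀ᶠ w in 𝓝 z, AppellDomain w q := by
  obtain ⟨K, b, -, -, -, hev⟩ := h.exists_bound
  exact ((Continuous.prodMk_left q).continuousAt.tendsto.eventually hev).mono fun _ h => h.1

theorem AppellDomain.eventually_right (h : AppellDomain z q) :
    ∀ᶠ t in 𝓝 q, AppellDomain z t := by
  obtain ⟨K, b, -, -, -, hev⟩ := h.exists_bound
  exact ((Continuous.prodMk_right z).continuousAt.tendsto.eventually hev).mono fun _ h => h.1

/-- The sum `∑ (-1) ^ n q ^ (n (3 n + 1) / 2) / (1 - z q ^ n) ^ k`. -/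
noncomputable def appellSumPow (k : ℕ) (z q : ℂ) : ℂ :=
  ∑' n : ℤ, pentCoeff q n * (1 - z * q ^ n)⁻¹ ^ k

theorem norm_pentCoeff_mul_pow_le {K b : ℝ} {y : ℂ} (hqb : ‖q‖ ≤ b) (hb : b ≤ 1) (k : ℕ) (n : ℤ)
    (hy : ‖y‖ ≤ K) : ‖pentCoeff q n * y ^ k‖ ≤ K ^ k * b ^ n.natAbs := by
  have hK : 0 ≤ K := (norm_nonneg _).trans hy
  rw [norm_mul, norm_pow, mul_comm]
  exact mul_le_mul (pow_le_pow_left₀ (norm_nonneg _) hy k) (norm_pentCoeff_le hqb hb n)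
    (norm_nonneg _) (by positivity)

theorem summable_const_mul_pow_natAbs {b : ℝ} (hb0 : 0 ≤ b) (hb : b < 1) (A : ℝ) :
    Summable fun n : ℤ => A * b ^ n.natAbs := by
  simpa using (summable_natAbs_pow_mul_geometric hb0 hb 0).mul_left A

theorem AppellDomain.summable_pow (h : AppellDomain z q) (k : ℕ) :
    Summable fun n : ℤ => pentCoeff q n * (1 - z * q ^ n)⁻¹ ^ k := by
  obtain ⟨K, b, -, hb0, hb, hev⟩ := h.exists_bound
  obtain ⟨-, h2, h3⟩ := hev.self_of_nhds
  exact .of_norm_bounded (summable_const_mul_pow_natAbs hb0 hb (K ^ k)) fun n =>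
    norm_pentCoeff_mul_pow_le h2 hb.le k n (h3 n)

/-- With y = 1/(1-zq^n) one has δ_z y = y² - y, hence δ_z y^k = k(y^{k+1} - y^k). The z-derivatives
therefore stay in the span of the sums A_k. -/
theorem AppellDomain.hasDerivAt_term (h : AppellDomain z q) (k : ℕ) (n : ℤ) :
    HasDerivAt (fun w => pentCoeff q n * (1 - w * q ^ n)⁻¹ ^ k)
      (z⁻¹ * (k * (pentCoeff q n * (1 - z * q ^ n)⁻¹ ^ (k + 1) -
        pentCoeff q n * (1 - z * q ^ n)⁻¹ ^ k))) z := by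
  have h0 := h.1
  have h1 : 1 - z * q ^ n ≠ 0 := sub_ne_zero.2 (h.2.2.2 n).symm
  have h2 : HasDerivAt (fun w : ℂ => 1 - w * q ^ n) (-(1 * q ^ n)) z :=
    ((hasDerivAt_id z).mul_const (q ^ n)).const_sub 1
  refine (((h2.fun_inv h1).fun_pow k).const_mul (pentCoeff q n)).congr_deriv ?_
  cases k with
  | zero => simp
  | succ k =>
    have e : (1 - z * q ^ n)⁻¹ ^ 2 - (1 - z * q ^ n)⁻¹ = z * q ^ n / (1 - z * q ^ n) ^ 2 := by
      field_simp
      ring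
    rw [← mul_sub, show ∀ y : ℂ, y ^ (k + 1 + 1) - y ^ (k + 1) = y ^ k * (y ^ 2 - y) by
      intro y; ring, e, Nat.add_sub_cancel]
    field_simp

theorem AppellDomain.hasDerivAt_appellSumPow (h : AppellDomain z q) (k : ℕ) :
    HasDerivAt (fun w => appellSumPow k w q)
      (z⁻¹ * (k * (appellSumPow (k + 1) z q - appellSumPow k z q))) z := by
  obtain ⟨K, b, -, hb0, hb, hev⟩ := h.exists_bound
  obtain ⟨U, hU, hUo, hzU⟩ :=
    eventually_nhds_iff.1 ((Continuous.prodMk_left q).continuousAt.tendsto.eventually hev)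
  have hs := summable_const_mul_pow_natAbs hb0 hb (K ^ k)
  have hd : ∀ n : ℤ, DifferentiableOn ℂ (fun w => pentCoeff q n * (1 - w * q ^ n)⁻¹ ^ k) U :=
    fun n w hw => ((hU w hw).1.hasDerivAt_term k n).differentiableAt.differentiableWithinAt
  have hle : ∀ (n : ℤ) (w : ℂ), w ∈ U →
      ‖pentCoeff q n * (1 - w * q ^ n)⁻¹ ^ k‖ ≤ K ^ k * b ^ n.natAbs := fun n w hw =>
    norm_pentCoeff_mul_pow_le (hU w hw).2.1 hb.le k n ((hU w hw).2.2 n)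
  have h1 := (Complex.hasSum_deriv_of_summable_norm hs hd hUo hle hzU).tsum_eq
  have h2 := ((Complex.differentiableOn_tsum_of_summable_norm hs hd hUo hle).differentiableAt
    (hUo.mem_nhds hzU)).hasDerivAt
  rw [← h1] at h2
  refine h2.congr_deriv ?_
  simp only [(h.hasDerivAt_term k _).deriv]
  rw [tsum_mul_left, tsum_mul_left, (h.summable_pow (k + 1)).tsum_sub (h.summable_pow k)]
  rfl

theorem hasDerivAt_pentCoeff (hq0 : q ≠ 0) (n : ℤ) :
    HasDerivAt (fun t => pentCoeff t n) (q⁻¹ * (pent n * pentCoeff q n)) q := by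
  refine ((hasDerivAt_pow (pent n) q).const_mul ((-1 : ℂ) ^ n)).congr_deriv ?_
  rw [pentCoeff]
  rcases Nat.eq_zero_or_pos (pent n) with h | h
  · simp [h]
  · obtain ⟨m, hm⟩ := Nat.exists_eq_succ_of_ne_zero h.ne'
    rw [hm, Nat.succ_sub_one, pow_succ]
    field_simp

theorem hasDerivAt_tsum_pentCoeff (hq : ‖q‖ < 1) (hq0 : q ≠ 0) :
    HasDerivAt (fun t => ∑' n, pentCoeff t n) (q⁻¹ * ∑' n : ℤ, pent n * pentCoeff q n) q := by
  obtain ⟨b, hqb, hb⟩ := exists_between hq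
  have hb0 : 0 ≤ b := (norm_nonneg _).trans hqb.le
  have hs := summable_const_mul_pow_natAbs hb0 hb 1
  set U : Set ℂ := Metric.ball 0 b with hU
  have hqU : q ∈ U := mem_ball_zero_iff.2 hqb
  have hd : ∀ n : ℤ, DifferentiableOn ℂ (fun t => pentCoeff t n) U := fun n => by
    unfold pentCoeff; fun_prop
  have hle : ∀ (n : ℤ) (t : ℂ), t ∈ U → ‖pentCoeff t n‖ ≤ 1 * b ^ n.natAbs := fun n t ht => by
    rw [one_mul]; exact norm_pentCoeff_le (mem_ball_zero_iff.1 ht).le hb.le n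
  have h1 := (Complex.hasSum_deriv_of_summable_norm hs hd Metric.isOpen_ball hle hqU).tsum_eq
  have h2 := ((Complex.differentiableOn_tsum_of_summable_norm hs hd Metric.isOpen_ball
    hle).differentiableAt (Metric.isOpen_ball.mem_nhds hqU)).hasDerivAt
  rw [← h1] at h2
  refine h2.congr_deriv ?_
  simp only [(hasDerivAt_pentCoeff hq0 _).deriv]
  rw [tsum_mul_left]

/-- The factor δ_q y is n(y² - y), and the pentagonal power contributes its exponent: precisely the
shape of the n-dependent part of `polarPart`, up to the factor 3. -/
theorem AppellDomain.hasDerivAt_term_right (h : AppellDomain z q) (n : ℤ) :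
    HasDerivAt (fun t => pentCoeff t n * (1 - z * t ^ n)⁻¹)
      (q⁻¹ * (pentCoeff q n * (pent n * (1 - z * q ^ n)⁻¹ +
        n * ((1 - z * q ^ n)⁻¹ ^ 2 - (1 - z * q ^ n)⁻¹)))) q := by
  have hq0 := h.2.1
  have h1 : 1 - z * q ^ n ≠ 0 := sub_ne_zero.2 (h.2.2.2 n).symm
  have h2 : HasDerivAt (fun t : ℂ => 1 - z * t ^ n) (-(z * (n * q ^ (n - 1)))) q :=
    ((hasDerivAt_zpow n q (Or.inl hq0)).const_mul z).const_sub 1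
  refine ((hasDerivAt_pentCoeff hq0 n).mul (h2.fun_inv h1)).congr_deriv ?_
  rw [zpow_sub_one₀ hq0]
  field_simp
  ring

theorem AppellDomain.hasDerivAt_appellSumPow_right (h : AppellDomain z q) :
    HasDerivAt (fun t => appellSumPow 1 z t)
      (q⁻¹ * ∑' n : ℤ, pentCoeff q n * (pent n * (1 - z * q ^ n)⁻¹ +
        n * ((1 - z * q ^ n)⁻¹ ^ 2 - (1 - z * q ^ n)⁻¹))) q := by
  obtain ⟨K, b, -, hb0, hb, hev⟩ := h.exists_bound
  obtain ⟨U, hU, hUo, hqU⟩ :=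
    eventually_nhds_iff.1 ((Continuous.prodMk_right z).continuousAt.tendsto.eventually hev)
  have hs := summable_const_mul_pow_natAbs hb0 hb (K ^ 1)
  have hd : ∀ n : ℤ, DifferentiableOn ℂ (fun t => pentCoeff t n * (1 - z * t ^ n)⁻¹ ^ 1) U :=
    fun n w hw => by
      simp only [pow_one]
      exact ((hU w hw).1.hasDerivAt_term_right n).differentiableAt.differentiableWithinAt
  have hle : ∀ (n : ℤ) (w : ℂ), w ∈ U →
      ‖pentCoeff w n * (1 - z * w ^ n)⁻¹ ^ 1‖ ≤ K ^ 1 * b ^ n.natAbs := fun n w hw =>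
    norm_pentCoeff_mul_pow_le (hU w hw).2.1 hb.le 1 n ((hU w hw).2.2 n)
  have h1 := (Complex.hasSum_deriv_of_summable_norm hs hd hUo hle hqU).tsum_eq
  have h2 := ((Complex.differentiableOn_tsum_of_summable_norm hs hd hUo hle).differentiableAt
    (hUo.mem_nhds hqU)).hasDerivAt
  rw [← h1] at h2
  refine h2.congr_deriv ?_
  simp only [pow_one, (h.hasDerivAt_term_right _).deriv]
  rw [tsum_mul_left]

end TermwiseDerivatives

/-! ### The differential equation in its two forms. -/

section PDE

variable {z q : ℂ}

theorem AppellDomain.Rstar_eq (h : AppellDomain z q) :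
    Rstar z q = appellSumPow 1 z q / qPochInf q q := by
  have h1 : 1 - z ≠ 0 := sub_ne_zero.2 (by simpa using (h.2.2.2 0).symm)
  have h2 : appellSumPow 1 z q = appellSum z q := by simp [appellSumPow, appellSum]
  rw [Rstar, R_eq_appellSum h.2.2.1 h.2.1 h.1 h.2.2.2, h2]
  field_simp

theorem AppellDomain.deltaZ_Rstar (h : AppellDomain z q) :
    deltaZ Rstar z q = (appellSumPow 2 z q - appellSumPow 1 z q) / qPochInf q q := by
  have h1 : (fun w => Rstar w q) =ᶠ[𝓝 z] fun w => appellSumPow 1 w q / qPochInf q q :=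
    h.eventually_left.mono fun w hw => hw.Rstar_eq
  have hz := h.1
  rw [deltaZ, h1.deriv_eq, ((h.hasDerivAt_appellSumPow 1).div_const _).deriv]
  field_simp
  simp

theorem AppellDomain.deltaZ_deltaZ_Rstar (h : AppellDomain z q) :
    deltaZ (deltaZ Rstar) z q =
      (2 * appellSumPow 3 z q - 3 * appellSumPow 2 z q + appellSumPow 1 z q) / qPochInf q q := by
  have h1 : (fun w => deltaZ Rstar w q) =ᶠ[𝓝 z]
      fun w => (appellSumPow 2 w q - appellSumPow 1 w q) / qPochInf q q :=
    h.eventually_left.mono fun w hw => hw.deltaZ_Rstar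
  have hz := h.1
  rw [deltaZ, h1.deriv_eq, (((h.hasDerivAt_appellSumPow 2).fun_sub
    (h.hasDerivAt_appellSumPow 1)).div_const _).deriv]
  field_simp
  push_cast
  ring

theorem AppellDomain.deltaQ_Rstar (h : AppellDomain z q) :
    deltaQ Rstar z q =
      (∑' n : ℤ, pentCoeff q n * (pent n * (1 - z * q ^ n)⁻¹ +
        n * ((1 - z * q ^ n)⁻¹ ^ 2 - (1 - z * q ^ n)⁻¹))) / qPochInf q q -
      appellSumPow 1 z q * (∑' n : ℤ, pent n * pentCoeff q n) / qPochInf q q ^ 2 := by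
  have hq0 := h.2.1
  have hE := qPochInf_ne_zero h.2.2.1 (mul_pow_self_ne_one h.2.2.1)
  have hEq := qPochInf_self_eq_tsum_pentCoeff h.2.2.1 hq0
  -- Replacing (t)_∞ by the pentagonal series lets the denominator be differentiated termwise.
  have h1 : (fun t => Rstar z t) =ᶠ[𝓝 q] fun t => appellSumPow 1 z t / ∑' n, pentCoeff t n :=
    h.eventually_right.mono fun t ht => by
      simp only
      rw [ht.Rstar_eq, qPochInf_self_eq_tsum_pentCoeff ht.2.2.1 ht.2.1]
  rw [deltaQ, h1.deriv_eq, (h.hasDerivAt_appellSumPow_right.fun_div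
    (hasDerivAt_tsum_pentCoeff h.2.2.1 hq0) (hEq ▸ hE)).deriv, ← hEq]
  field_simp

theorem AppellDomain.summable_polarPart (h : AppellDomain z q) (c : ℂ) :
    Summable fun n : ℤ => pentCoeff q n * polarPart c n (1 - z * q ^ n)⁻¹ := by
  obtain ⟨K, b, -, -, -, hev⟩ := h.exists_bound
  obtain ⟨-, -, h3⟩ := hev.self_of_nhds
  exact .of_norm_bounded (summable_polarBound c K (norm_nonneg q) h.2.2.1) fun n =>
    norm_pentCoeff_mul_polarPart_le h.2.2.1 c n (h3 n)

theorem AppellDomain.polarSeries_eq (h : AppellDomain z q) (c : ℂ) :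
    polarSeries c q z = (appellSumPow 3 z q - appellSumPow 2 z q) +
      3 * (∑' n : ℤ, pentCoeff q n * (pent n * (1 - z * q ^ n)⁻¹ +
        n * ((1 - z * q ^ n)⁻¹ ^ 2 - (1 - z * q ^ n)⁻¹))) + c * appellSumPow 1 z q := by
  have s1 := h.summable_pow 1
  have s2 := h.summable_pow 2
  have s3 := h.summable_pow 3
  have e : ∀ n : ℤ, pentCoeff q n * polarPart c n (1 - z * q ^ n)⁻¹ -
      (pentCoeff q n * (1 - z * q ^ n)⁻¹ ^ 3 - pentCoeff q n * (1 - z * q ^ n)⁻¹ ^ 2 +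
        c * (pentCoeff q n * (1 - z * q ^ n)⁻¹ ^ 1)) =
      3 * (pentCoeff q n * (pent n * (1 - z * q ^ n)⁻¹ +
        n * ((1 - z * q ^ n)⁻¹ ^ 2 - (1 - z * q ^ n)⁻¹))) := fun n => by
    rw [polarPart]; ring
  rw [← tsum_mul_left]
  simp only [← e]
  rw [(h.summable_polarPart c).tsum_sub ((s3.sub s2).add (s1.mul_left c)),
    (s3.sub s2).tsum_add (s1.mul_left c), s3.tsum_sub s2, tsum_mul_left, polarSeries, appellSumPow,
    appellSumPow, appellSumPow]
  ring

theorem summable_pent_mul_pentCoeff (hq : ‖q‖ < 1) : Summable fun n : ℤ => pent n * pentCoeff q n := by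
  refine .of_norm_bounded ((summable_natAbs_pow_mul_geometric (norm_nonneg q) hq 2).mul_left 2)
    fun n => ?_
  rw [norm_mul, Complex.norm_natCast, ← mul_assoc]
  refine mul_le_mul ?_ (norm_pentCoeff_le le_rfl hq.le n) (norm_nonneg _) (by positivity)
  exact_mod_cast pent_le n

/-- The rank–crank PDE for `R*` and `C*` when `q ≠ 0`. -/
theorem AppellDomain.pde_Rstar (h : AppellDomain z q) :
    z * qPochInf q q ^ 2 * Cstar z q ^ 3 =
      3 * deltaQ Rstar z q + 1 / 2 * deltaZ Rstar z q + 1 / 2 * deltaZ (deltaZ Rstar) z q := by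
  obtain ⟨hz, hq0, hq, hn⟩ := id h
  obtain ⟨c, hc, hcE⟩ := exists_cubeQuot_eq_polarSeries hq hq0
  have hE := qPochInf_ne_zero hq (mul_pow_self_ne_one hq)
  have h1 : c * qPochInf q q + 3 * ∑' n : ℤ, pent n * pentCoeff q n = 0 := by
    rw [qPochInf_self_eq_tsum_pentCoeff hq hq0, ← tsum_mul_left, ← tsum_mul_left,
      ← ((summable_pentCoeff hq).mul_left c).tsum_add
        ((summable_pent_mul_pentCoeff hq).mul_left 3), ← hcE]
    congr 1; ext n; ring
  have h2 : cubeQuot q z = z * qPochInf q q ^ 3 * Cstar z q ^ 3 :=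
    cubeQuot_eq_Cstar hq (by simpa using hn 0) (fun n => by simpa only [zpow_natCast] using hn ((n + 1 : ℕ) : ℤ))
      fun n => inv_mul_pow_ne_one hn (n + 1)
  rw [hc z hz hn, h.polarSeries_eq c] at h2
  rw [h.deltaQ_Rstar, h.deltaZ_Rstar, h.deltaZ_deltaZ_Rstar]
  -- So c = -3 δ_q(E)/E, the logarithmic derivative needed to complete δ_q A_1 to E δ_q(A_1/E).
  have h3 : c = -(3 * ∑' n : ℤ, pent n * pentCoeff q n) / qPochInf q q := by
    rw [eq_div_iff hE]; linear_combination h1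
  rw [h3] at h2
  generalize (∑' n : ℤ, pentCoeff q n * (pent n * (1 - z * q ^ n)⁻¹ +
        n * ((1 - z * q ^ n)⁻¹ ^ 2 - (1 - z * q ^ n)⁻¹))) = X at h2 ⊢
  generalize ∑' n : ℤ, (pent n : ℂ) * pentCoeff q n = Y at h2 ⊢
  field_simp at h2 ⊢
  linear_combination (-2) * h2

theorem R_zero_right (z : ℂ) : R z 0 = 1 := by
  simp [R]

/-- At q = 0 the bilateral sums make no sense, but R = 1 and C = 1 there, so the q-derivative term
drops out and both sides are elementary in z. -/
theorem pde_Rstar_zero (hz1 : z ≠ 1) :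
    z * qPochInf 0 0 ^ 2 * Cstar z 0 ^ 3 =
      3 * deltaQ Rstar z 0 + 1 / 2 * deltaZ Rstar z 0 + 1 / 2 * deltaZ (deltaZ Rstar) z 0 := by
  have hE : qPochInf 0 0 = 1 := by simp [qPochInf]
  have hC : Cstar z 0 = (1 - z)⁻¹ := by simp [Cstar, C]
  have hR : (fun w => Rstar w 0) = fun w => (1 - w)⁻¹ := by
    ext w; rw [Rstar, R_zero_right, one_div]
  have hd : ∀ w : ℂ, w ≠ 1 → HasDerivAt (fun w : ℂ => (1 - w)⁻¹) (1 / (1 - w) ^ 2) w := fun w hw => by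
    refine (((hasDerivAt_id w).const_sub 1).fun_inv (sub_ne_zero.2 hw.symm)).congr_deriv ?_
    simp
  have h1 : ∀ w : ℂ, w ≠ 1 → deltaZ Rstar w 0 = w * (1 - w)⁻¹ ^ 2 := fun w hw => by
    rw [deltaZ, hR, (hd w hw).deriv, one_div, inv_pow]
  have h2 : deltaZ (deltaZ Rstar) z 0 =
      z * (1 * (1 - z)⁻¹ ^ 2 + z * (2 * (1 - z)⁻¹ ^ 1 * (1 / (1 - z) ^ 2))) := by
    have e : (fun w => deltaZ Rstar w 0) =ᶠ[𝓝 z] fun w => w * (1 - w)⁻¹ ^ 2 :=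
      (eventually_ne_nhds hz1).mono h1
    rw [deltaZ, e.deriv_eq, ((hasDerivAt_id' z).fun_mul ((hd z hz1).fun_pow 2)).deriv]
    norm_num
  have hz : 1 - z ≠ 0 := sub_ne_zero.2 hz1.symm
  rw [hE, hC, h2, h1 z hz1, deltaQ]
  field_simp
  ring

theorem deltaQ_R_eq (hz1 : z ≠ 1) : deltaQ R z q = (1 - z) * deltaQ Rstar z q := by
  have hz : 1 - z ≠ 0 := sub_ne_zero.2 hz1.symm
  have e : (fun t => R z t) = fun t => (1 - z) * Rstar z t := by
    ext t; rw [Rstar]; field_simp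
  rw [deltaQ, deltaQ, e, deriv_const_mul_field]
  ring

/-- The two forms of the right-hand side of the rank–crank PDE agree. -/
theorem pde_rhs_eq (hz1 : z ≠ 1) (hR : AnalyticAt ℂ (fun w => R w q) z) :
    3 * (1 - z) ^ 2 * deltaQ R z q + 1 / 2 * (1 - z) ^ 2 * deltaZ (deltaZ R) z q
        - 1 / 2 * (z ^ 2 - 1) * deltaZ R z q + z * R z q =
      (1 - z) ^ 3 * (3 * deltaQ Rstar z q + 1 / 2 * deltaZ Rstar z q
        + 1 / 2 * deltaZ (deltaZ Rstar) z q) := by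
  have hz : 1 - z ≠ 0 := sub_ne_zero.2 hz1.symm
  have hS : AnalyticAt ℂ (fun w => Rstar w q) z :=
    hR.div (analyticAt_const.sub analyticAt_id) hz
  have hmul : ∀ w : ℂ, w ≠ 1 → R w q = (1 - w) * Rstar w q := fun w hw => by
    have : 1 - w ≠ 0 := sub_ne_zero.2 hw.symm
    rw [Rstar]; field_simp
  have h1 : ∀ᶠ w in 𝓝 z, deltaZ R w q = -w * Rstar w q + (1 - w) * deltaZ Rstar w q := by
    filter_upwards [hS.eventually_analyticAt, eventually_ne_nhds hz1] with w hw hw1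
    have e : (fun x => R x q) =ᶠ[𝓝 w] fun x => (1 - x) * Rstar x q :=
      (eventually_ne_nhds hw1).mono hmul
    rw [deltaZ, deltaZ, e.deriv_eq,
      (((hasDerivAt_id' w).const_sub 1).fun_mul hw.differentiableAt.hasDerivAt).deriv]
    ring
  have h2 : deltaZ (deltaZ R) z q =
      -z * Rstar z q - 2 * z * deltaZ Rstar z q + (1 - z) * deltaZ (deltaZ Rstar) z q := by
    have hd : DifferentiableAt ℂ (fun w => deltaZ Rstar w q) z :=
      (analyticAt_id.mul hS.deriv).differentiableAt
    have e : (fun w => deltaZ R w q) =ᶠ[𝓝 z]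
      fun w => -w * Rstar w q + (1 - w) * deltaZ Rstar w q := h1
    rw [deltaZ, e.deriv_eq, (((hasDerivAt_neg' z).fun_mul hS.differentiableAt.hasDerivAt).fun_add
      (((hasDerivAt_id' z).const_sub 1).fun_mul hd.hasDerivAt)).deriv]
    have e1 : deltaZ Rstar z q = z * deriv (fun w => Rstar w q) z := rfl
    have e2 : deltaZ (deltaZ Rstar) z q = z * deriv (fun w => deltaZ Rstar w q) z := rfl
    rw [e2]
    linear_combination (z : ℂ) * e1
  rw [h2, h1.self_of_nhds, deltaQ_R_eq hz1, hmul z hz1]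
  ring

end PDE

/-! ### Euler products as sums over multisets. -/

section MultisetSums

theorem prod_map_replicate_add {R : Type*} [CommMonoid R] (x : ℕ → R) (a k : ℕ) (s : Multiset ℕ) :
    ((Multiset.replicate k a + s).map x).prod = x a ^ k * (s.map x).prod := by
  simp

theorem replicate_count_add_filter (a : ℕ) (s : Multiset ℕ) :
    Multiset.replicate (s.count a) a + s.filter (fun b => ¬ b = a) = s := by
  rw [← Multiset.filter_eq']
  exact Multiset.filter_add_not _ s

theorem count_replicate_add {a k : ℕ} {s : Multiset ℕ} (h : a ∉ s) :
    (Multiset.replicate k a + s).count a = k := by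
  rw [Multiset.count_add, Multiset.count_replicate_self, Multiset.count_eq_zero_of_notMem h,
    add_zero]

theorem prod_map_ne_zero {R : Type*} [CommMonoidWithZero R] {x : ℕ → R} {a : ℕ} (hx : x a = 0)
    {s : Multiset ℕ} (hs : (s.map x).prod ≠ 0) : a ∉ s := fun h =>
  hs (Multiset.prod_eq_zero (Multiset.mem_map.2 ⟨a, h, hx⟩))

theorem norm_prod_map {𝕜 : Type*} [NormedField 𝕜] (x : ℕ → 𝕜) (s : Multiset ℕ) :
    ‖(s.map x).prod‖ = (s.map fun i => ‖x i‖).prod := by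
  induction s using Multiset.induction_on with
  | empty => simp
  | cons a s ih => simp [ih]

theorem ofReal_prod_map (y : ℕ → ℝ) (s : Multiset ℕ) :
    (((s.map y).prod : ℝ) : ℂ) = (s.map fun i => (y i : ℂ)).prod := by
  induction s using Multiset.induction_on with
  | empty => simp
  | cons a s ih => simp [ih]

theorem hasSum_mul_complex {ι κ : Type*} {f : ι → ℂ} {g : κ → ℂ} {a b : ℂ} (hf : HasSum f a)
    (hg : HasSum g b) : HasSum (fun p : ι × κ => f p.1 * g p.2) (a * b) :=
  hf.mul hg (summable_mul_of_summable_norm hf.summable.norm hg.summable.norm)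

/-- Setting the weight to 0 off F discards multisets with other elements. Adding a to F multiplies
by a geometric series: a multiset is k copies of a together with a multiset avoiding a. -/
theorem hasSum_prod_map_finset {x : ℕ → ℂ} (hx : ∀ i, ‖x i‖ < 1)
    (F : Finset ℕ) : HasSum (fun s : Multiset ℕ => (s.map fun i => if i ∈ F then x i else 0).prod)
      (∏ i ∈ F, (1 - x i)⁻¹) := by
  induction F using Finset.induction_on with
  | empty =>
    rw [prod_empty]
    have h := hasSum_single (f := fun s : Multiset ℕ =>
      (s.map fun i => if i ∈ (∅ : Finset ℕ) then x i else 0).prod) 0 fun s hs => by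
        obtain ⟨a, ha⟩ := Multiset.exists_mem_of_ne_zero hs
        by_contra h
        exact prod_map_ne_zero (a := a) (by simp) h ha
    simpa using h
  | insert a F ha ih =>
    rw [prod_insert ha]
    have hg : HasSum (fun k => x a ^ k) (1 - x a)⁻¹ := hasSum_geometric_of_norm_lt_one (hx a)
    have hm := hasSum_mul_complex hg ih
    have hz : ∀ {p : ℕ × Multiset ℕ},
        x a ^ p.1 * (p.2.map fun i => if i ∈ F then x i else 0).prod ≠ 0 → a ∉ p.2 := fun h =>
      prod_map_ne_zero (by simp [ha]) (right_ne_zero_of_mul h)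
    have hcongr : ∀ s : Multiset ℕ, a ∉ s →
        (s.map fun i => if i ∈ insert a F then x i else 0) =
          s.map fun i => if i ∈ F then x i else 0 := fun s hs => by
      refine Multiset.map_congr rfl fun b hb => ?_
      have : b ≠ a := fun h => hs (h ▸ hb)
      simp [this]
    refine (hasSum_iff_hasSum_of_ne_zero_bij
      (fun p => Multiset.replicate p.1.1 a + p.1.2) ?_ ?_ ?_).2 hm
    · rintro ⟨⟨k, s⟩, h⟩ ⟨⟨k', s'⟩, h'⟩ he
      simp only at he
      have e1 : k = k' := by
        rw [← count_replicate_add (k := k) (hz h), ← count_replicate_add (k := k') (hz h'), he]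
      subst e1
      rw [add_right_inj] at he
      simp [he]
    · intro s hs
      have h1 : a ∉ s.filter (fun b => ¬ b = a) := by simp
      have h2 := replicate_count_add_filter a s
      refine ⟨⟨(s.count a, s.filter fun b => ¬ b = a), ?_⟩, h2⟩
      rw [Function.mem_support, ← h2, prod_map_replicate_add, hcongr _ h1] at hs
      simpa using hs
    · rintro ⟨⟨k, s⟩, h⟩
      simp only
      rw [prod_map_replicate_add, hcongr s (hz h)]
      simp

variable {x : ℕ → ℂ}

/-- Finitely many multisets involve finitely many elements, so a partial sum is at most a finite
product of 1/(1-|x_i|), itself at most the inverse of the positive infinite product. -/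
theorem summable_norm_prod_map (hs : Summable fun i => ‖x i‖) (hx : ∀ i, ‖x i‖ < 1) :
    Summable fun s : Multiset ℕ => ‖(s.map x).prod‖ := by
  have hpos : ∀ i, 0 < 1 - ‖x i‖ := fun i => sub_pos.2 (hx i)
  have hm : Multipliable fun i => 1 + -‖x i‖ := multipliable_one_add_of_summable (by simpa using hs)
  have hne : ∏' i, (1 + -‖x i‖) ≠ 0 := tprod_one_add_ne_zero_of_summable
    (fun i => by rw [← sub_eq_add_neg]; exact (hpos i).ne') (by simpa using hs)
  have hle : ∀ F : Finset ℕ, ∏' i, (1 + -‖x i‖) ≤ ∏ i ∈ F, (1 - ‖x i‖) := fun F => by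
    refine le_of_tendsto hm.hasProd ?_
    filter_upwards [eventually_ge_atTop F] with G hG
    simp only [← sub_eq_add_neg]
    rw [← prod_sdiff hG]
    refine mul_le_of_le_one_left (prod_nonneg fun i _ => (hpos i).le)
      (prod_le_one (fun i _ => (hpos i).le) fun i _ => by simp)
  have h0 : 0 < ∏' i, (1 + -‖x i‖) := by
    refine lt_of_le_of_ne (ge_of_tendsto hm.hasProd (.of_forall fun F => ?_)) hne.symm
    simp only [← sub_eq_add_neg]
    exact prod_nonneg fun i _ => (hpos i).le
  refine summable_of_sum_le (c := (∏' i, (1 + -‖x i‖))⁻¹) (fun _ => norm_nonneg _) fun T => ?_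
  set F : Finset ℕ := T.biUnion Multiset.toFinset with hF
  have h1 : HasSum (fun s : Multiset ℕ => (s.map fun i => if i ∈ F then ‖x i‖ else 0).prod)
      (∏ i ∈ F, (1 - ‖x i‖)⁻¹) := by
    rw [← Complex.hasSum_ofReal]
    have := hasSum_prod_map_finset (x := fun i => (‖x i‖ : ℂ)) (fun i => by simpa using hx i) F
    simpa [ofReal_prod_map, apply_ite Complex.ofReal] using this
  have h2 : ∀ s ∈ T, ‖(s.map x).prod‖ =
      (s.map fun i => if i ∈ F then ‖x i‖ else 0).prod := fun s hs' => by
    rw [norm_prod_map]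
    congr 1
    refine Multiset.map_congr rfl fun i hi => ?_
    have : i ∈ F := mem_biUnion.2 ⟨s, hs', Multiset.mem_toFinset.2 hi⟩
    simp [this]
  rw [sum_congr rfl h2]
  refine (sum_le_hasSum T (fun s _ => ?_) h1).trans ?_
  · refine Multiset.prod_nonneg fun a ha => ?_
    obtain ⟨i, -, rfl⟩ := Multiset.mem_map.1 ha
    split_ifs <;> simp
  · rw [prod_inv_distrib]
    exact inv_anti₀ h0 (hle F)

/-- The generating function of all multisets with multiplicative weights. -/
theorem hasSum_prod_map (hs : Summable fun i => ‖x i‖) (hx : ∀ i, ‖x i‖ < 1) :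
    HasSum (fun s : Multiset ℕ => (s.map x).prod) (∏' i, (1 - x i))⁻¹ := by
  have hn := summable_norm_prod_map hs hx
  have hne' : ∀ i, 1 - x i ≠ 0 := fun i h => by
    have := hx i; rw [← sub_eq_zero.1 h, norm_one] at this; exact lt_irrefl _ this
  have hm : Multipliable fun i => 1 - x i := by
    simp only [sub_eq_add_neg]
    exact multipliable_one_add_of_summable (by simpa using hs)
  have hne : ∏' i, (1 - x i) ≠ 0 := by
    simp only [sub_eq_add_neg] at hne' ⊢
    exact tprod_one_add_ne_zero_of_summable hne' (by simpa using hs)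
  have h1 : Tendsto (fun F : Finset ℕ => ∑' s : Multiset ℕ,
      (s.map fun i => if i ∈ F then x i else 0).prod) atTop
      (𝓝 (∑' s : Multiset ℕ, (s.map x).prod)) := by
    refine tendsto_tsum_of_dominated_convergence hn (fun s => ?_) (.of_forall fun F s => ?_)
    · refine tendsto_const_nhds.congr' ?_
      filter_upwards [eventually_ge_atTop s.toFinset] with F hF
      congr 1
      exact Multiset.map_congr rfl fun i hi => by simp [hF (Multiset.mem_toFinset.2 hi)]
    · by_cases h : ∀ i ∈ s, i ∈ F
      · refine le_of_eq ?_
        congr 2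
        exact Multiset.map_congr rfl fun i hi => by simp [h i hi]
      · push Not at h
        obtain ⟨i, hi, hiF⟩ := h
        rw [Multiset.prod_eq_zero (Multiset.mem_map.2 ⟨i, hi, by simp [hiF]⟩), norm_zero]
        exact norm_nonneg _
  simp only [(hasSum_prod_map_finset hx _).tsum_eq, prod_inv_distrib] at h1
  have h2 : Tendsto (fun F => ∏ i ∈ F, (1 - x i)) atTop (𝓝 (∏' i, (1 - x i))) := hm.hasProd
  rw [← tendsto_nhds_unique h1 (h2.inv₀ hne)]
  exact hn.of_norm.hasSum

/-- The generating function of multisets containing `a` exactly `j` times, where `a` does not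
contribute to the weight. -/
theorem hasSum_prod_map_count (hs : Summable fun i => ‖x i‖) (hx : ∀ i, ‖x i‖ < 1) {a : ℕ}
    (ha : x a = 0) (j : ℕ) :
    HasSum (fun s : Multiset ℕ => if s.count a = j then
      ((s.filter fun b => ¬ b = a).map x).prod else 0) (∏' i, (1 - x i))⁻¹ := by
  have hfil : ∀ s : Multiset ℕ, a ∉ s →
      (Multiset.replicate j a + s).filter (fun b => ¬ b = a) = s := fun s h => by
    rw [Multiset.filter_add, Multiset.filter_eq_self (s := s) (p := fun b => ¬ b = a).2
        fun b hb hba => h (by rw [← hba]; exact hb),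
      Multiset.filter_eq_nil.2 fun b hb => by simp [Multiset.eq_of_mem_replicate hb]]
    simp
  refine (hasSum_iff_hasSum_of_ne_zero_bij (fun p => Multiset.replicate j a + p.1)
    ?_ ?_ ?_).2 (hasSum_prod_map hs hx)
  · rintro ⟨s, h⟩ ⟨s', h'⟩ he
    simpa using he
  · intro s h
    rw [Function.mem_support, ite_ne_right_iff] at h
    refine ⟨⟨s.filter fun b => ¬ b = a, h.2⟩, ?_⟩
    simp only
    rw [← h.1]
    exact replicate_count_add_filter a s
  · rintro ⟨s, h⟩
    have h1 := prod_map_ne_zero ha h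
    simp only
    rw [if_pos (count_replicate_add h1), hfil s h1]

end MultisetSums

/-! ### Sums over partitions and regrouping by a statistic. -/

section PartitionSums

/-- Partitions of all sizes are exactly the multisets of naturals without 0, so a weight killed by
the part 0 has the same sum over both. -/
theorem hasSum_partition_iff {φ : Multiset ℕ → ℂ} (h0 : ∀ s, 0 ∈ s → φ s = 0) {a : ℂ} :
    HasSum (fun p : Σ n : ℕ, n.Partition => φ p.2.parts) a ↔ HasSum φ a := by
  have hinj : Function.Injective fun p : Σ n : ℕ, n.Partition => p.2.parts := by
    rintro ⟨n, p⟩ ⟨m, p'⟩ h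
    simp only at h
    obtain rfl : n = m := by rw [← p.parts_sum, ← p'.parts_sum, h]
    rw [Nat.Partition.ext h]
  refine hinj.hasSum_iff (f := φ) fun s hs => h0 s ?_
  by_contra h
  exact hs ⟨⟨s.sum, s, fun {i} hi => Nat.pos_of_ne_zero fun h' => h (h' ▸ hi), rfl⟩, rfl⟩

/-- Summation of a series over the fibres of a map, given the sums over the fibres of the series
and of the series of norms. -/
theorem hasSum_of_fibers {ι κ : Type*} [DecidableEq κ] {f : ι → ℂ} (g : ι → κ) {S S' : κ → ℂ}
    {a : ℂ} (h : ∀ k, HasSum (fun p => if g p = k then f p else 0) (S k))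
    (h' : ∀ k, HasSum (fun p => if g p = k then (‖f p‖ : ℂ) else 0) (S' k))
    (hS' : Summable fun k => ‖S' k‖) (hS : HasSum S a) : HasSum f a := by
  set F : κ → ι → ℂ := fun k p => if g p = k then f p else 0 with hF
  have hnorm : ∀ k p, ((‖F k p‖ : ℝ) : ℂ) = if g p = k then (‖f p‖ : ℂ) else 0 := fun k p => by
    simp only [hF]
    split_ifs <;> simp
  have hrow : ∀ k, ((∑' p, ‖F k p‖ : ℝ) : ℂ) = S' k := fun k => by
    rw [Complex.ofReal_tsum, ← (h' k).tsum_eq]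
    exact tsum_congr fun p => hnorm k p
  have hs : Summable (Function.uncurry F) := by
    refine Summable.of_norm ((summable_prod_of_nonneg fun _ => norm_nonneg _).2
      ⟨fun k => (h k).summable.norm, ?_⟩)
    refine hS'.congr fun k => ?_
    rw [← hrow, Complex.norm_real, Real.norm_of_nonneg (tsum_nonneg fun _ => norm_nonneg _)]
    rfl
  have hcol : ∀ p, ∑' k, F k p = f p := fun p => by
    simp only [hF]
    rw [tsum_eq_single (g p) fun k hk => if_neg (Ne.symm hk), if_pos rfl]
  have h1 : HasSum (fun p => ∑' k, F k p) (∑' p, ∑' k, F k p) := by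
    have := hs.prod_symm.prod
    exact this.hasSum
  rw [hs.tsum_comm] at h1
  simp only [hcol] at h1
  have h2 : ∑' k, ∑' p, F k p = a := by
    rw [← hS.tsum_eq]
    exact tsum_congr fun k => (h k).tsum_eq
  rwa [h2] at h1

/-- Regrouping a sum over partitions according to a statistic and the size. -/
theorem hasSum_statistic {z q a : ℂ} (st : ∀ {n : ℕ}, n.Partition → ℤ)
    (h : HasSum (fun p : Σ n : ℕ, n.Partition => z ^ st p.2 * q ^ p.1) a) :
    HasSum (fun c : ℤ × ℕ =>
      ((univ.filter fun p : c.2.Partition => st p = c.1).card : ℂ) * z ^ c.1 * q ^ c.2) a := by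
  set φ : (Σ n : ℕ, n.Partition) → ℤ × ℕ := fun p => (st p.2, p.1) with hφ
  rw [← (Equiv.sigmaFiberEquiv φ).hasSum_iff] at h
  refine h.sigma fun c => ?_
  obtain ⟨m, n⟩ := c
  let e : {p : n.Partition // st p = m} ≃ {p : Σ n : ℕ, n.Partition // φ p = (m, n)} :=
    Equiv.ofBijective (fun p => ⟨⟨n, p.1⟩, by simp [hφ, p.2]⟩) ⟨fun p p' h => by
      simpa [Subtype.ext_iff] using h, by
      rintro ⟨⟨n', p⟩, hp⟩
      obtain ⟨h1, h2⟩ := Prod.mk.inj hp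
      simp only at h1 h2
      subst h2
      exact ⟨⟨p, h1⟩, rfl⟩⟩
  rw [← e.hasSum_iff]
  have h2 := hasSum_fintype (fun _ : {p : n.Partition // st p = m} => z ^ m * q ^ n)
  rw [sum_const, card_univ, Fintype.card_subtype, nsmul_eq_mul, ← mul_assoc] at h2
  refine h2.congr_fun fun p => ?_
  change z ^ st p.1 * q ^ n = _
  rw [p.2]

end PartitionSums

/-! ### The rank generating function. -/

section RankGeneratingFunction

variable {z w q : ℂ}

theorem norm_mul_pow_lt_one {a : ℂ} (hq : ‖q‖ < 1) (ha : ‖a‖ < 1) (i : ℕ) : ‖a * q ^ i‖ < 1 := by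
  rw [norm_mul, norm_pow]
  exact mul_lt_one_of_nonneg_of_lt_one_left (norm_nonneg _) ha (pow_le_one₀ (norm_nonneg _) hq.le)

/-- The generating function, by number of parts and size, of the partitions with all parts in
`[L, L + k)`. -/
theorem hasSum_parts_mem_Ico (hq : ‖q‖ < 1) {L : ℕ} (hL : 1 ≤ L) (hw : ‖w * q ^ L‖ < 1) (k : ℕ) :
    HasSum (fun p : Σ n : ℕ, n.Partition =>
      if ∀ i ∈ p.2.parts, i ∈ Finset.Ico L (L + k) then w ^ p.2.parts.card * q ^ p.1 else 0)
      (qPoch (w * q ^ L) q k)⁻¹ := by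
  set x : ℕ → ℂ := fun i => if i ∈ Finset.Ico L (L + k) then w * q ^ i else 0 with hx
  have hx1 : ∀ i, ‖x i‖ < 1 := fun i => by
    simp only [hx]
    split_ifs with h
    · have := norm_mul_pow_lt_one hq hw (i - L)
      rwa [mul_assoc, ← pow_add, Nat.add_sub_cancel' (Finset.mem_Ico.1 h).1] at this
    · simp
  have hs : Summable fun i => ‖x i‖ :=
    summable_of_ne_finset_zero (s := Finset.Ico L (L + k)) fun i hi => by
      simp only [hx, if_neg hi, norm_zero]
  have hp : ∏' i, (1 - x i) = qPoch (w * q ^ L) q k := by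
    rw [tprod_eq_prod (s := Finset.Ico L (L + k)) fun i hi => by
        simp only [hx, if_neg hi, sub_zero],
      prod_Ico_eq_prod_range, Nat.add_sub_cancel_left, qPoch]
    refine prod_congr rfl fun i hi => ?_
    have : L + i ∈ Finset.Ico L (L + k) := by
      have := Finset.mem_range.1 hi; simp [this]
    simp only [hx, if_pos this]
    ring
  have hφ : ∀ s : Multiset ℕ, (s.map x).prod =
      if ∀ i ∈ s, i ∈ Finset.Ico L (L + k) then w ^ s.card * q ^ s.sum else 0 := fun s => by
    induction s using Multiset.induction_on with
    | empty => simp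
    | cons a s ih =>
      simp only [Multiset.map_cons, Multiset.prod_cons, ih, Multiset.forall_mem_cons,
        Multiset.card_cons, Multiset.sum_cons]
      simp only [hx]
      by_cases h1 : a ∈ Finset.Ico L (L + k)
      · by_cases h2 : ∀ i ∈ s, i ∈ Finset.Ico L (L + k)
        · rw [if_pos h1, if_pos h2, if_pos ⟨h1, h2⟩]
          ring
        · rw [if_neg h2, mul_zero, if_neg (not_and_of_not_right _ h2)]
      · rw [if_neg h1, zero_mul, if_neg (not_and_of_not_left _ h1)]
  have h := hasSum_prod_map hs hx1
  rw [hp, ← hasSum_partition_iff fun s h0 =>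
    Multiset.prod_eq_zero (Multiset.mem_map.2 ⟨0, h0, by simp [hx]; omega⟩)] at h
  refine h.congr_fun fun p => ?_
  rw [hφ, p.2.parts_sum]

theorem largestPart_le_iff {n : ℕ} (p : n.Partition) (m : ℕ) :
    largestPart p ≤ m ↔ ∀ i ∈ p.parts, i ≤ m := Multiset.sup_le

theorem parts_mem_Ico_one_iff {n : ℕ} (p : n.Partition) (m : ℕ) :
    (∀ i ∈ p.parts, i ∈ Finset.Ico 1 (1 + m)) ↔ largestPart p ≤ m := by
  rw [largestPart_le_iff]
  refine forall₂_congr fun i hi => ?_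
  have := p.parts_pos hi
  rw [Finset.mem_Ico]
  omega

theorem ite_eq_succ_eq_sub {m k : ℕ} (a : ℂ) :
    (if m = k + 1 then a else 0) = (if m ≤ k + 1 then a else 0) - if m ≤ k then a else 0 := by
  rcases lt_trichotomy m (k + 1) with h | h | h
  · rw [if_neg h.ne, if_pos h.le, if_pos (Nat.le_of_lt_succ h), sub_self]
  · rw [if_pos h, if_pos h.le, if_neg (by omega), sub_zero]
  · rw [if_neg (by omega), if_neg (by omega), if_neg (by omega), sub_zero]

theorem hasSum_largestPart_le (hq : ‖q‖ < 1) (hw : ‖w * q‖ < 1) (m : ℕ) :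
    HasSum (fun p : Σ n : ℕ, n.Partition =>
      if largestPart p.2 ≤ m then w ^ p.2.parts.card * q ^ p.1 else 0) (qPoch (w * q) q m)⁻¹ := by
  have h := hasSum_parts_mem_Ico (L := 1) hq le_rfl (by simpa using hw) m
  simpa only [parts_mem_Ico_one_iff, pow_one] using h

/-- The contribution of the partitions with largest part `m` to the rank generating function. -/
noncomputable def rankFiber (z w q : ℂ) : ℕ → ℂ
  | 0 => 1
  | m + 1 => z * w * q / (1 - w * q) * ((z * q) ^ m / qPoch (w * q * q) q m)

theorem hasSum_rankFiber (hq : ‖q‖ < 1) (hw : ‖w * q‖ < 1) (m : ℕ) :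
    HasSum (fun p : Σ n : ℕ, n.Partition => if largestPart p.2 = m then
      z ^ largestPart p.2 * w ^ p.2.parts.card * q ^ p.1 else 0) (rankFiber z w q m) := by
  cases m with
  | zero =>
    have h := hasSum_largestPart_le hq hw 0
    rw [qPoch_zero, inv_one] at h
    refine h.congr_fun fun p => ?_
    simp only [Nat.le_zero]
    split_ifs with h0
    · rw [h0, pow_zero, one_mul]
    · rfl
  | succ m =>
    have h := ((hasSum_largestPart_le hq hw (m + 1)).sub (hasSum_largestPart_le hq hw m)).mul_left
      (z ^ (m + 1))
    have e : z ^ (m + 1) * ((qPoch (w * q) q (m + 1))⁻¹ - (qPoch (w * q) q m)⁻¹) =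
        rankFiber z w q (m + 1) := by
      have hn := mul_pow_ne_one_of_norm_lt hq hw
      have h1 := qPoch_ne_zero hn (m + 1)
      have h2 := qPoch_ne_zero hn m
      have e1 := qPoch_succ (w * q) q m
      have e2 := qPoch_succ_left (w * q) q m
      rw [rankFiber, div_mul_div_comm, ← e2]
      field_simp
      rw [e1]
      ring
    rw [e] at h
    refine h.congr_fun fun p => ?_
    rw [← ite_eq_succ_eq_sub]
    split_ifs with h0
    · rw [h0]; ring
    · rw [mul_zero]

theorem norm_rankFiber_summable (hq : ‖q‖ < 1) (hz : ‖z * q‖ < 1) (hw : ‖w * q‖ < 1) :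
    Summable fun m => ‖rankFiber z w q m‖ := by
  rw [← summable_nat_add_iff 1]
  simp only [rankFiber, norm_mul]
  refine Summable.mul_left _ ?_
  have := summable_pow_div_qPoch (τ := z * q) (β := w * q * q) hq hz
    (mul_pow_ne_one_of_norm_lt hq (by simpa using norm_mul_pow_lt_one hq hw 1))
  exact this

/-- Rogers–Fine with β = q²/z and τ = zq, so that βτ = q³; the exponent 1 + 3n + n(n-1) is (n+1)²,
the one in the series for R. -/
theorem hasSum_rankFiber_nat (hq : ‖q‖ < 1) (hz0 : z ≠ 0) (hz : ‖z * q‖ < 1)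
    (hw : ‖z⁻¹ * q‖ < 1) : HasSum (rankFiber z z⁻¹ q) (R z q) := by
  have hn := mul_pow_ne_one_of_norm_lt hq hw
  have hwq : ‖z⁻¹ * q * q‖ < 1 := by simpa using norm_mul_pow_lt_one hq hw 1
  have hβ := mul_pow_ne_one_of_norm_lt hq hwq
  have hβτ : z⁻¹ * q * q * (z * q) = q ^ 3 := by field_simp
  have h1 := hasSum_rogersFine (τ := z * q) (β := z⁻¹ * q * q) hq hz hβ
    (by rw [hβτ, norm_pow]; exact pow_lt_one₀ (norm_nonneg _) hq (by norm_num))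
  have h2 := h1.mul_left (z * z⁻¹ * q / (1 - z⁻¹ * q))
  have h3 := (summable_pow_div_qPoch (τ := z * q) (β := z⁻¹ * q * q) hq hz
    hβ).of_norm.hasSum.mul_left (z * z⁻¹ * q / (1 - z⁻¹ * q))
  rw [← h2.tsum_eq] at h3
  have h4 := HasSum.zero_add (f := rankFiber z z⁻¹ q) h3
  have e : rankFiber z z⁻¹ q 0 + ∑' n : ℕ, z * z⁻¹ * q / (1 - z⁻¹ * q) *
      ((z⁻¹ * q * q * (z * q)) ^ n * q ^ (n * (n - 1)) /
        (qPoch (z⁻¹ * q * q) q n * qPoch (z * q) q (n + 1))) = R z q := by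
    rw [R, rankFiber]
    congr 1
    refine tsum_congr fun n => ?_
    have hexp : q * (q ^ 3) ^ n * q ^ (n * (n - 1)) = q ^ ((n + 1) ^ 2) := by
      rw [← pow_mul, ← pow_succ', ← pow_add]
      congr 1
      cases n with
      | zero => rfl
      | succ n => simp only [Nat.add_sub_cancel]; ring
    rw [hβτ, ← hexp, qPoch_succ_left (z⁻¹ * q), div_mul_div_comm, mul_inv_cancel₀ hz0]
    congr 1 <;> ring
  rwa [e] at h4

/-- The generating function of the ranks, summed over all partitions. -/
theorem hasSum_rank (hq : ‖q‖ < 1) (hz0 : z ≠ 0) (hz : ‖z * q‖ < 1) (hw : ‖z⁻¹ * q‖ < 1) :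
    HasSum (fun p : Σ n : ℕ, n.Partition => z ^ rank p.2 * q ^ p.1) (R z q) := by
  have h : HasSum (fun p : Σ n : ℕ, n.Partition =>
      z ^ largestPart p.2 * z⁻¹ ^ p.2.parts.card * q ^ p.1) (R z q) := by
    -- The norms of the terms are the same expressions at |z|, |z⁻¹|, |q|, so the fibre sums of the
    -- norms need no separate computation.
    have hq' : ‖(‖q‖ : ℂ)‖ < 1 := by simpa using hq
    have hz' : ‖(‖z‖ : ℂ) * ‖q‖‖ < 1 := by simpa using hz
    have hw' : ‖(‖z⁻¹‖ : ℂ) * ‖q‖‖ < 1 := by simpa using hw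
    refine hasSum_of_fibers
      (f := fun p : Σ n : ℕ, n.Partition =>
        z ^ largestPart p.2 * z⁻¹ ^ p.2.parts.card * q ^ p.1)
      (fun p => largestPart p.2) (S := rankFiber z z⁻¹ q) (S' := rankFiber ‖z‖ ‖z⁻¹‖ ‖q‖)
      (hasSum_rankFiber hq hw) (fun k => ?_) (norm_rankFiber_summable hq' hz' hw')
      (hasSum_rankFiber_nat hq hz0 hz hw)
    have hf := hasSum_rankFiber (z := (‖z‖ : ℂ)) hq' hw' k
    refine hf.congr_fun fun p => ?_
    simp only [norm_mul, norm_pow, Complex.ofReal_mul, Complex.ofReal_pow]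
  refine h.congr_fun fun p => ?_
  rw [rank, zpow_sub₀ hz0, zpow_natCast, zpow_natCast, inv_pow, div_eq_mul_inv]

end RankGeneratingFunction

/-! ### The crank generating function. -/

section CrankGeneratingFunction

variable {z q : ℂ}

/-- Partitions are grouped by their largest part if there are no ones, and otherwise by minus the
number of ones. -/
def crankKey {n : ℕ} (p : n.Partition) : ℤ :=
  if numOnes p = 0 then (largestPart p : ℤ) else -(numOnes p : ℤ)

/-- The contribution to the crank generating function of a group of partitions. -/
noncomputable def crankFiber (z q : ℂ) : ℤ → ℂ
  | Int.ofNat m =>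
    (1 - q) * ((z * q) ^ m / qPoch q q m) + (if m = 0 then q else 0) - if m = 1 then z * q else 0
  | Int.negSucc j =>
    z⁻¹ ^ (j + 1) * q ^ (j + 1) * (qPoch (q * q) q j * qPochInf (z * q * q ^ (j + 1)) q)⁻¹

/-- Truncated subtraction matters: for m = 0 and m = 1 the interval is empty, and the right side
also leaves only the empty partition. -/
theorem parts_mem_Ico_two_iff {n : ℕ} (p : n.Partition) (m : ℕ) :
    (∀ i ∈ p.parts, i ∈ Finset.Ico 2 (2 + (m - 1))) ↔ numOnes p = 0 ∧ largestPart p ≤ m := by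
  rw [largestPart_le_iff, numOnes, Multiset.count_eq_zero]
  constructor
  · intro h
    refine ⟨fun h1 => ?_, fun i hi => ?_⟩
    · have := Finset.mem_Ico.1 (h 1 h1); omega
    · have := Finset.mem_Ico.1 (h i hi); omega
  · rintro ⟨h1, h2⟩ i hi
    have h3 := p.parts_pos hi
    have h4 := h2 i hi
    have h5 : i ≠ 1 := fun h => h1 (h ▸ hi)
    rw [Finset.mem_Ico]
    omega

theorem hasSum_no_ones (hq : ‖q‖ < 1) (m : ℕ) :
    HasSum (fun p : Σ n : ℕ, n.Partition =>
      if numOnes p.2 = 0 ∧ largestPart p.2 ≤ m then q ^ p.1 else 0)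
      (qPoch (q * q) q (m - 1))⁻¹ := by
  have h := hasSum_parts_mem_Ico (w := 1) (L := 2) hq (by norm_num)
    (by rw [one_mul, norm_pow]; exact pow_lt_one₀ (norm_nonneg _) hq (by norm_num)) (m - 1)
  simpa only [parts_mem_Ico_two_iff, one_pow, one_mul, sq] using h

theorem crankKey_eq_natCast_iff {n : ℕ} (p : n.Partition) (m : ℕ) :
    crankKey p = m ↔ numOnes p = 0 ∧ largestPart p = m := by
  unfold crankKey
  split_ifs with h
  · simp [h]
  · constructor
    · intro h'; omega
    · rintro ⟨h', -⟩; exact absurd h' h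

theorem hasSum_crankFiber_natCast (hq : ‖q‖ < 1) (m : ℕ) :
    HasSum (fun p : Σ n : ℕ, n.Partition =>
      if crankKey p.2 = (m : ℤ) then z ^ crank p.2 * q ^ p.1 else 0) (crankFiber z q m) := by
  have hq1 : 1 - q ≠ 0 := by simpa using (sub_ne_zero.2 (mul_pow_ne_one_of_norm_lt hq hq 0).symm)
  have hsimp : ∀ p : Σ n : ℕ, n.Partition,
      (if crankKey p.2 = (m : ℤ) then z ^ crank p.2 * q ^ p.1 else 0) =
        z ^ m * if numOnes p.2 = 0 ∧ largestPart p.2 = m then q ^ p.1 else 0 := fun p => by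
    simp only [crankKey_eq_natCast_iff]
    split_ifs with h
    · rw [crank, if_pos h.1, h.2, zpow_natCast]
    · rw [mul_zero]
  simp only [hsimp]
  cases m with
  | zero =>
    have h := (hasSum_no_ones hq 0).mul_left (z ^ 0)
    have e : z ^ 0 * (qPoch (q * q) q (0 - 1))⁻¹ = crankFiber z q ((0 : ℕ) : ℤ) := by
      change _ = (1 - q) * ((z * q) ^ 0 / qPoch q q 0) + q - 0
      simp [qPoch_zero]
    rw [e] at h
    simpa only [Nat.le_zero] using h
  | succ m =>
    have h := ((hasSum_no_ones hq (m + 1)).sub (hasSum_no_ones hq m)).mul_left (z ^ (m + 1))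
    have e : z ^ (m + 1) * ((qPoch (q * q) q (m + 1 - 1))⁻¹ - (qPoch (q * q) q (m - 1))⁻¹) =
        crankFiber z q ((m + 1 : ℕ) : ℤ) := by
      change _ = (1 - q) * ((z * q) ^ (m + 1) / qPoch q q (m + 1)) + 0 -
        if m + 1 = 1 then z * q else 0
      rw [qPoch_succ_left]
      cases m with
      -- No partition has largest part 1 and no ones; the correction -zq in `crankFiber` makes this
      -- fibre 0. The correction +q similarly makes fibre 0 equal to 1.
      | zero => simp [qPoch_zero]; field_simp; simp
      | succ m =>
        have hn := mul_pow_ne_one_of_norm_lt hq (a := q * q)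
          (by simpa using norm_mul_pow_lt_one hq hq 1)
        have h1 := qPoch_ne_zero hn (m + 1)
        have h2 := qPoch_ne_zero hn m
        have e1 := qPoch_succ (q * q) q m
        simp only [Nat.add_sub_cancel, Nat.add_eq_right, Nat.add_eq_zero_iff, one_ne_zero,
          and_false, if_false]
        rw [e1, show q * q * q ^ m = q ^ (m + 2) by ring] at h1 ⊢
        generalize qPoch (q * q) q m = A at h1 h2 ⊢
        have h3 := right_ne_zero_of_mul h1
        field_simp
        ring
    rw [e] at h
    refine h.congr_fun fun p => ?_
    by_cases h0 : numOnes p.2 = 0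
    · simp only [h0, true_and]
      rw [ite_eq_succ_eq_sub]
    · simp only [h0, false_and, if_false, sub_self]

theorem crankKey_eq_negSucc_iff {n : ℕ} (p : n.Partition) (j : ℕ) :
    crankKey p = Int.negSucc j ↔ p.parts.count 1 = j + 1 := by
  unfold crankKey numOnes
  rw [Int.negSucc_eq]
  split_ifs with h <;> omega

/-- The weight of a part different from one in a partition with `j + 1` ones. -/
noncomputable def partWeight (z q : ℂ) (j i : ℕ) : ℂ :=
  if i ≤ 1 then 0 else if i ≤ j + 1 then q ^ i else z * q ^ i

theorem partWeight_add (z q : ℂ) (j i : ℕ) :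
    partWeight z q j (i + (j + 2)) = z * q ^ (i + (j + 2)) := by
  rw [partWeight, if_neg (by omega), if_neg (by omega)]

theorem norm_partWeight_lt_one (hq : ‖q‖ < 1) (hz : ‖z * q‖ < 1) (j i : ℕ) :
    ‖partWeight z q j i‖ < 1 := by
  unfold partWeight
  split_ifs with h1 h2
  · simp
  · rw [norm_pow]; exact pow_lt_one₀ (norm_nonneg _) hq (by omega)
  · obtain ⟨k, rfl⟩ : ∃ k, i = k + 1 := ⟨i - 1, by omega⟩
    rw [pow_succ', ← mul_assoc]
    exact norm_mul_pow_lt_one hq hz k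

theorem summable_norm_partWeight (hq : ‖q‖ < 1) (j : ℕ) :
    Summable fun i => ‖partWeight z q j i‖ := by
  rw [← summable_nat_add_iff (j + 2)]
  simp only [partWeight_add]
  exact (summable_nat_add_iff (j + 2)).2 (summable_norm_mul_pow hq z)

theorem tprod_one_sub_partWeight (hq : ‖q‖ < 1) (j : ℕ) :
    ∏' i, (1 - partWeight z q j i) =
      qPoch (q * q) q j * qPochInf (z * q * q ^ (j + 1)) q := by
  have e : ∀ i, 1 - partWeight z q j (i + (j + 2)) = 1 - z * q * q ^ (j + 1) * q ^ i := fun i => by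
    rw [partWeight_add]; ring
  have hm : Multipliable fun i => 1 - partWeight z q j (i + (j + 2)) := by
    simp only [e]
    exact multipliable_one_sub_mul_pow hq _
  rw [← Multipliable.prod_mul_tprod_nat_mul' (f := fun i => 1 - partWeight z q j i) (k := j + 2) hm,
    qPochInf]
  simp only [e]
  refine congrArg₂ _ ?_ rfl
  rw [prod_range_succ', prod_range_succ', qPoch]
  have e0 : partWeight z q j 0 = 0 := by simp [partWeight]
  have e1 : partWeight z q j (0 + 1) = 0 := by simp [partWeight]
  rw [e0, e1, sub_zero, mul_one, mul_one]
  refine prod_congr rfl fun i hi => ?_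
  have := Finset.mem_range.1 hi
  rw [partWeight, if_neg (by omega), if_pos (by omega)]
  ring

theorem prod_map_partWeight (z q : ℂ) (j : ℕ) {s : Multiset ℕ} (hs : ∀ i ∈ s, 2 ≤ i) :
    (s.map (partWeight z q j)).prod = z ^ s.countP (fun i => j + 1 < i) * q ^ s.sum := by
  induction s using Multiset.induction_on with
  | empty => simp
  | cons a s ih =>
    rw [Multiset.forall_mem_cons] at hs
    rw [Multiset.map_cons, Multiset.prod_cons, ih hs.2, Multiset.sum_cons, Multiset.countP_cons,
      partWeight, if_neg (by omega)]
    by_cases h : a ≤ j + 1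
    · rw [if_pos h, if_neg (by omega)]; ring
    · rw [if_neg h, if_pos (by omega)]; ring

/-- The j + 1 ones give (q/z)^{j+1}. Each other part gives a power of q, with an extra z exactly
when it exceeds the number of ones. -/
theorem weight_eq_of_count_one {z q : ℂ} (hz0 : z ≠ 0) {n : ℕ} (p : n.Partition) {j : ℕ}
    (h : p.parts.count 1 = j + 1) : z ^ crank p * q ^ n =
      z⁻¹ ^ (j + 1) * q ^ (j + 1) *
        ((p.parts.filter fun b => ¬ b = 1).map (partWeight z q j)).prod := by
  have hs := replicate_count_add_filter 1 p.parts
  have hge : ∀ i ∈ p.parts.filter (fun b => ¬ b = 1), 2 ≤ i := fun i hi => by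
    obtain ⟨h1, h2⟩ := Multiset.mem_filter.1 hi
    have := p.parts_pos h1
    omega
  have hsum : n = j + 1 + (p.parts.filter fun b => ¬ b = 1).sum := by
    have := congrArg Multiset.sum hs
    rw [Multiset.sum_add, Multiset.sum_replicate, p.parts_sum, h, smul_eq_mul, mul_one] at this
    exact this.symm
  have hcount : p.parts.countP (fun i => j + 1 < i) =
      (p.parts.filter fun b => ¬ b = 1).countP fun i => j + 1 < i := by
    conv_lhs => rw [← hs]
    rw [Multiset.countP_add, Nat.add_eq_right, Multiset.countP_eq_zero]
    intro i hi
    rw [Multiset.eq_of_mem_replicate hi]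
    omega
  have hc : crank p = (p.parts.countP fun i => j + 1 < i : ℤ) - ((j + 1 : ℕ) : ℤ) := by
    rw [crank, numOnes, h, if_neg (Nat.succ_ne_zero j)]
  rw [prod_map_partWeight z q j hge, hc, zpow_sub₀ hz0, zpow_natCast, zpow_natCast, hcount,
    show q ^ n = q ^ (j + 1) * q ^ (p.parts.filter fun b => ¬ b = 1).sum by rw [← pow_add, ← hsum],
    inv_pow]
  ring

theorem hasSum_crankFiber_negSucc (hq : ‖q‖ < 1) (hz0 : z ≠ 0) (hz : ‖z * q‖ < 1) (j : ℕ) :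
    HasSum (fun p : Σ n : ℕ, n.Partition =>
      if crankKey p.2 = Int.negSucc j then z ^ crank p.2 * q ^ p.1 else 0)
      (crankFiber z q (Int.negSucc j)) := by
  have h := hasSum_prod_map_count (summable_norm_partWeight (z := z) hq j)
    (norm_partWeight_lt_one hq hz j) (a := 1) (by simp [partWeight]) (j + 1)
  rw [tprod_one_sub_partWeight hq, ← hasSum_partition_iff fun s h0 => ?_] at h
  · refine (h.mul_left (z⁻¹ ^ (j + 1) * q ^ (j + 1))).congr_fun fun p => ?_
    simp only [crankKey_eq_negSucc_iff]
    split_ifs with h1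
    · exact weight_eq_of_count_one hz0 p.2 h1
    · rw [mul_zero]
  · split_ifs
    · exact Multiset.prod_eq_zero (Multiset.mem_map.2
        ⟨0, Multiset.mem_filter.2 ⟨h0, zero_ne_one⟩, by simp [partWeight]⟩)
    · rfl

theorem hasSum_crankFiber (hq : ‖q‖ < 1) (hz0 : z ≠ 0) (hz : ‖z * q‖ < 1) (k : ℤ) :
    HasSum (fun p : Σ n : ℕ, n.Partition =>
      if crankKey p.2 = k then z ^ crank p.2 * q ^ p.1 else 0) (crankFiber z q k) := by
  cases k with
  | ofNat m => exact hasSum_crankFiber_natCast hq m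
  | negSucc j => exact hasSum_crankFiber_negSucc hq hz0 hz j

theorem hasSum_crankFiber_nonneg (hq : ‖q‖ < 1) (hz : ‖z * q‖ < 1) :
    HasSum (fun m : ℕ => crankFiber z q m) ((1 - q) * (1 / qPochInf (z * q) q) + q - z * q) :=
  (((hasSum_pow_div_qPoch_self hq hz).mul_left (1 - q)).add (hasSum_ite_eq 0 q)).sub
    (hasSum_ite_eq 1 (z * q))

/-- The q-binomial theorem with a = zq and t = q/z, where at = q². The sum lacks the n = 0 term,
(1-q)/(zq)_∞, which is what the partitions without ones supply through Euler's expansion. -/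
theorem hasSum_crankFiber_neg (hq : ‖q‖ < 1) (hz0 : z ≠ 0) (hz : ‖z * q‖ < 1)
    (hw : ‖z⁻¹ * q‖ < 1) :
    HasSum (fun j : ℕ => crankFiber z q (-((j : ℤ) + 1)))
      (C z q - (1 - q) * (1 / qPochInf (z * q) q)) := by
  have hq1 : 1 - q ≠ 0 := by simpa using (sub_ne_zero.2 (mul_pow_ne_one_of_norm_lt hq hq 0).symm)
  have hn := mul_pow_ne_one_of_norm_lt hq hz
  have hn' := mul_pow_ne_one_of_norm_lt hq hw
  have hP := qPochInf_ne_zero hq hn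
  have hC : C z q = qPochInf q q / (qPochInf (z * q) q * qPochInf (z⁻¹ * q) q) :=
    C_eq hq (fun n => by rw [pow_succ', ← mul_assoc]; exact hn n)
      fun n => by rw [pow_succ', ← mul_assoc]; exact hn' n
  have h := ((hasSum_qBinomial hq (z * q) hw).mul_left ((1 - q) / qPochInf (z * q) q))
  have e : (1 - q) / qPochInf (z * q) q * (qPochInf (z * q * (z⁻¹ * q)) q / qPochInf (z⁻¹ * q) q) =
      C z q := by
    have e1 : z * q * (z⁻¹ * q) = q * q := by field_simp
    rw [e1, hC, qPochInf_eq_one_sub_mul hq q, div_mul_div_comm]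
  rw [e, ← hasSum_nat_add_iff' 1] at h
  simp only [range_one, sum_singleton, qPoch_zero, pow_zero, mul_one, div_one] at h
  rw [mul_one_div]
  refine h.congr_fun fun j => ?_
  rw [← Int.negSucc_eq, crankFiber, qPochInf_eq_qPoch_mul hq (z * q) (j + 1), qPoch_succ_left q,
    mul_pow]
  have h1 := qPoch_ne_zero hn (j + 1)
  field_simp

theorem hasSum_crankFiber_int (hq : ‖q‖ < 1) (hz0 : z ≠ 0) (hz : ‖z * q‖ < 1)
    (hw : ‖z⁻¹ * q‖ < 1) : HasSum (crankFiber z q) (C z q + q - z * q) := by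
  have h := (hasSum_crankFiber_nonneg hq hz).of_nat_of_neg_add_one
    (hasSum_crankFiber_neg hq hz0 hz hw)
  convert h using 1
  ring

/-- The generating function of the combinatorial cranks, summed over all partitions. -/
theorem hasSum_crank (hq : ‖q‖ < 1) (hz0 : z ≠ 0) (hz : ‖z * q‖ < 1) (hw : ‖z⁻¹ * q‖ < 1) :
    HasSum (fun p : Σ n : ℕ, n.Partition => z ^ crank p.2 * q ^ p.1) (C z q + q - z * q) := by
  have hq' : ‖(‖q‖ : ℂ)‖ < 1 := by simpa using hq
  have hz' : ‖(‖z‖ : ℂ) * ‖q‖‖ < 1 := by simpa using hz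
  have hw' : ‖(‖z‖ : ℂ)⁻¹ * ‖q‖‖ < 1 := by simpa using hw
  have hz0' : (‖z‖ : ℂ) ≠ 0 := by simpa using hz0
  refine hasSum_of_fibers (f := fun p : Σ n : ℕ, n.Partition => z ^ crank p.2 * q ^ p.1)
    (fun p => crankKey p.2) (S := crankFiber z q) (S' := crankFiber ‖z‖ ‖q‖)
    (hasSum_crankFiber hq hz0 hz) (fun k => ?_)
    (hasSum_crankFiber_int hq' hz0' hz' hw').summable.norm (hasSum_crankFiber_int hq hz0 hz hw)
  have hf := hasSum_crankFiber hq' hz0' hz' k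
  refine hf.congr_fun fun p => ?_
  simp only [norm_mul, norm_pow, norm_zpow, Complex.ofReal_mul, Complex.ofReal_pow,
    Complex.ofReal_zpow]

end CrankGeneratingFunction

/-! ### The double series with coefficients N(m,n) and M(m,n). -/

section Coefficients

variable {z q : ℂ}

theorem hasSum_N (hq : ‖q‖ < 1) (hz0 : z ≠ 0) (hz : ‖z * q‖ < 1) (hw : ‖z⁻¹ * q‖ < 1) :
    HasSum (fun c : ℤ × ℕ => (N c.1 c.2 : ℂ) * z ^ c.1 * q ^ c.2) (R z q) :=
  hasSum_statistic rank (hasSum_rank hq hz0 hz hw)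

theorem crank_partition_one (p : Nat.Partition 1) : crank p = -1 := by
  rw [Subsingleton.elim p (Nat.Partition.indiscrete 1)]
  rfl

/-- The only partition of 1 has crank -1, so the amendment just subtracts q and adds zq. This
cancels the excess q - zq of the combinatorial crank sum over C. -/
theorem M_mul_eq (c : ℤ × ℕ) : (M c.1 c.2 : ℂ) * z ^ c.1 * q ^ c.2 =
    ((univ.filter fun p : c.2.Partition => crank p = c.1).card : ℂ) * z ^ c.1 * q ^ c.2 -
      (if c = (0, 1) then q else 0) + if c = (1, 1) then z * q else 0 := by
  obtain ⟨m, n⟩ := c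
  by_cases hn : n = 1
  · subst hn
    simp only [M, crank_partition_one, if_true, Prod.mk.injEq, and_true]
    by_cases h0 : m = 0
    · subst h0; simp
    by_cases h1 : m = 1
    · subst h1; simp
    by_cases h2 : m = -1
    · subst h2; simp
    · simp [h0, h1, h2, Ne.symm h2]
  · simp [M, hn]

theorem hasSum_M (hq : ‖q‖ < 1) (hz0 : z ≠ 0) (hz : ‖z * q‖ < 1) (hw : ‖z⁻¹ * q‖ < 1) :
    HasSum (fun c : ℤ × ℕ => (M c.1 c.2 : ℂ) * z ^ c.1 * q ^ c.2) (C z q) := by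
  have h := ((hasSum_statistic crank (hasSum_crank hq hz0 hz hw)).sub
    (hasSum_ite_eq ((0, 1) : ℤ × ℕ) q)).add (hasSum_ite_eq ((1, 1) : ℤ × ℕ) (z * q))
  have e : C z q + q - z * q - q + z * q = C z q := by ring
  rw [e] at h
  exact h.congr_fun M_mul_eq

end Coefficients

theorem zpow_mul_ne_one {z q : ℂ} (hz1 : z ≠ 1)
    (hzq : ∀ n : ℕ, 1 ≤ n → z * q ^ n ≠ 1 ∧ z⁻¹ * q ^ n ≠ 1) (n : ℤ) : z * q ^ n ≠ 1 := by
  obtain ⟨m, rfl | rfl⟩ := n.eq_nat_or_neg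
  · rcases Nat.eq_zero_or_pos m with rfl | hm
    · simpa using hz1
    · simpa using (hzq m hm).1
  · rcases Nat.eq_zero_or_pos m with rfl | hm
    · simpa using hz1
    · intro h
      refine (hzq m hm).2 ?_
      rw [← inv_eq_one, mul_inv, inv_inv]
      simpa using h

end RankCrank

/-- The rank–crank PDE, on the common domain `|q| < 1`, `z ≠ 0`, `z ≠ q^{±n}` (`n ≥ 1`) of the two
generating functions. The first conjunct says that `R` and `C` are the generating functions of the
ranks and of the cranks where the double series converge; the next two say that the derivatives
exist. -/
theorem theorem1p1 (z q : ℂ) (hq : ‖q‖ < 1) (hz : z ≠ 0)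
    (hzq : ∀ n : ℕ, 1 ≤ n → z * q ^ n ≠ 1 ∧ z⁻¹ * q ^ n ≠ 1) :
    (‖z * q‖ < 1 → ‖z⁻¹ * q‖ < 1 →
      HasSum (fun p : ℤ × ℕ => (RankCrank.N p.1 p.2 : ℂ) * z ^ p.1 * q ^ p.2) (RankCrank.R z q) ∧
      HasSum (fun p : ℤ × ℕ => (RankCrank.M p.1 p.2 : ℂ) * z ^ p.1 * q ^ p.2) (RankCrank.C z q)) ∧
    AnalyticAt ℂ (fun w => RankCrank.R w q) z ∧
    AnalyticAt ℂ (fun t => RankCrank.R z t) q ∧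
    (z ≠ 1 →
      z * RankCrank.qPochInf q q ^ 2 * RankCrank.Cstar z q ^ 3 =
        3 * RankCrank.deltaQ RankCrank.Rstar z q
          + 1 / 2 * RankCrank.deltaZ RankCrank.Rstar z q
          + 1 / 2 * RankCrank.deltaZ (RankCrank.deltaZ RankCrank.Rstar) z q) ∧
    z * RankCrank.qPochInf q q ^ 2 * RankCrank.C z q ^ 3 =
      3 * (1 - z) ^ 2 * RankCrank.deltaQ RankCrank.R z q
        + 1 / 2 * (1 - z) ^ 2 * RankCrank.deltaZ (RankCrank.deltaZ RankCrank.R) z q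
        - 1 / 2 * (z ^ 2 - 1) * RankCrank.deltaZ RankCrank.R z q
        + z * RankCrank.R z q := by
  have h1 : ∀ n : ℕ, z * q ^ (n + 1) ≠ 1 := fun n => (hzq (n + 1) n.succ_pos).1
  have h2 : ∀ n : ℕ, z⁻¹ * q ^ (n + 1) ≠ 1 := fun n => (hzq (n + 1) n.succ_pos).2
  have hR := RankCrank.analyticAt_R_left hq hz h1 h2
  have hstar : z ≠ 1 → z * RankCrank.qPochInf q q ^ 2 * RankCrank.Cstar z q ^ 3 =
        3 * RankCrank.deltaQ RankCrank.Rstar z q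
          + 1 / 2 * RankCrank.deltaZ RankCrank.Rstar z q
          + 1 / 2 * RankCrank.deltaZ (RankCrank.deltaZ RankCrank.Rstar) z q := fun hz1 => by
    by_cases hq0 : q = 0
    · subst hq0
      exact RankCrank.pde_Rstar_zero hz1
    · exact RankCrank.AppellDomain.pde_Rstar
        ⟨hz, hq0, hq, RankCrank.zpow_mul_ne_one hz1 hzq⟩
  refine ⟨fun ha hb => ⟨RankCrank.hasSum_N hq hz ha hb, RankCrank.hasSum_M hq hz ha hb⟩, hR,
    RankCrank.analyticAt_R_right hq hz h1 h2, hstar, ?_⟩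
  -- At z = 1 every derivative term has coefficient 0, and both sides equal 1/(q)_∞.
  by_cases hz1 : z = 1
  · subst hz1
    have hP := RankCrank.qPochInf_ne_zero hq (RankCrank.mul_pow_self_ne_one hq)
    rw [RankCrank.C_eq hq h1 h2, RankCrank.R_one_eq hq, inv_one, one_mul]
    field_simp
    ring
  · have hne : 1 - z ≠ 0 := sub_ne_zero.2 (Ne.symm hz1)
    rw [RankCrank.pde_rhs_eq hz1 hR, ← hstar hz1, RankCrank.Cstar]
    field_simp
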